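/- **Setting.** Let $n\ge 1$, $x_1,\dots,x_n\in\mathbb R$, $c_1,c_2>0$, $w>0$, $\xi>0$, $Q\ge 0$ and $\delta,\mu,\sigma\in\mathbb R$. For $(\lambda_1,\lambda_2)$ put $\lambda_3=\xi-\lambda_1$, $b_i=\lambda_1x_i-\lambda_2/2$ and $$F(\lambda_1,\lambda_2)=\lambda_1\delta+\lambda_2\mu+\lambda_3(\sigma^2+\mu^2)+w\sum_{i=1}^n\Big(-\lambda_1x_i^2+\sup_{y\ge0}\big[c_1(y-Q)^++c_2(Q-y)^+-\xi y^2+2b_iy\big]\Big)$$ ($w=1$ gives the plain sum, $w=1/n$ the average over the empirical measure). Let $H=\{\lambda_1\ge0\}$, assume that $F$ is bounded below on $H$, and let $f(\xi,Q)=\inf_HF$. *Arrangement.* Let $\beta_1=c_1$, $\beta_2=-c_2$, $\beta_3=\frac{c_1-c_2}2-2\xi Q$, $\beta_4=c_1-2\sqrt{\xi(c_1+c_2)Q}$, and let $L_{ij}$ be the line $\lambda_2=2\lambda_1x_i+\beta_j$ ($1\le i\le n$, $1\le j\le4$). These lines cut $H$ into closed regions $\Gamma$; the nondegenerate sides of regions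 along the lines are the segments. The vertices are the points of $H$ where two different lines meet or where a line meets the axis $\lambda_1=0$. For a region $\Gamma$, on which each supremum in $F$ equals one of $g_{i0}=c_2Q$, $g_{i1}=c_2(Q-x_{i1})-\xi x_{i1}^2+2b_ix_{i1}$, $g_{i2}=c_1(x_{i2}-Q)-\xi x_{i2}^2+2b_ix_{i2}$ with $x_{i1}=\frac{2b_i-c_2}{2\xi}$, $x_{i2}=\frac{2b_i+c_1}{2\xi}$, let $F_\Gamma$ be the function on the whole plane obtained from $F$ by using on the whole plane the form that holds on $\Gamma$. *Directional Descent (DD) method.* Start at a vertex $p_0$ with the smallest value of $F$. At the current point $p$: (a) if for some region $\Gamma\ni p$ the function $F_\Gamma$ has a minimizer $m$ over $H$ (take the one nearest to $p$) with $F_\Gamma(m)<F(p)$, and the straight path from $p$ to $m$ runs into $\Gamma$, follow this path to $m$ or to the point where it leaves $\Gamma$, whichever comes first; (b) otherwise, consider the critical points on the segments $e\ni p$, that is, the points $q\in e$ with $F(q)<F(p)$ at which the derivative of $F$ along $e$ is $0$; if there are any, move to a nearest one; (c) otherwise stop and return $F(p)$. Ties are resolved arbitrarily. **Theorem.** There is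 an absolute constant $C$ such that for all $n$ and all such data: 1. $f(\xi,Q)$ is attained: $f(\xi,Q)=\min_{\lambda_1\ge0,\lambda_2}F(\lambda_1,\lambda_2)$. 2. There are at most $Cn^2$ regions, at most $Cn^2$ segments and at most $Cn^2$ vertices, and the method can be started. 3. In every run of the DD method, each region and each segment is traversed at most once, there are at most $Cn^2$ moves, and the vertices together with the regions and segments adjacent to the successive search points (counted once per search point) number at most $Cn^2$. The method never gets stuck: at each point either it stops or a move (a) or (b) exists. When it stops, it returns $f(\xi,Q)$. 4. The method can be carried out in $O(n^2)$ operations: for each $n$ there is an algebraic computation tree (operations: rational constants, $+,-,\times,/$, square root, comparison, output of a number), depending on $n$ only, which on every input $(x_1,\dots,x_n,c_1,c_2,w,\xi,Q,\delta,\mu,\sigma)$ as above executes at most $Cn^2$ operations and outputs the search points of a complete run of the DD method followed by $f(\xi,Q)$. -/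

import Mathlib

/-! ### The dual objective of the robust newsvendor problem, for fixed `ξ = λ₁ + λ₃` and `Q` -/

/-- Data of the dual problem with `n` demand observations: observations `x`, underage and overage
costs `c₁, c₂`, Wasserstein radius `δ`, moments `μ, σ`, the fixed `ξ = λ₁ + λ₃`, the fixed order
quantity `Q`, and the weight `w` of the sum over the observations (`w = 1` for the plain sum,
`w = 1/n` for the average over the empirical measure). -/
structure Newsvendor (n : ℕ) where
  x : Fin n → ℝ
  c₁ : ℝ
  c₂ : ℝ
  w : ℝ
  ξ : ℝ
  Q : ℝ
  δ : ℝ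
  μ : ℝ
  σ : ℝ

namespace Newsvendor

variable {n : ℕ} (I : Newsvendor n)

/-- The standing sign conditions. -/
structure Admissible : Prop where
  c₁_pos : 0 < I.c₁
  c₂_pos : 0 < I.c₂
  w_pos : 0 < I.w
  ξ_pos : 0 < I.ξ
  Q_nonneg : 0 ≤ I.Q

/-- The half-plane `{λ₁ ≥ 0, λ₂}`; a point `p` is `(λ₁, λ₂)`. -/
def halfPlane : Set (ℝ × ℝ) := {p | 0 ≤ p.1}

/-- `b_i = λ₁ x_i - λ₂ / 2`. -/
noncomputable def b (i : Fin n) (p : ℝ × ℝ) : ℝ := p.1 * I.x i - p.2 / 2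

/-- `g_i(y, λ, Q) = c₁ (y - Q)⁺ + c₂ (Q - y)⁺ - ξ y² + 2 b_i y`. -/
noncomputable def g (i : Fin n) (p : ℝ × ℝ) (y : ℝ) : ℝ :=
  I.c₁ * max (y - I.Q) 0 + I.c₂ * max (I.Q - y) 0 - I.ξ * y ^ 2 + 2 * I.b i p * y

/-- `sup_{y ≥ 0} g_i(y, λ, Q)`. -/
noncomputable def supg (i : Fin n) (p : ℝ × ℝ) : ℝ := sSup (I.g i p '' Set.Ici 0)

/-- The objective with the terms `sup_{y ≥ 0} g_i` replaced by given functions `h i`;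
here `λ₃ = ξ - λ₁`. -/
noncomputable def objective (h : Fin n → ℝ × ℝ → ℝ) (p : ℝ × ℝ) : ℝ :=
  p.1 * I.δ + p.2 * I.μ + (I.ξ - p.1) * (I.σ ^ 2 + I.μ ^ 2)
    + I.w * ∑ i, (-(p.1 * I.x i ^ 2) + h i p)

/-- `F(λ₁, λ₂, ξ, Q)`. -/
noncomputable def F (p : ℝ × ℝ) : ℝ := I.objective I.supg p

/-- `f(ξ, Q)`, the infimum of `F` over the half-plane. -/
noncomputable def f : ℝ := sInf (I.F '' halfPlane)

/-! ### The line arrangement -/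

/-- The intercepts `β₁, β₂, β₃, β₄`. -/
noncomputable def β : Fin 4 → ℝ :=
  ![I.c₁, -I.c₂, (I.c₁ - I.c₂) / 2 - 2 * I.ξ * I.Q,
    I.c₁ - 2 * Real.sqrt (I.ξ * (I.c₁ + I.c₂) * I.Q)]

/-- `L_{ij}(λ₁) = 2 λ₁ x_i + β_j`. -/
noncomputable def L (i : Fin n) (j : Fin 4) (t : ℝ) : ℝ := 2 * t * I.x i + I.β j

/-- A vertex: a point of the half-plane on a line `L_{ij}` that lies on the axis `λ₁ = 0` or on a
second, different line (lines with a common point differ iff their slopes do). -/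
def IsVertex (p : ℝ × ℝ) : Prop :=
  0 ≤ p.1 ∧ ∃ i j, p.2 = I.L i j p.1 ∧
    (p.1 = 0 ∨ ∃ i' j', p.2 = I.L i' j' p.1 ∧ I.x i' ≠ I.x i)

/-- A (closed) region of the half-plane cut out by the lines: a side of each line is prescribed,
and some point of the half-plane is strictly on the prescribed side of every line. -/
def IsRegion (Γ : Set (ℝ × ℝ)) : Prop :=
  ∃ above : Fin n → Fin 4 → Bool,
    Γ = {p | 0 ≤ p.1 ∧ ∀ i j, if above i j then I.L i j p.1 ≤ p.2 else p.2 ≤ I.L i j p.1} ∧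
    ∃ p : ℝ × ℝ, 0 ≤ p.1 ∧ ∀ i j, if above i j then I.L i j p.1 < p.2 else p.2 < I.L i j p.1

/-- A (closed, possibly unbounded) segment of the arrangement: a nondegenerate side of a region
along a line `L_{ij}`. -/
def IsSegment (e : Set (ℝ × ℝ)) : Prop :=
  ∃ Γ i j, I.IsRegion Γ ∧ e = Γ ∩ {p | p.2 = I.L i j p.1} ∧ e.Nontrivial

def vertices : Set (ℝ × ℝ) := {p | I.IsVertex p}

def regions : Set (Set (ℝ × ℝ)) := {Γ | I.IsRegion Γ}

def segments : Set (Set (ℝ × ℝ)) := {e | I.IsSegment e}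

/-- The regions adjacent to a point. -/
def regionsAt (p : ℝ × ℝ) : Set (Set (ℝ × ℝ)) := {Γ | I.IsRegion Γ ∧ p ∈ Γ}

/-- The segments adjacent to a point. -/
def segmentsAt (p : ℝ × ℝ) : Set (Set (ℝ × ℝ)) := {e | I.IsSegment e ∧ p ∈ e}

/-! ### The Directional Descent method -/

/-- The functional forms `g_{i0}, g_{i1}, g_{i2}` that `sup_{y ≥ 0} g_i` can take. -/
noncomputable def gForm (i : Fin n) (k : Fin 3) (p : ℝ × ℝ) : ℝ :=
  let x₁ := (2 * I.b i p - I.c₂) / (2 * I.ξ)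
  let x₂ := (2 * I.b i p + I.c₁) / (2 * I.ξ)
  ![I.c₂ * I.Q,
    I.c₂ * (I.Q - x₁) - I.ξ * x₁ ^ 2 + 2 * I.b i p * x₁,
    I.c₁ * (x₂ - I.Q) - I.ξ * x₂ ^ 2 + 2 * I.b i p * x₂] k

/-- `FΓ` is `F` with every `Ψ_i` continued to all `(λ₁, λ₂)` by the functional form that it has
on the region `Γ`. -/
def IsContinuationFrom (Γ : Set (ℝ × ℝ)) (FΓ : ℝ × ℝ → ℝ) : Prop :=
  ∃ k : Fin n → Fin 3, (∀ i, ∀ p ∈ Γ, I.supg i p = I.gForm i (k i) p) ∧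
    FΓ = I.objective (fun i => I.gForm i (k i))

/-- Squared Euclidean distance in the `(λ₁, λ₂)` plane. -/
def sqDist (p q : ℝ × ℝ) : ℝ := (p.1 - q.1) ^ 2 + (p.2 - q.2) ^ 2

/-- `m` is the minimizer of `G` over the half-plane (the one nearest to `p` if there are several). -/
def IsNearestMinimizer (G : ℝ × ℝ → ℝ) (p m : ℝ × ℝ) : Prop :=
  (m ∈ halfPlane ∧ ∀ z ∈ halfPlane, G m ≤ G z) ∧
    ∀ m' ∈ halfPlane, (∀ z ∈ halfPlane, G m' ≤ G z) → sqDist p m ≤ sqDist p m'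

/-- A descent step from `p` through the adjacent region `Γ`: the path heads from `p` into `Γ`
straight for the minimizer `m` of `F_Γ`, whose value is below the current one, and ends in `m` or,
if it leaves `Γ` before, at the point `q` of the lines where it does so. -/
def RegionStep (Γ : Set (ℝ × ℝ)) (p q : ℝ × ℝ) : Prop :=
  I.IsRegion Γ ∧ p ∈ Γ ∧ ∃ FΓ m, I.IsContinuationFrom Γ FΓ ∧ IsNearestMinimizer FΓ p m ∧
    FΓ m < I.F p ∧
    q ≠ p ∧ q ∈ segment ℝ p m ∩ Γ ∧ ∀ z ∈ segment ℝ p m ∩ Γ, z ∈ segment ℝ p q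

/-- `q` is a critical point of `F` along the segment `e` emanating from `p`, in a descent
direction: the derivative of `F` at `q` in the direction of the segment vanishes. -/
def RayCritical (e : Set (ℝ × ℝ)) (p q : ℝ × ℝ) : Prop :=
  I.IsSegment e ∧ p ∈ e ∧ q ∈ e ∧ I.F q < I.F p ∧ HasLineDerivAt ℝ I.F 0 q (q - p)

/-- A descent step from `p` along the adjacent segment `e`: to a nearest one of the critical points
on the segments emanating from `p`. -/
def RayStep (e : Set (ℝ × ℝ)) (p q : ℝ × ℝ) : Prop :=
  I.RayCritical e p q ∧ ∀ e' q', I.RayCritical e' p q' → sqDist p q ≤ sqDist p q'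

/-- One pass through the loop, from `p` to `q`, traversing the region or segment `P`. Segments are
tried only if no region admits a descent step. Ties (which region, which nearest critical point)
may be resolved in any way. -/
def Step (P : Set (ℝ × ℝ)) (p q : ℝ × ℝ) : Prop :=
  I.RegionStep P p q ∨ ((∀ Γ q', ¬ I.RegionStep Γ p q') ∧ I.RayStep P p q)

/-- The exit test of the loop: no descent direction via regions or segments. -/
def Stops (p : ℝ × ℝ) : Prop :=
  (∀ Γ q, ¬ I.RegionStep Γ p q) ∧ ∀ e q, ¬ I.RayCritical e p q

/-- The initial search point: a vertex with the smallest value of `F`. -/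
def IsStart (p : ℝ × ℝ) : Prop := I.IsVertex p ∧ ∀ v, I.IsVertex v → I.F p ≤ I.F v

/-- The points `p 0, …, p K` are produced by the first `K` passes through the loop, the `k`-th of
which traverses the region or segment `P k`. -/
def IsRun (K : ℕ) (p : ℕ → ℝ × ℝ) (P : ℕ → Set (ℝ × ℝ)) : Prop :=
  I.IsStart (p 0) ∧ ∀ k < K, I.Step (P k) (p k) (p (k + 1))

/-- The number of items examined in a run: the vertices, where `F` is evaluated to find the initial
point, and, for each search point, the adjacent regions and segments. -/
noncomputable def searchCount (K : ℕ) (p : ℕ → ℝ × ℝ) : ℕ :=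
  I.vertices.ncard +
    ∑ k ∈ Finset.range (K + 1), ((I.regionsAt (p k)).ncard + (I.segmentsAt (p k)).ncard)

/-- The input of the method, as a list of real numbers. -/
def input : List ℝ :=
  List.ofFn I.x ++ [I.c₁, I.c₂, I.w, I.ξ, I.Q, I.δ, I.μ, I.σ]

/-- The coordinates of the search points `p 0, …, p K`, as a list of real numbers. -/
def trace (K : ℕ) (p : ℕ → ℝ × ℝ) : List ℝ :=
  (List.range (K + 1)).flatMap fun k => [(p k).1, (p k).2]

end Newsvendor

/-! ### Counting operations on real numbers -/

inductive ArithOp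
  | add
  | sub
  | mul
  | div

noncomputable def ArithOp.eval : ArithOp → ℝ → ℝ → ℝ
  | .add, a, b => a + b
  | .sub, a, b => a - b
  | .mul, a, b => a * b
  | .div, a, b => a / b

/-- Algebraic computation trees. The memory is a list of real numbers that initially holds the
input; every constant, arithmetic operation and square root appends its result, operands are given
by their positions, and the only access of the control flow to the numbers is by comparisons. -/
inductive CompTree
  | output (out : List ℕ)
  | const (c : ℚ) (next : CompTree)
  | arith (o : ArithOp) (i j : ℕ) (next : CompTree)
  | sqrt (i : ℕ) (next : CompTree)
  | ifLe (i j : ℕ) (yes no : CompTree)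

namespace CompTree

/-- The output of a computation tree on a given memory. -/
noncomputable def result : CompTree → List ℝ → List ℝ
  | output out, M => out.map fun i => M.getD i 0
  | const c next, M => next.result (M ++ [(c : ℝ)])
  | arith o i j next, M => next.result (M ++ [o.eval (M.getD i 0) (M.getD j 0)])
  | sqrt i next, M => next.result (M ++ [Real.sqrt (M.getD i 0)])
  | ifLe i j yes no, M =>
      open Classical in if M.getD i 0 ≤ M.getD j 0 then yes.result M else no.result M

/-- The number of operations executed on a given memory: constants, arithmetic operations, square
roots, comparisons, and numbers written to the output. -/
noncomputable def cost : CompTree → List ℝ → ℕ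
  | output out, _ => out.length
  | const c next, M => next.cost (M ++ [(c : ℝ)]) + 1
  | arith o i j next, M => next.cost (M ++ [o.eval (M.getD i 0) (M.getD j 0)]) + 1
  | sqrt i next, M => next.cost (M ++ [Real.sqrt (M.getD i 0)]) + 1
  | ifLe i j yes no, M =>
      open Classical in
        (if M.getD i 0 ≤ M.getD j 0 then yes.cost M else no.cost M) + 1

end CompTree

/-! ### Closed form of the suprema, convexity of the objective, quadratic forms -/

namespace Newsvendor

variable {n : ℕ} (I : Newsvendor n)

/-! Convexity. The i-th supremum depends only on `2 b_i = 2 λ₁ x_i - λ₂`, and as a function `phi` of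
this number it is a maximum of two constants plus truncated squares, hence convex. So `F` is convex
on the whole plane, and on each cell of the arrangement it coincides with a convex quadratic `F_Γ`.

No vertices below the start. The run starts at a lowest vertex `p₀` and descends strictly, so all
later search points lie in the convex set `{F < F(p₀)}`, and this set contains no vertex in the
half-plane. Inside it two different lines never meet and no line meets the axis. Consequently all
its points on one line have the same adjacent cells (`mem_Cell_of_line`): at most two regions and
two segments.

Correctness (`optimal_of_stops`). Suppose `F(z) < F(p)` and `p` admits no step. No line through `p`
carries a lower point, since otherwise there would be a critical point on it (`exists_rayCritical`).
So the path from `p` to `z` enters the interior of some region `Γ`. Boundedness of `F` yields a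
minimizer `m` of `F_Γ`, with a value below `F(p)`. If `m` lay outside the cone of `Γ` at `p`, the
path to `m` from an interior point of `Γ` near `p` would cross a line through `p` below the level
`F(p)`, and by convexity `F` would descend along that line. So `m` lies in the cone and a region
step exists.

No repetition (`IsRun.ne`). A segment step ends at the strict minimum of `F` on its line, so the
segment is of no further use. A region step that does not reach `m` leaves `Γ` through a line beyond
which `m` lies. The next pass either reaches the lowest point of this line, after which `Γ` contains
nothing lower (`no_return`), or enters the region on the other side. To come back, the run has to
reach the line again through that same region, which is excluded by induction.

Counting. Cells are counted by deletion and restriction of sign patterns. A search point after the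
first that is off all lines is optimal, so each pass after the first uses a cell adjacent to a line
below the level `F(p₀)`; there are at most 4 such cells for each of the `4 n` lines, and a run has
at most `16 n + 1` passes.

Operations. A small calculus tracks which numbers are available and which comparisons are decided at
a node of a computation tree. The values of `F` at all `O(n²)` vertices are found in constant time
each after merging sorted lists and forming prefix sums. A pass at a point where the lines have `r`
different slopes costs `O(n (r + 1))`: this is `O(n²)` at the start, where `r ≤ n`, and `O(n)`
afterwards, where `r ≤ 1`. -/

/-- The point `p + τ d`. -/
def ray (p d : ℝ × ℝ) (τ : ℝ) : ℝ × ℝ := (p.1 + τ * d.1, p.2 + τ * d.2)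

@[simp] lemma ray_fst (p d : ℝ × ℝ) (τ : ℝ) : (ray p d τ).1 = p.1 + τ * d.1 := rfl

@[simp] lemma ray_snd (p d : ℝ × ℝ) (τ : ℝ) : (ray p d τ).2 = p.2 + τ * d.2 := rfl

lemma ray_zero (p d : ℝ × ℝ) : ray p d 0 = p := by ext <;> simp

lemma ray_sub_one (p q : ℝ × ℝ) : ray p (q - p) 1 = q := by ext <;> simp

lemma mem_segment_iff_ray {p m z : ℝ × ℝ} :
    z ∈ segment ℝ p m ↔ ∃ τ, 0 ≤ τ ∧ τ ≤ 1 ∧ z = ray p (m - p) τ := by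
  rw [segment_eq_image']
  constructor
  · rintro ⟨τ, ⟨h0, h1⟩, rfl⟩
    exact ⟨τ, h0, h1, by ext <;> simp⟩
  · rintro ⟨τ, h0, h1, rfl⟩
    exact ⟨τ, ⟨h0, h1⟩, by ext <;> simp⟩

/-- The slack variable `2 b_i`, on which the `i`-th supremum depends. -/
def s (i : Fin n) (p : ℝ × ℝ) : ℝ := 2 * p.1 * I.x i - p.2

lemma s_ray (i : Fin n) (p d : ℝ × ℝ) (τ : ℝ) :
    I.s i (ray p d τ) = I.s i p + τ * I.s i d := by
  simp only [s, ray]; ring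

lemma s_sub (i : Fin n) (p q : ℝ × ℝ) : I.s i (q - p) = I.s i q - I.s i p := by
  simp only [s, Prod.fst_sub, Prod.snd_sub]; ring

lemma L_le_iff (i : Fin n) (j : Fin 4) (p : ℝ × ℝ) : I.L i j p.1 ≤ p.2 ↔ I.s i p + I.β j ≤ 0 := by
  simp only [s, L]; constructor <;> intro h <;> linarith

lemma le_L_iff (i : Fin n) (j : Fin 4) (p : ℝ × ℝ) : p.2 ≤ I.L i j p.1 ↔ 0 ≤ I.s i p + I.β j := by
  simp only [s, L]; constructor <;> intro h <;> linarith

lemma L_lt_iff (i : Fin n) (j : Fin 4) (p : ℝ × ℝ) : I.L i j p.1 < p.2 ↔ I.s i p + I.β j < 0 := by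
  simp only [s, L]; constructor <;> intro h <;> linarith

lemma lt_L_iff (i : Fin n) (j : Fin 4) (p : ℝ × ℝ) : p.2 < I.L i j p.1 ↔ 0 < I.s i p + I.β j := by
  simp only [s, L]; constructor <;> intro h <;> linarith

lemma eq_L_iff (i : Fin n) (j : Fin 4) (p : ℝ × ℝ) : p.2 = I.L i j p.1 ↔ I.s i p + I.β j = 0 := by
  simp only [s, L]; constructor <;> intro h <;> linarith

/-- The supremum `sup_{y ≥ 0} g_i` as a function of `2 b_i`. -/
noncomputable def phi (t : ℝ) : ℝ :=
  max (I.c₂ * I.Q + max (t - I.c₂) 0 ^ 2 / (4 * I.ξ)) (-(I.c₁ * I.Q) + max (t + I.c₁) 0 ^ 2 / (4 * I.ξ))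

/-- The parabola `a y - ξ y²` restricted to `y ≥ 0` peaks at `max a 0 / (2 ξ)`; the next lemma
evaluates it there. -/
lemma mul_sub_sq_le {ξ : ℝ} (hξ : 0 < ξ) (a : ℝ) {y : ℝ} (hy : 0 ≤ y) :
    a * y - ξ * y ^ 2 ≤ max a 0 ^ 2 / (4 * ξ) := by
  have h1 : a * y ≤ max a 0 * y := mul_le_mul_of_nonneg_right (le_max_left _ _) hy
  have h2 : max a 0 * y - ξ * y ^ 2 ≤ max a 0 ^ 2 / (4 * ξ) := by
    rw [le_div_iff₀ (by positivity)]
    nlinarith [sq_nonneg (max a 0 - 2 * ξ * y)]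
  linarith

lemma mul_sub_sq_eq {ξ : ℝ} (hξ : 0 < ξ) (a : ℝ) :
    a * (max a 0 / (2 * ξ)) - ξ * (max a 0 / (2 * ξ)) ^ 2 = max a 0 ^ 2 / (4 * ξ) := by
  rcases le_total a 0 with h | h
  · simp [max_eq_right h]
  · rw [max_eq_left h]; field_simp; ring

variable {I}

/-- The two affine costs `c₂ (Q - y)` and `c₁ (y - Q)` change order at `y = Q`, so their maximum is
the piecewise cost. This turns the supremum into a maximum of two suprema of parabolas. -/
lemma g_eq (hI : I.Admissible) (i : Fin n) (p : ℝ × ℝ) (y : ℝ) :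
    I.g i p y = max (I.c₂ * I.Q + ((I.s i p - I.c₂) * y - I.ξ * y ^ 2))
      (-(I.c₁ * I.Q) + ((I.s i p + I.c₁) * y - I.ξ * y ^ 2)) := by
  have h1 := hI.c₁_pos
  have h2 := hI.c₂_pos
  simp only [g, b, s]
  rcases le_total y I.Q with h | h
  · rw [max_eq_right (by linarith : y - I.Q ≤ 0), max_eq_left (by linarith : 0 ≤ I.Q - y),
      max_eq_left (by nlinarith)]
    ring
  · rw [max_eq_left (by linarith : 0 ≤ y - I.Q), max_eq_right (by linarith : I.Q - y ≤ 0),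
      max_eq_right (by nlinarith)]
    ring

lemma supg_eq (hI : I.Admissible) (i : Fin n) (p : ℝ × ℝ) : I.supg i p = I.phi (I.s i p) := by
  have hξ := hI.ξ_pos
  have hub : ∀ z ∈ I.g i p '' Set.Ici 0, z ≤ I.phi (I.s i p) := by
    rintro _ ⟨y, hy, rfl⟩
    rw [g_eq hI, phi]
    exact max_le_max (by have := mul_sub_sq_le hξ (I.s i p - I.c₂) hy; linarith)
      (by have := mul_sub_sq_le hξ (I.s i p + I.c₁) hy; linarith)
  refine le_antisymm (csSup_le ⟨_, 0, by simp, rfl⟩ hub) ?_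
  have key : ∀ y, 0 ≤ y → I.g i p y ≤ I.supg i p := fun y hy =>
    le_csSup ⟨_, hub⟩ ⟨y, hy, rfl⟩
  rw [phi]
  refine max_le ?_ ?_
  · rw [← mul_sub_sq_eq hξ]
    refine le_trans ?_ (key (max (I.s i p - I.c₂) 0 / (2 * I.ξ)) (by positivity))
    rw [g_eq hI]; exact le_max_left _ _
  · rw [← mul_sub_sq_eq hξ]
    refine le_trans ?_ (key (max (I.s i p + I.c₁) 0 / (2 * I.ξ)) (by positivity))
    rw [g_eq hI]; exact le_max_right _ _

/-- Truncation at 0 keeps an affine function convex and makes it nonnegative, so its square is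
convex; maxima preserve convexity. -/
lemma convexOn_phi (hI : I.Admissible) : ConvexOn ℝ Set.univ I.phi := by
  have aux : ∀ c d : ℝ, ConvexOn ℝ Set.univ fun t : ℝ => c + max (t + d) 0 ^ 2 / (4 * I.ξ) := by
    intro c d
    have h1 : ConvexOn ℝ Set.univ fun t : ℝ => max (t + d) 0 :=
      ((convexOn_id convex_univ).add (convexOn_const d convex_univ)).sup
        (convexOn_const 0 convex_univ)
    have h2 := h1.pow (fun t _ => le_max_right _ _) 2
    have h3 := (h2.smul (by have := hI.ξ_pos; positivity : 0 ≤ 1 / (4 * I.ξ))).add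
      (convexOn_const c convex_univ)
    refine h3.congr fun t _ => ?_
    simp only [Pi.add_apply, Pi.pow_apply, smul_eq_mul]; ring
  have := (aux (I.c₂ * I.Q) (-I.c₂)).sup (aux (-(I.c₁ * I.Q)) I.c₁)
  exact this.congr fun t _ => by simp [phi, sub_eq_add_neg]

variable (I)

/-- The affine part of the objective. -/
def lin (p : ℝ × ℝ) : ℝ :=
  p.1 * I.δ + p.2 * I.μ + (I.ξ - p.1) * (I.σ ^ 2 + I.μ ^ 2) - I.w * p.1 * ∑ i, I.x i ^ 2

lemma objective_eq (h : Fin n → ℝ × ℝ → ℝ) (p : ℝ × ℝ) :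
    I.objective h p = I.lin p + I.w * ∑ i, h i p := by
  simp only [objective, lin, Finset.sum_add_distrib, Finset.sum_neg_distrib, ← Finset.mul_sum]
  ring

variable {I}

lemma F_eq (hI : I.Admissible) (p : ℝ × ℝ) :
    I.F p = I.lin p + I.w * ∑ i, I.phi (I.s i p) := by
  rw [F, objective_eq]; simp only [supg_eq hI]

/-- Convexity of `F` in the parametrization used throughout. It holds on the whole plane, also for
`λ₁ < 0`. -/
lemma F_ray_le (hI : I.Admissible) (p q : ℝ × ℝ) {τ : ℝ} (h0 : 0 ≤ τ) (h1 : τ ≤ 1) :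
    I.F (ray p (q - p) τ) ≤ (1 - τ) * I.F p + τ * I.F q := by
  have hs : ∑ i, I.phi (I.s i (ray p (q - p) τ)) ≤
      (1 - τ) * ∑ i, I.phi (I.s i p) + τ * ∑ i, I.phi (I.s i q) := by
    rw [Finset.mul_sum, Finset.mul_sum, ← Finset.sum_add_distrib]
    refine Finset.sum_le_sum fun i _ => ?_
    have := (convexOn_phi hI).2 (Set.mem_univ (I.s i p)) (Set.mem_univ (I.s i q))
      (by linarith : 0 ≤ 1 - τ) h0 (by ring)
    simp only [smul_eq_mul] at this
    rw [s_ray, s_sub]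
    convert this using 2
    ring
  have hl : I.lin (ray p (q - p) τ) = (1 - τ) * I.lin p + τ * I.lin q := by
    simp only [lin, ray, Prod.fst_sub, Prod.snd_sub]; ring
  rw [F_eq hI, F_eq hI, F_eq hI, hl]
  nlinarith [mul_le_mul_of_nonneg_left hs hI.w_pos.le]

/-- Strict decrease towards a better point. -/
lemma F_ray_lt (hI : I.Admissible) {p q : ℝ × ℝ} (h : I.F q < I.F p) {τ : ℝ} (h0 : 0 < τ)
    (h1 : τ ≤ 1) : I.F (ray p (q - p) τ) < I.F p := by
  have := F_ray_le hI p q h0.le h1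
  nlinarith

/-! ### The functional forms -/

variable (I)

/-- Coefficient of the square in a functional form. -/
def ac : Fin 3 → ℝ := ![0, 1, 1]

/-- Shift inside the square of a functional form. -/
def ev : Fin 3 → ℝ := ![0, -I.c₂, I.c₁]

/-- Constant part of a functional form. -/
def hv : Fin 3 → ℝ := ![I.c₂ * I.Q, I.c₂ * I.Q, -(I.c₁ * I.Q)]

/-- The continued objective with the functional forms `k`. -/
noncomputable def FG (k : Fin n → Fin 3) : ℝ × ℝ → ℝ := I.objective fun i => I.gForm i (k i)

/-- Second-order coefficient of `FG k` in the direction `d`. -/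
noncomputable def quadA (k : Fin n → Fin 3) (d : ℝ × ℝ) : ℝ :=
  I.w * ∑ i, ac (k i) * I.s i d ^ 2 / (4 * I.ξ)

/-- First-order coefficient of `FG k` at `p` in the direction `d`. -/
noncomputable def quadB (k : Fin n → Fin 3) (p d : ℝ × ℝ) : ℝ :=
  d.1 * I.δ + d.2 * I.μ - d.1 * (I.σ ^ 2 + I.μ ^ 2) - I.w * d.1 * ∑ i, I.x i ^ 2 +
    I.w * ∑ i, ac (k i) * (2 * (I.s i p + I.ev (k i)) * I.s i d) / (4 * I.ξ)

lemma ac_nonneg (k : Fin 3) : 0 ≤ ac k := by fin_cases k <;> simp [ac]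

variable {I}

lemma gForm_eq (hI : I.Admissible) (i : Fin n) (k : Fin 3) (p : ℝ × ℝ) :
    I.gForm i k p = ac k * (I.s i p + I.ev k) ^ 2 / (4 * I.ξ) + I.hv k := by
  have h := hI.ξ_pos.ne'
  fin_cases k
  · simp [gForm, ac, hv]
  · simp [gForm, ac, hv, ev, b, s]; field_simp; ring
  · simp [gForm, ac, hv, ev, b, s]; field_simp; ring

lemma FG_eq (hI : I.Admissible) (k : Fin n → Fin 3) (p : ℝ × ℝ) :
    I.FG k p = I.lin p + I.w * ∑ i, (ac (k i) * (I.s i p + I.ev (k i)) ^ 2 / (4 * I.ξ) + I.hv (k i)) := by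
  rw [FG, objective_eq]; simp only [gForm_eq hI]

lemma FG_ray (hI : I.Admissible) (k : Fin n → Fin 3) (p d : ℝ × ℝ) (τ : ℝ) :
    I.FG k (ray p d τ) = I.quadA k d * τ ^ 2 + I.quadB k p d * τ + I.FG k p := by
  have : ∑ i, (ac (k i) * (I.s i (ray p d τ) + I.ev (k i)) ^ 2 / (4 * I.ξ) + I.hv (k i)) =
      (∑ i, ac (k i) * I.s i d ^ 2 / (4 * I.ξ)) * τ ^ 2 +
      (∑ i, ac (k i) * (2 * (I.s i p + I.ev (k i)) * I.s i d) / (4 * I.ξ)) * τ +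
      ∑ i, (ac (k i) * (I.s i p + I.ev (k i)) ^ 2 / (4 * I.ξ) + I.hv (k i)) := by
    rw [Finset.sum_mul, Finset.sum_mul, ← Finset.sum_add_distrib, ← Finset.sum_add_distrib]
    refine Finset.sum_congr rfl fun i _ => ?_
    rw [s_ray]; ring
  rw [FG_eq hI, FG_eq hI, this, quadA, quadB]
  simp only [lin, ray]
  ring

lemma quadA_nonneg (hI : I.Admissible) (k : Fin n → Fin 3) (d : ℝ × ℝ) : 0 ≤ I.quadA k d :=
  mul_nonneg hI.w_pos.le <| Finset.sum_nonneg fun i _ =>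
    div_nonneg (mul_nonneg (ac_nonneg _) (sq_nonneg _)) (by linarith [hI.ξ_pos])

lemma FG_ray_le (hI : I.Admissible) (k : Fin n → Fin 3) (p q : ℝ × ℝ) {τ : ℝ} (h0 : 0 ≤ τ)
    (h1 : τ ≤ 1) : I.FG k (ray p (q - p) τ) ≤ (1 - τ) * I.FG k p + τ * I.FG k q := by
  have h2 := FG_ray hI k p (q - p) τ
  have h3 := FG_ray hI k p (q - p) 1
  rw [ray_sub_one] at h3
  have hA := quadA_nonneg hI k (q - p)
  rw [h2, h3]
  nlinarith [mul_nonneg hA (mul_nonneg h0 (sub_nonneg.2 h1))]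

end Newsvendor

/-! ### Cells as systems of affine constraints, and the form of the objective on a cell -/

namespace Newsvendor

open Filter Topology

/-- The last parameter at which finitely many affine constraints hold on `[0, 1]`. -/
lemma exists_exit {ι : Type*} [Finite ι] (a b : ι → ℝ) (ha : ∀ i, 0 ≤ a i) :
    ∃ τ, 0 ≤ τ ∧ τ ≤ 1 ∧ (∀ i, 0 ≤ a i + τ * (b i - a i)) ∧
      (τ = 1 ∨ ∃ i, a i + τ * (b i - a i) = 0 ∧ b i < 0) ∧
      ∀ τ', τ' ≤ 1 → (∀ i, 0 ≤ a i + τ' * (b i - a i)) → τ' ≤ τ := by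
  classical
  have := Fintype.ofFinite ι
  by_cases hb : ∃ i, b i < 0
  · obtain ⟨i₀, hi₀⟩ := hb
    -- Only constraints with `b i < 0` can fail on the way; such a constraint vanishes at time `a i
    -- / (a i - b i)`, and the exit is at the earliest of these times.
    obtain ⟨i, hi, hmin⟩ := Finset.exists_min_image (Finset.univ.filter fun i => b i < 0)
      (fun i => a i / (a i - b i)) ⟨i₀, by simpa using hi₀⟩
    have hbi : b i < 0 := by simpa using hi
    have hpos : 0 < a i - b i := by linarith [ha i]
    have hτ : a i + a i / (a i - b i) * (b i - a i) = 0 := by field_simp; ring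
    refine ⟨a i / (a i - b i), div_nonneg (ha i) hpos.le, (div_le_one hpos).2 (by linarith),
      fun j => ?_, Or.inr ⟨i, hτ, hbi⟩, fun τ' _ h => ?_⟩
    · rcases lt_or_ge (b j) 0 with hj | hj
      · have h1 := hmin j (by simpa using hj)
        have h2 : 0 < a j - b j := by linarith [ha j]
        rw [le_div_iff₀ h2] at h1
        linarith
      · have h1 : a i / (a i - b i) ≤ 1 := (div_le_one hpos).2 (by linarith)
        have h0 := div_nonneg (ha i) hpos.le
        nlinarith [ha j]
    · rw [le_div_iff₀ hpos]; linarith [h i]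
  · push Not at hb
    exact ⟨1, zero_le_one, le_rfl, fun i => by linarith [hb i], Or.inl rfl, fun τ' h _ => h⟩

lemma eventually_pos {a : ℝ} (ha : 0 < a) (b : ℝ) : ∀ᶠ τ in 𝓝[>] (0 : ℝ), 0 < a + τ * b := by
  have : Tendsto (fun τ : ℝ => a + τ * b) (𝓝 0) (𝓝 (a + 0 * b)) := by
    apply Continuous.tendsto; fun_prop
  exact (this.mono_left nhdsWithin_le_nhds).eventually (lt_mem_nhds (by simpa using ha))

lemma eventually_small {c : ℝ} (hc : 0 < c) : ∀ᶠ τ in 𝓝[>] (0 : ℝ), 0 < τ ∧ τ < c :=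
  (eventually_mem_nhdsWithin).and ((eventually_lt_nhds hc).filter_mono nhdsWithin_le_nhds)

variable {n : ℕ} (I : Newsvendor n)

/-- The closed cell of the arrangement with prescribed sides. -/
def Cell (above : Fin n → Fin 4 → Bool) : Set (ℝ × ℝ) :=
  {p | 0 ≤ p.1 ∧ ∀ i j, if above i j then I.L i j p.1 ≤ p.2 else p.2 ≤ I.L i j p.1}

/-- The constraints of a cell: `none` is `λ₁ ≥ 0`, `some (i, j)` the prescribed side of `L_{ij}`. -/
noncomputable def con (above : Fin n → Fin 4 → Bool) : Option (Fin n × Fin 4) → ℝ × ℝ → ℝ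
  | none, p => p.1
  | some (i, j), p => if above i j then -(I.s i p + I.β j) else I.s i p + I.β j

/-- A point strictly on the prescribed sides. -/
def StrictIn (above : Fin n → Fin 4 → Bool) (p : ℝ × ℝ) : Prop :=
  0 ≤ p.1 ∧ ∀ i j, 0 < I.con above (some (i, j)) p

variable {I} {above : Fin n → Fin 4 → Bool}

lemma con_ray (c : Option (Fin n × Fin 4)) (p q : ℝ × ℝ) (τ : ℝ) :
    I.con above c (ray p (q - p) τ) =
      I.con above c p + τ * (I.con above c q - I.con above c p) := by
  rcases c with _ | ⟨i, j⟩
  · simp [con]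
  · simp only [con, s_ray, s_sub]; split <;> ring

lemma con_eq_zero_iff (i : Fin n) (j : Fin 4) (p : ℝ × ℝ) :
    I.con above (some (i, j)) p = 0 ↔ I.s i p + I.β j = 0 := by
  simp only [con]; split <;> constructor <;> intro h <;> linarith

lemma mem_Cell {p : ℝ × ℝ} : p ∈ I.Cell above ↔ ∀ c, 0 ≤ I.con above c p := by
  rw [Option.forall, Prod.forall]
  refine and_congr Iff.rfl (forall_congr' fun i => forall_congr' fun j => ?_)
  simp only [con]
  split
  · rw [L_le_iff]; constructor <;> intro h <;> linarith
  · rw [le_L_iff]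

lemma isRegion_iff {Γ : Set (ℝ × ℝ)} :
    I.IsRegion Γ ↔ ∃ above, Γ = I.Cell above ∧ ∃ p, I.StrictIn above p := by
  refine exists_congr fun above => and_congr Iff.rfl (exists_congr fun p => and_congr Iff.rfl
    (forall_congr' fun i => forall_congr' fun j => ?_))
  simp only [con]
  split
  · rw [L_lt_iff]; constructor <;> intro h <;> linarith
  · rw [lt_L_iff]

lemma StrictIn.mem {p : ℝ × ℝ} (h : I.StrictIn above p) : p ∈ I.Cell above :=
  mem_Cell.2 fun c => match c with
    | none => h.1
    | some (i, j) => (h.2 i j).le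

lemma isVertex_iff {p : ℝ × ℝ} : I.IsVertex p ↔ 0 ≤ p.1 ∧ ∃ i j, I.s i p + I.β j = 0 ∧
    (p.1 = 0 ∨ ∃ i' j', I.s i' p + I.β j' = 0 ∧ I.x i' ≠ I.x i) := by
  simp only [IsVertex, eq_L_iff]

lemma s_congr {i i' : Fin n} (h : I.x i' = I.x i) (p : ℝ × ℝ) : I.s i' p = I.s i p := by
  simp only [s, h]

/-- Lines of different slopes through `p` would make it a vertex, and lines of equal slope through a
common point coincide. Coincident lines may still carry different labels, because observations or
intercepts may be repeated. -/
lemma line_unique {p : ℝ × ℝ} (hp : 0 ≤ p.1) (hv : ¬ I.IsVertex p) {i i' : Fin n} {j j' : Fin 4}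
    (h : I.s i p + I.β j = 0) (h' : I.s i' p + I.β j' = 0) : I.x i' = I.x i ∧ I.β j' = I.β j := by
  have hx : I.x i' = I.x i := by
    by_contra hne
    exact hv (isVertex_iff.2 ⟨hp, i, j, h, Or.inr ⟨i', j', h', hne⟩⟩)
  exact ⟨hx, by rw [s_congr hx] at h'; linarith⟩

/-- Strictness persists under small moves. -/
lemma StrictIn.eventually {p : ℝ × ℝ} (h : I.StrictIn above p) (d : ℝ × ℝ) :
    ∀ᶠ τ in 𝓝[>] (0 : ℝ), ∀ i j, 0 < I.con above (some (i, j)) (ray p d τ) := by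
  rw [eventually_all]; intro i
  rw [eventually_all]; intro j
  have := eventually_pos (h.2 i j) (I.con above (some (i, j)) (ray p d 1) -
    I.con above (some (i, j)) p)
  filter_upwards [this] with τ hτ
  have h1 : ray p d τ = ray p (ray p d 1 - p) τ := by ext <;> simp
  rw [h1, con_ray]; exact hτ

lemma StrictIn.exists_pos {p : ℝ × ℝ} (h : I.StrictIn above p) :
    ∃ q, I.StrictIn above q ∧ 0 < q.1 := by
  obtain ⟨τ, hτ, h0⟩ := ((h.eventually (1, 0)).and (eventually_small one_pos)).exists
  have := h.1
  have h1 : 0 < (ray p (1, 0) τ).1 := by simp; linarith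
  exact ⟨ray p (1, 0) τ, ⟨h1.le, hτ⟩, h1⟩

lemma StrictIn.above_iff {p : ℝ × ℝ} (h : I.StrictIn above p) (i : Fin n) (j : Fin 4) :
    above i j = true ↔ I.s i p + I.β j < 0 := by
  have := h.2 i j
  simp only [con] at this
  split at this <;> rename_i hh
  · simp only [hh, true_iff]; linarith
  · exact ⟨fun h => absurd h hh, fun h => by linarith⟩

/-- For a nonempty open cell the prescribed sides are read off from any of its points, so labels of
the same line get the same side. -/
lemma StrictIn.congr_above {p : ℝ × ℝ} (h : I.StrictIn above p) {i i' : Fin n} {j j' : Fin 4}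
    (hx : I.x i' = I.x i) (hβ : I.β j' = I.β j) : above i' j' = above i j := by
  rw [Bool.eq_iff_iff, h.above_iff, h.above_iff, s_congr hx, hβ]

/-! ### The form of the objective on a cell -/

variable (I)

/-- Whether the middle functional form occurs. -/
def Big : Prop := I.c₁ + I.c₂ ≤ 4 * I.ξ * I.Q

open Classical in
/-- The index of the intercept at which `phi` stops being constant. -/
noncomputable def theta : Fin 4 := if I.Big then 1 else 3

open Classical in
/-- The functional forms on a cell. -/
noncomputable def kform (above : Fin n → Fin 4 → Bool) (i : Fin n) : Fin 3 :=
  if I.Big then (if above i 1 then 0 else if above i 2 then 1 else 2)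
  else if above i 3 then 0 else 2

lemma β_one : I.β 1 = -I.c₂ := rfl

lemma β_two : I.β 2 = (I.c₁ - I.c₂) / 2 - 2 * I.ξ * I.Q := rfl

lemma β_three : I.β 3 = I.c₁ - 2 * Real.sqrt (I.ξ * (I.c₁ + I.c₂) * I.Q) := rfl

variable {I}

/-- If `c₁ + c₂ ≤ 4 ξ Q`, then at `t = c₂` the branch with `c₁` has not yet overtaken the constant
`c₂ Q`. So `phi` is constant up to `-β₂ = c₂`, then follows the middle parabola, and changes to the
last one at `-β₃`, in the numbering of the intercepts from 1. -/
lemma phi_of_big_le (hI : I.Admissible) (hb : I.Big) {t : ℝ} (h : t + I.β 1 ≤ 0) :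
    I.phi t = I.c₂ * I.Q := by
  have h1 := hI.c₁_pos
  have h2 := hI.c₂_pos
  have h3 := hI.ξ_pos
  rw [β_one] at h
  rw [Big] at hb
  rw [phi, max_eq_right (by linarith : t - I.c₂ ≤ 0), max_eq_left]
  · simp
  · have h0 : 0 ≤ max (t + I.c₁) 0 := le_max_right _ _
    have h5 : max (t + I.c₁) 0 ≤ I.c₁ + I.c₂ := max_le (by linarith) (by linarith)
    have h6 : max (t + I.c₁) 0 ^ 2 / (4 * I.ξ) ≤ (I.c₁ + I.c₂) * I.Q := by
      rw [div_le_iff₀ (by positivity)]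
      nlinarith
    have h7 : (0 : ℝ) ^ 2 / (4 * I.ξ) = 0 := by simp
    rw [h7]; linarith

lemma phi_of_big_mid (hI : I.Admissible) {t : ℝ} (h : 0 ≤ t + I.β 1)
    (h' : t + I.β 2 ≤ 0) : I.phi t = (t - I.c₂) ^ 2 / (4 * I.ξ) + I.c₂ * I.Q := by
  have h1 := hI.c₁_pos
  have h2 := hI.c₂_pos
  have h3 := hI.ξ_pos
  rw [β_one] at h
  rw [β_two] at h'
  rw [phi, max_eq_left (by linarith : 0 ≤ t - I.c₂), max_eq_left (by linarith : 0 ≤ t + I.c₁),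
    max_eq_left]
  · ring
  · have : (t + I.c₁) ^ 2 / (4 * I.ξ) ≤ (t - I.c₂) ^ 2 / (4 * I.ξ) + (I.c₁ + I.c₂) * I.Q := by
      rw [div_add' _ _ _ (by positivity), div_le_div_iff_of_pos_right (by positivity)]
      nlinarith
    linarith

lemma phi_of_big_ge (hI : I.Admissible) {t : ℝ} (h : 0 ≤ t + I.β 1)
    (h' : 0 ≤ t + I.β 2) : I.phi t = (t + I.c₁) ^ 2 / (4 * I.ξ) + -(I.c₁ * I.Q) := by
  have h1 := hI.c₁_pos
  have h2 := hI.c₂_pos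
  have h3 := hI.ξ_pos
  rw [β_one] at h
  rw [β_two] at h'
  rw [phi, max_eq_left (by linarith : 0 ≤ t - I.c₂), max_eq_left (by linarith : 0 ≤ t + I.c₁),
    max_eq_right]
  · ring
  · have : (t - I.c₂) ^ 2 / (4 * I.ξ) + (I.c₁ + I.c₂) * I.Q ≤ (t + I.c₁) ^ 2 / (4 * I.ξ) := by
      rw [div_add' _ _ _ (by positivity), div_le_div_iff_of_pos_right (by positivity)]
      nlinarith
    linarith

/-- In the other regime the last parabola overtakes the constant at `2 √(ξ (c₁ + c₂) Q) - c₁`, and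
the inequality says that this happens before `c₂`, where the middle form would begin. So the middle
form never occurs. -/
lemma sqrt_lt_of_not_big (hI : I.Admissible) (hb : ¬ I.Big) :
    2 * Real.sqrt (I.ξ * (I.c₁ + I.c₂) * I.Q) < I.c₁ + I.c₂ := by
  have h1 := hI.c₁_pos
  have h2 := hI.c₂_pos
  rw [Big, not_le] at hb
  have : Real.sqrt (I.ξ * (I.c₁ + I.c₂) * I.Q) < (I.c₁ + I.c₂) / 2 := by
    rw [Real.sqrt_lt' (by positivity)]; nlinarith
  linarith

lemma phi_of_not_big_le (hI : I.Admissible) (hb : ¬ I.Big) {t : ℝ} (h : t + I.β 3 ≤ 0) :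
    I.phi t = I.c₂ * I.Q := by
  have h1 := hI.c₁_pos
  have h2 := hI.c₂_pos
  have h3 := hI.ξ_pos
  have h4 := hI.Q_nonneg
  have hs := sqrt_lt_of_not_big hI hb
  rw [β_three] at h
  rw [phi, max_eq_right (by linarith : t - I.c₂ ≤ 0), max_eq_left]
  · simp
  · have h0 : 0 ≤ max (t + I.c₁) 0 := le_max_right _ _
    have hsq := Real.sq_sqrt (by positivity : 0 ≤ I.ξ * (I.c₁ + I.c₂) * I.Q)
    have hs0 := Real.sqrt_nonneg (I.ξ * (I.c₁ + I.c₂) * I.Q)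
    have h5 : max (t + I.c₁) 0 ≤ 2 * Real.sqrt (I.ξ * (I.c₁ + I.c₂) * I.Q) :=
      max_le (by linarith) (by linarith)
    have h6 : max (t + I.c₁) 0 ^ 2 / (4 * I.ξ) ≤ (I.c₁ + I.c₂) * I.Q := by
      rw [div_le_iff₀ (by positivity)]
      nlinarith
    have h7 : (0 : ℝ) ^ 2 / (4 * I.ξ) = 0 := by simp
    rw [h7]; linarith

lemma phi_of_not_big_ge (hI : I.Admissible) (hb : ¬ I.Big) {t : ℝ} (h : 0 ≤ t + I.β 3) :
    I.phi t = (t + I.c₁) ^ 2 / (4 * I.ξ) + -(I.c₁ * I.Q) := by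
  have h1 := hI.c₁_pos
  have h2 := hI.c₂_pos
  have h3 := hI.ξ_pos
  have h4 := hI.Q_nonneg
  rw [β_three] at h
  rw [Big, not_le] at hb
  have hsq := Real.sq_sqrt (by positivity : 0 ≤ I.ξ * (I.c₁ + I.c₂) * I.Q)
  have hs0 := Real.sqrt_nonneg (I.ξ * (I.c₁ + I.c₂) * I.Q)
  have key : (I.c₁ + I.c₂) * I.Q ≤ (t + I.c₁) ^ 2 / (4 * I.ξ) := by
    rw [le_div_iff₀ (by positivity)]; nlinarith
  rw [phi, max_eq_left (by linarith : 0 ≤ t + I.c₁), max_eq_right]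
  · ring
  · rcases le_total t I.c₂ with ht | ht
    · rw [max_eq_right (by linarith : t - I.c₂ ≤ 0)]
      have h7 : (0 : ℝ) ^ 2 / (4 * I.ξ) = 0 := by simp
      rw [h7]; linarith
    · rw [max_eq_left (by linarith : 0 ≤ t - I.c₂)]
      have : (t - I.c₂) ^ 2 / (4 * I.ξ) + (I.c₁ + I.c₂) * I.Q ≤ (t + I.c₁) ^ 2 / (4 * I.ξ) := by
        rw [div_add' _ _ _ (by positivity), div_le_div_iff_of_pos_right (by positivity)]
        nlinarith
      linarith

lemma phi_of_theta_le (hI : I.Admissible) {t : ℝ} (h : t + I.β I.theta ≤ 0) :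
    I.phi t = I.c₂ * I.Q := by
  by_cases hb : I.Big
  · rw [theta, if_pos hb] at h; exact phi_of_big_le hI hb h
  · rw [theta, if_neg hb] at h; exact phi_of_not_big_le hI hb h

lemma con_some_nonneg {p : ℝ × ℝ} (hp : p ∈ I.Cell above) (i : Fin n) (j : Fin 4) :
    if above i j then I.s i p + I.β j ≤ 0 else 0 ≤ I.s i p + I.β j := by
  have := mem_Cell.1 hp (some (i, j))
  simp only [con] at this
  split <;> rename_i h <;> simp only [h] at this <;> simp at this <;> linarith

lemma supg_eq_gForm (hI : I.Admissible) {p : ℝ × ℝ} (hp : p ∈ I.Cell above) (i : Fin n) :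
    I.supg i p = I.gForm i (I.kform above i) p := by
  rw [supg_eq hI, gForm_eq hI, kform]
  have h1 := con_some_nonneg hp i 1
  have h2 := con_some_nonneg hp i 2
  have h3 := con_some_nonneg hp i 3
  by_cases hb : I.Big
  · rw [if_pos hb]
    split at h1 <;> rename_i e1
    · rw [if_pos e1, phi_of_big_le hI hb h1]; simp [ac, hv]
    · rw [if_neg e1]
      split at h2 <;> rename_i e2
      · rw [if_pos e2, phi_of_big_mid hI h1 h2]; simp [ac, hv, ev, sub_eq_add_neg]
      · rw [if_neg e2, phi_of_big_ge hI h1 h2]; simp [ac, hv, ev]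
  · rw [if_neg hb]
    split at h3 <;> rename_i e3
    · rw [if_pos e3, phi_of_not_big_le hI hb h3]; simp [ac, hv]
    · rw [if_neg e3, phi_of_not_big_ge hI hb h3]; simp [ac, hv, ev]

lemma F_eq_FG (hI : I.Admissible) {p : ℝ × ℝ} (hp : p ∈ I.Cell above) :
    I.F p = I.FG (I.kform above) p := by
  rw [F, FG, objective_eq, objective_eq]
  simp only [supg_eq_gForm hI hp]

lemma isContinuationFrom_kform (hI : I.Admissible) :
    I.IsContinuationFrom (I.Cell above) (I.FG (I.kform above)) :=
  ⟨_, fun i _ hp => supg_eq_gForm hI hp i, rfl⟩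

/-- Functions of `t` of degree at most 2 that agree at three points are equal, and the three forms
differ: one is constant, and the other two have different shifts since `c₁ + c₂ > 0`. -/
lemma form_injective (hI : I.Admissible) {k k' : Fin 3} {t η : ℝ} (hη : 0 < η)
    (h : ∀ e ∈ ({-η, 0, η} : Set ℝ), ac k * (t + e + I.ev k) ^ 2 / (4 * I.ξ) + I.hv k =
      ac k' * (t + e + I.ev k') ^ 2 / (4 * I.ξ) + I.hv k') : k = k' := by
  have h1 := hI.c₁_pos
  have h2 := hI.c₂_pos
  have h3 := hI.ξ_pos
  have ha := h (-η) (by simp)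
  have hb := h 0 (by simp)
  have hc := h η (by simp)
  fin_cases k <;> fin_cases k' <;> simp [ac, ev, hv, h3.ne'] at ha hb hc ⊢ <;> exfalso <;>
    (try field_simp at ha hb hc) <;> nlinarith [mul_pos hη h1, mul_pos hη h2, mul_pos hη hη]

/-- The definition of `F_Γ` allows any forms that are valid on `Γ`. Since `Γ` has interior points,
they are determined, so `F_Γ` can be replaced by the explicit quadratic. -/
lemma continuation_unique (hI : I.Admissible) {p : ℝ × ℝ} (hp : I.StrictIn above p)
    {G : ℝ × ℝ → ℝ} (hG : I.IsContinuationFrom (I.Cell above) G) : G = I.FG (I.kform above) := by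
  obtain ⟨k, hk, rfl⟩ := hG
  suffices k = I.kform above by rw [this, FG]
  funext i
  -- A vertical shift by `η` changes every slack by `∓η` and keeps `λ₁`, so three values of the
  -- slack are taken inside the cell even when `p` is on the axis.
  obtain ⟨η, ⟨h1, h2⟩, h0, -⟩ := (((hp.eventually (0, 1)).and (hp.eventually (0, -1))).and
    (eventually_small one_pos)).exists
  refine form_injective hI (t := I.s i p) h0 fun e he => ?_
  have key : ∀ q ∈ I.Cell above, I.s i q = I.s i p + e →
      ac (k i) * (I.s i p + e + I.ev (k i)) ^ 2 / (4 * I.ξ) + I.hv (k i) =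
      ac (I.kform above i) * (I.s i p + e + I.ev (I.kform above i)) ^ 2 / (4 * I.ξ) +
        I.hv (I.kform above i) := by
    intro q hq hs
    rw [← hs, ← gForm_eq hI, ← gForm_eq hI, ← hk i q hq, supg_eq_gForm hI hq]
  rcases he with rfl | rfl | rfl
  · refine key (ray p (0, 1) η) (StrictIn.mem ⟨by simpa using hp.1, h1⟩) ?_
    simp only [s_ray]; simp [s]
  · exact key p hp.mem (by simp)
  · refine key (ray p (0, -1) e) (StrictIn.mem ⟨by simpa using hp.1, h2⟩) ?_
    simp only [s_ray]; simp [s]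

end Newsvendor

/-! ### Boundedness below and the minimizers of the continued objective -/

namespace Newsvendor

open Filter Topology

variable {n : ℕ} {I : Newsvendor n} {above : Fin n → Fin 4 → Bool}

lemma slope_nonneg_of_bddBelow {M a b : ℝ} (h : ∀ τ : ℝ, 0 ≤ τ → M ≤ a + τ * b) : 0 ≤ b := by
  by_contra hb
  push Not at hb
  have h1 := h 0 le_rfl
  have h2 := h ((a - M + 1) / (-b)) (div_nonneg (by linarith) (by linarith))
  have h3 : (a - M + 1) / (-b) * b = -(a - M + 1) := by
    rw [div_neg, neg_mul, div_mul_cancel₀ _ hb.ne]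
  linarith

lemma lin_ray (p d : ℝ × ℝ) (τ : ℝ) : I.lin (ray p d τ) = I.lin p + τ *
    (d.1 * I.δ + d.2 * I.μ - d.1 * (I.σ ^ 2 + I.μ ^ 2) - I.w * d.1 * ∑ i, I.x i ^ 2) := by
  simp only [lin, ray]; ring

lemma exists_lowerBound (hB : BddBelow (I.F '' halfPlane)) : ∃ M, ∀ p : ℝ × ℝ, 0 ≤ p.1 → M ≤ I.F p := by
  obtain ⟨M, hM⟩ := hB
  exact ⟨M, fun p hp => hM ⟨p, hp, rfl⟩⟩

/-- Where all suprema are constant, the objective is smallest at the vertex on the axis. -/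
lemma F_axis_le_of_inactive (hn : 1 ≤ n) (hI : I.Admissible) (hB : BddBelow (I.F '' halfPlane))
    {p : ℝ × ℝ} (hp : 0 ≤ p.1) (h : ∀ i, I.s i p + I.β I.theta ≤ 0) :
    I.F (0, I.β I.theta) ≤ I.F p := by
  have hF : ∀ z : ℝ × ℝ, (∀ i, I.s i z + I.β I.theta ≤ 0) →
      I.F z = I.lin z + I.w * ∑ _i : Fin n, I.c₂ * I.Q := by
    intro z hz
    rw [F_eq hI]
    simp only [fun i => phi_of_theta_le hI (hz i)]
  obtain ⟨M, hM⟩ := exists_lowerBound hB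
  have : Nonempty (Fin n) := ⟨⟨0, hn⟩⟩
  obtain ⟨i₀, hi₀⟩ := Finite.exists_max I.x
  set z₀ : ℝ × ℝ := (0, I.β I.theta) with hz₀
  -- All suprema stay constant along such a direction from `z₀`, so `F` is affine there and, being
  -- bounded below, has nonnegative slope.
  have key : ∀ d : ℝ × ℝ, 0 ≤ d.1 → (∀ i, I.s i d ≤ 0) → 0 ≤
      d.1 * I.δ + d.2 * I.μ - d.1 * (I.σ ^ 2 + I.μ ^ 2) - I.w * d.1 * ∑ i, I.x i ^ 2 := by
    intro d hd hs
    refine slope_nonneg_of_bddBelow (M := M) (a := I.F z₀) fun τ hτ => ?_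
    refine (hM (ray z₀ d τ) (by simp [hz₀]; positivity)).trans_eq ?_
    rw [hF, hF, lin_ray]
    · ring
    · intro i; simp [s, hz₀]
    · intro i
      rw [s_ray]
      have : I.s i z₀ = -I.β I.theta := by simp [s, hz₀]
      nlinarith [hs i]
  -- The set in question is a cone with apex `z₀`; its extreme directions are the vertical one and
  -- that of the steepest line.
  have k1 := key (0, 1) le_rfl (fun i => by simp [s])
  have k2 := key (1, 2 * I.x i₀) zero_le_one (fun i => by simp [s]; linarith [hi₀ i])
  rw [hF p h, hF z₀ (fun i => by simp [s, hz₀])]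
  have h0 := h i₀
  simp only [s] at h0
  simp only [lin, hz₀]
  simp only [zero_mul, one_mul, mul_zero] at k1 k2
  have e1 := mul_nonneg hp k2
  have e2 := mul_nonneg (by linarith : 0 ≤ p.2 - 2 * p.1 * I.x i₀ - I.β I.theta)
    (by linarith : 0 ≤ I.μ)
  nlinarith

lemma isVertex_axis (hn : 1 ≤ n) (j : Fin 4) : I.IsVertex (0, I.β j) :=
  isVertex_iff.2 ⟨le_rfl, ⟨0, hn⟩, j, by simp [s], Or.inl rfl⟩

/-! ### Minimizers of the continued objective -/

variable (I)

/-- The number of nonconstant forms. -/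
def acSum (k : Fin n → Fin 3) : ℝ := ∑ i, ac (k i)

/-- Slope of the line of the minimizers in `λ₂` for fixed `λ₁`. -/
noncomputable def mSlope (k : Fin n → Fin 3) : ℝ := 2 * (∑ i, ac (k i) * I.x i) / acSum k

/-- Intercept of the line of the minimizers in `λ₂` for fixed `λ₁`. -/
noncomputable def mIcpt (k : Fin n → Fin 3) : ℝ :=
  (∑ i, ac (k i) * I.ev (k i) - 2 * I.ξ * I.μ / I.w) / acSum k

/-- Second-order coefficient along the line of partial minimizers. -/
noncomputable def mD (k : Fin n → Fin 3) : ℝ := I.quadA k (1, I.mSlope k)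

/-- First-order coefficient along the line of partial minimizers. -/
noncomputable def mE (k : Fin n → Fin 3) : ℝ := I.quadB k (0, I.mIcpt k) (1, I.mSlope k)

open Classical in
/-- First coordinate of the nearest minimizer. -/
noncomputable def mTime (k : Fin n → Fin 3) (p : ℝ × ℝ) : ℝ :=
  if 0 < I.mD k then max 0 (-I.mE k / (2 * I.mD k))
  else if 0 < I.mE k then 0
  else max 0 ((p.1 + I.mSlope k * (p.2 - I.mIcpt k)) / (1 + I.mSlope k ^ 2))

/-- The minimizer of `FG k` over the half-plane that is nearest to `p`. -/
noncomputable def nearMin (k : Fin n → Fin 3) (p : ℝ × ℝ) : ℝ × ℝ :=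
  (I.mTime k p, I.mSlope k * I.mTime k p + I.mIcpt k)

variable {I}

/-- Completing the square in `λ₂`: the slope and intercept are chosen so that the derivative in `λ₂`
vanishes on their line, and a one-variable quadratic in `λ₁` remains. Minimization over the
half-plane thus becomes minimization over `λ₁ ≥ 0`. -/
lemma FG_decomp (hI : I.Admissible) {k : Fin n → Fin 3} (hk : 0 < acSum k) (p : ℝ × ℝ) :
    I.FG k p = I.quadA k (0, 1) * (p.2 - (I.mSlope k * p.1 + I.mIcpt k)) ^ 2 +
      (I.mD k * p.1 ^ 2 + I.mE k * p.1 + I.FG k (0, I.mIcpt k)) := by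
  have hw := hI.w_pos
  have hξ := hI.ξ_pos
  set b := ray (0, I.mIcpt k) (1, I.mSlope k) p.1 with hb
  have h1 : p = ray b (0, 1) (p.2 - (I.mSlope k * p.1 + I.mIcpt k)) := by
    ext <;> simp [hb]; ring
  have h2 : I.quadB k b (0, 1) = 0 := by
    have e1 : ∑ i, ac (k i) * (2 * (I.s i b + I.ev (k i)) * I.s i (0, 1)) / (4 * I.ξ) =
        -(1 / (2 * I.ξ)) * (2 * p.1 * (∑ i, ac (k i) * I.x i) - acSum k * b.2 +
          ∑ i, ac (k i) * I.ev (k i)) := by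
      rw [acSum, Finset.mul_sum, Finset.sum_mul, ← Finset.sum_sub_distrib,
        ← Finset.sum_add_distrib, Finset.mul_sum]
      refine Finset.sum_congr rfl fun i _ => ?_
      simp only [s, hb, ray_fst]
      field_simp; ring
    rw [quadB, e1]
    simp only [hb, ray_snd, mSlope, mIcpt]
    field_simp
    ring
  conv_lhs => rw [h1]
  rw [FG_ray hI, h2, hb, FG_ray hI, mD, mE]
  ring

lemma quadA_vertical_pos (hI : I.Admissible) {k : Fin n → Fin 3} (hk : 0 < acSum k) :
    0 < I.quadA k (0, 1) := by
  have hw := hI.w_pos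
  have hξ := hI.ξ_pos
  have : I.quadA k (0, 1) = I.w * (acSum k / (4 * I.ξ)) := by
    simp [quadA, s, acSum, Finset.sum_div]
  rw [this]; positivity

lemma mD_nonneg (hI : I.Admissible) (k : Fin n → Fin 3) : 0 ≤ I.mD k := quadA_nonneg hI k _

lemma isNearestMinimizer_nearMin (hI : I.Admissible) {k : Fin n → Fin 3} (hk : 0 < acSum k)
    (hE : I.mD k = 0 → 0 ≤ I.mE k) (p : ℝ × ℝ) :
    IsNearestMinimizer (I.FG k) p (I.nearMin k p) := by
  have hq := quadA_vertical_pos hI hk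
  set u := I.mSlope k
  set v := I.mIcpt k
  set D := I.mD k with hD
  set E := I.mE k with hEdef
  have hD0 : 0 ≤ D := mD_nonneg hI k
  have ht0 : 0 ≤ I.mTime k p := by
    rw [mTime]; split_ifs <;> simp
  have hmin : ∀ t, 0 ≤ t → D * I.mTime k p ^ 2 + E * I.mTime k p ≤ D * t ^ 2 + E * t := by
    intro t ht
    rw [mTime, ← hD, ← hEdef]
    split_ifs with h1 h2
    · rcases le_total 0 (-E / (2 * D)) with h | h
      · rw [max_eq_right h]
        have e : -E / (2 * D) * D * 2 = -E := by field_simp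
        nlinarith [sq_nonneg (t - -E / (2 * D)), mul_nonneg hD0 (sq_nonneg (t - -E / (2 * D)))]
      · rw [max_eq_left h]
        have : 0 ≤ E := by
          by_contra hlt
          push Not at hlt
          have : 0 < -E / (2 * D) := by apply div_pos <;> linarith
          linarith
        nlinarith [mul_nonneg this ht, mul_nonneg hD0 (sq_nonneg t)]
    · nlinarith [mul_nonneg h2.le ht, mul_nonneg hD0 (sq_nonneg t)]
    · have hD' : D = 0 := le_antisymm (not_lt.1 h1) hD0
      have hE' : E = 0 := le_antisymm (not_lt.1 h2) (hE hD')
      simp [hD', hE']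
  have hval : ∀ z, I.FG k z = I.quadA k (0, 1) * (z.2 - (u * z.1 + v)) ^ 2 +
      (D * z.1 ^ 2 + E * z.1 + I.FG k (0, v)) := FG_decomp hI hk
  have hm : I.FG k (I.nearMin k p) =
      D * I.mTime k p ^ 2 + E * I.mTime k p + I.FG k (0, v) := by
    rw [hval]; simp only [nearMin]; ring
  refine ⟨⟨ht0, fun z hz => ?_⟩, fun m hm0 hmm => ?_⟩
  · rw [hm, hval z]
    nlinarith [hmin z.1 hz, mul_nonneg hq.le (sq_nonneg (z.2 - (u * z.1 + v)))]
  · have h1 := hmm (I.nearMin k p) ht0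
    rw [hm, hval m] at h1
    have h2 := hmin m.1 hm0
    have h3 : m.2 = u * m.1 + v := by
      have : (m.2 - (u * m.1 + v)) ^ 2 ≤ 0 := by
        by_contra hpos
        push Not at hpos
        nlinarith [mul_pos hq hpos]
      have := pow_eq_zero_iff (two_ne_zero) |>.1 (le_antisymm this (sq_nonneg _))
      linarith
    have h4 : D * m.1 ^ 2 + E * m.1 ≤ D * I.mTime k p ^ 2 + E * I.mTime k p := by
      nlinarith [mul_nonneg hq.le (sq_nonneg (m.2 - (u * m.1 + v)))]
    suffices hs : sqDist p (I.nearMin k p) ≤ sqDist p (m.1, u * m.1 + v) by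
      rwa [← h3] at hs
    by_cases hD1 : 0 < D
    · suffices m.1 = I.mTime k p by rw [this]; rfl
      -- Two different minimizers of a strictly convex quadratic are impossible: their midpoint
      -- would be lower.
      have hmid := hmin ((m.1 + I.mTime k p) / 2) (by have : 0 ≤ m.1 := hm0; linarith)
      have : (m.1 - I.mTime k p) ^ 2 ≤ 0 := by
        by_contra hpos
        push Not at hpos
        nlinarith [mul_pos hD1 hpos]
      have := pow_eq_zero_iff (two_ne_zero) |>.1 (le_antisymm this (sq_nonneg _))
      linarith
    · have hD' : D = 0 := le_antisymm (not_lt.1 hD1) hD0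
      by_cases hE1 : 0 < E
      · suffices m.1 = I.mTime k p by rw [this]; rfl
        rw [hD'] at h2 h4
        have : E * (m.1 - I.mTime k p) = 0 := by nlinarith
        rcases mul_eq_zero.1 this with h | h <;> linarith
      · have ht : I.mTime k p = max 0 ((p.1 + u * (p.2 - v)) / (1 + u ^ 2)) := by
          rw [mTime, if_neg hD1, if_neg hE1]
        have hu : 0 < 1 + u ^ 2 := by positivity
        set r := (p.1 + u * (p.2 - v)) / (1 + u ^ 2) with hr
        have hr' : r * (1 + u ^ 2) = p.1 + u * (p.2 - v) := by rw [hr]; field_simp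
        -- Here all points of the half-line `λ₂ = u λ₁ + v`, `λ₁ ≥ 0`, are minimizers; the squared
        -- distance to `p` is a parabola in `λ₁` around the foot `r` of the perpendicular, so the
        -- nearest one is at `max 0 r`.
        have hsq : ∀ t, sqDist p (t, u * t + v) =
            (1 + u ^ 2) * (t - r) ^ 2 + (p.1 ^ 2 + (p.2 - v) ^ 2 - (1 + u ^ 2) * r ^ 2) := by
          intro t
          simp only [sqDist]
          have e : (1 + u ^ 2) * (t - r) ^ 2 =
            (1 + u ^ 2) * t ^ 2 - 2 * t * (r * (1 + u ^ 2)) + (1 + u ^ 2) * r ^ 2 := by ring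
          rw [e, hr']; ring
        have : (I.mTime k p - r) ^ 2 ≤ (m.1 - r) ^ 2 := by
          rw [ht]
          rcases le_total 0 r with h | h
          · rw [max_eq_right h]; simp; positivity
          · rw [max_eq_left h]
            have : 0 ≤ m.1 := hm0
            nlinarith
        change sqDist p (I.mTime k p, u * I.mTime k p + v) ≤ _
        rw [hsq, hsq]
        nlinarith

lemma sqDist_ray_half (p m m' : ℝ × ℝ) : sqDist p (ray m (m' - m) (1 / 2)) =
    (sqDist p m + sqDist p m') / 2 - sqDist m m' / 4 := by
  simp only [sqDist, ray, Prod.fst_sub, Prod.snd_sub]; ring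

lemma eq_of_sqDist_nonpos {p q : ℝ × ℝ} (h : sqDist p q ≤ 0) : p = q := by
  simp only [sqDist] at h
  have h1 : (p.1 - q.1) ^ 2 = 0 := by nlinarith [sq_nonneg (p.1 - q.1), sq_nonneg (p.2 - q.2)]
  have h2 : (p.2 - q.2) ^ 2 = 0 := by nlinarith [sq_nonneg (p.1 - q.1), sq_nonneg (p.2 - q.2)]
  have h1 := pow_eq_zero_iff (two_ne_zero) |>.1 h1
  have h2 := pow_eq_zero_iff (two_ne_zero) |>.1 h2
  ext <;> linarith

/-- Minimizers form a convex set, and by the parallelogram identity the midpoint of two nearest ones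
would be nearer. -/
lemma nearestMinimizer_unique (hI : I.Admissible) {k : Fin n → Fin 3} {p m m' : ℝ × ℝ}
    (h : IsNearestMinimizer (I.FG k) p m) (h' : IsNearestMinimizer (I.FG k) p m') : m = m' := by
  have hc : ray m (m' - m) (1 / 2) ∈ halfPlane := by
    have h1 : 0 ≤ m.1 := h.1.1
    have h2 : 0 ≤ m'.1 := h'.1.1
    change 0 ≤ m.1 + 1 / 2 * (m'.1 - m.1)
    linarith
  have h1 := FG_ray_le hI k m m' (by norm_num : (0 : ℝ) ≤ 1 / 2) (by norm_num)
  have h2 := h'.1.2 m h.1.1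
  have h3 := h.2 _ hc fun z hz => by linarith [h.1.2 z hz]
  have h4 := h'.2 m h.1.1 h.1.2
  have h5 := sqDist_ray_half p m m'
  exact eq_of_sqDist_nonpos (by linarith)

/-- The nearest minimizer does not change along the way to it. -/
lemma isNearestMinimizer_ray (hI : I.Admissible) {k : Fin n → Fin 3} {p m : ℝ × ℝ}
    (h : IsNearestMinimizer (I.FG k) p m) {τ : ℝ} (h1 : τ ≤ 1) :
    IsNearestMinimizer (I.FG k) (ray p (m - p) τ) m := by
  refine ⟨h.1, fun m' hm' hmin => ?_⟩
  have key : ∀ η : ℝ, 0 < η → η ≤ 1 → sqDist p m ≤ sqDist p (ray m (m' - m) η) := by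
    intro η hη0 hη1
    refine h.2 _ ?_ fun z hz => ?_
    · have e1 : 0 ≤ m.1 := h.1.1
      have e2 : 0 ≤ m'.1 := hm'
      change 0 ≤ m.1 + η * (m'.1 - m.1)
      nlinarith
    · have e1 := FG_ray_le hI k m m' hη0.le hη1
      have e2 := hmin m h.1.1
      have e3 := h.1.2 z hz
      nlinarith
  -- The variational inequality for `m` as the projection of `p` onto the convex set of minimizers:
  -- a negative inner product would make a short move from `m` towards `m'` decrease the distance.
  have hinner : 0 ≤ (m.1 - p.1) * (m'.1 - m.1) + (m.2 - p.2) * (m'.2 - m.2) := by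
    by_contra hneg
    push Not at hneg
    have hN : 0 ≤ sqDist m m' := by simp only [sqDist]; positivity
    obtain ⟨η, hη0, hη1⟩ := (eventually_small (c := min 1
      (-((m.1 - p.1) * (m'.1 - m.1) + (m.2 - p.2) * (m'.2 - m.2)) / (sqDist m m' + 1)))
      (by apply lt_min one_pos; apply div_pos <;> linarith)).exists
    have e1 := key η hη0 (hη1.le.trans (min_le_left _ _))
    have e2 := hη1.trans_le (min_le_right _ _)
    rw [lt_div_iff₀ (by linarith)] at e2
    have e3 : sqDist p (ray m (m' - m) η) = sqDist p m + η * (2 * ((m.1 - p.1) * (m'.1 - m.1) +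
        (m.2 - p.2) * (m'.2 - m.2)) + η * sqDist m m') := by
      simp only [sqDist, ray, Prod.fst_sub, Prod.snd_sub]; ring
    rw [e3] at e1
    have e4 : 0 ≤ 2 * ((m.1 - p.1) * (m'.1 - m.1) +
        (m.2 - p.2) * (m'.2 - m.2)) + η * sqDist m m' := by
      by_contra hh
      push Not at hh
      nlinarith [mul_neg_of_pos_of_neg hη0 hh]
    nlinarith
  have e : sqDist (ray p (m - p) τ) m' - sqDist (ray p (m - p) τ) m = sqDist m m' +
      2 * (1 - τ) * ((m.1 - p.1) * (m'.1 - m.1) + (m.2 - p.2) * (m'.2 - m.2)) := by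
    simp only [sqDist, ray, Prod.fst_sub, Prod.snd_sub]; ring
  have hN : 0 ≤ sqDist m m' := by simp only [sqDist]; positivity
  nlinarith [mul_nonneg (sub_nonneg.2 h1) hinner]

/-! ### Boundedness of the continued objective -/

lemma kform_eq_zero_iff (i : Fin n) : I.kform above i = 0 ↔ above i I.theta = true := by
  rw [kform, theta]
  split_ifs <;> simp_all

lemma acSum_pos {k : Fin n → Fin 3} {i : Fin n} (h : k i ≠ 0) : 0 < acSum k := by
  refine Finset.sum_pos' (fun i _ => ac_nonneg _) ⟨i, Finset.mem_univ _, ?_⟩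
  generalize k i = a at h
  fin_cases a <;> simp [ac] at h ⊢

/-- If `mD` vanishes, the slacks of all active observations are constant along the line of partial
minimizers. As shown below, inactive observations stay inactive along it, so `F` itself is affine in
this direction with slope `mE`, and boundedness below gives the sign. Together with `FG_decomp` this
is why minimizers exist. -/
lemma mE_nonneg (hI : I.Admissible) (hB : BddBelow (I.F '' halfPlane)) {p : ℝ × ℝ}
    (hp : I.StrictIn above p) {a : Fin n} (ha : I.kform above a ≠ 0)
    (hD : I.mD (I.kform above) = 0) : 0 ≤ I.mE (I.kform above) := by
  obtain ⟨p, hp, hp1⟩ := hp.exists_pos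
  obtain ⟨M, hM⟩ := exists_lowerBound hB
  set k := I.kform above
  set d : ℝ × ℝ := (1, I.mSlope k) with hd
  have hsum : ∑ i, ac (k i) * I.s i d ^ 2 / (4 * I.ξ) = 0 := by
    rcases mul_eq_zero.1 hD with h | h
    · exact absurd h hI.w_pos.ne'
    · exact h
  have hz : ∀ i, k i ≠ 0 → I.s i d = 0 := by
    intro i hi
    have h1 := (Finset.sum_eq_zero_iff_of_nonneg (fun i _ =>
      div_nonneg (mul_nonneg (ac_nonneg _) (sq_nonneg _)) (by linarith [hI.ξ_pos]))).1 hsum i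
      (Finset.mem_univ i)
    have hac : ac (k i) = 1 := by
      generalize k i = b at hi
      fin_cases b <;> simp [ac] at hi ⊢
    have := hI.ξ_pos
    rw [hac, one_mul, div_eq_zero_iff] at h1
    rcases h1 with h1 | h1
    · exact pow_eq_zero_iff (two_ne_zero) |>.1 h1
    · linarith
  -- At a point with `λ₁ > 0` the slack of an inactive observation is below that of an active one,
  -- which forces `x_i < x_a`.
  have hneg : ∀ i, k i = 0 → I.s i d ≤ 0 := by
    intro i hi
    have h1 := (hp.above_iff i I.theta).1 ((kform_eq_zero_iff i).1 hi)
    have h2 : 0 ≤ I.s a p + I.β I.theta := by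
      by_contra hh
      push Not at hh
      exact ha ((kform_eq_zero_iff a).2 ((hp.above_iff a I.theta).2 hh))
    have h3 := hz a ha
    simp only [s, hd] at h1 h2 h3 ⊢
    have : I.x i < I.x a := by nlinarith
    linarith
  refine slope_nonneg_of_bddBelow (M := M) (a := I.F p) fun τ hτ => ?_
  refine (hM (ray p d τ) (by simp [hd]; linarith)).trans_eq ?_
  have hphi : ∀ i, I.phi (I.s i (ray p d τ)) = I.phi (I.s i p) := by
    intro i
    rw [s_ray]
    by_cases hi : k i = 0
    · have h1 := (hp.above_iff i I.theta).1 ((kform_eq_zero_iff i).1 hi)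
      have h2 := mul_nonneg hτ (neg_nonneg.2 (hneg i hi))
      rw [phi_of_theta_le hI h1.le, phi_of_theta_le hI (by linarith)]
    · rw [hz i hi]; simp
  have hsum' : ∑ i, ac (k i) * (2 * (I.s i (0, I.mIcpt k) + I.ev (k i)) * I.s i d) / (4 * I.ξ) = 0 := by
    refine Finset.sum_eq_zero fun i _ => ?_
    by_cases hi : k i = 0
    · simp [hi, ac]
    · rw [hz i hi]; simp
  rw [F_eq hI, F_eq hI, lin_ray, mE, quadB, ← hd, hsum']
  simp only [hphi]
  ring

lemma isNearestMinimizer_region (hI : I.Admissible) (hB : BddBelow (I.F '' halfPlane)) {z : ℝ × ℝ}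
    (hz : I.StrictIn above z) {a : Fin n} (ha : I.kform above a ≠ 0) (p : ℝ × ℝ) :
    IsNearestMinimizer (I.FG (I.kform above)) p (I.nearMin (I.kform above) p) :=
  isNearestMinimizer_nearMin hI (acSum_pos ha) (mE_nonneg hI hB hz ha) p

end Newsvendor

/-! ### Steps from points not above the vertices, and correctness of the exit test -/

namespace Newsvendor

open Filter Topology

variable {n : ℕ} {I : Newsvendor n} {above : Fin n → Fin 4 → Bool}

variable (I) in
/-- A point of the half-plane at which the objective does not exceed its values at the vertices. -/
def Good (p : ℝ × ℝ) : Prop := 0 ≤ p.1 ∧ ∀ v, I.IsVertex v → I.F p ≤ I.F v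

lemma Good.not_isVertex {p z : ℝ × ℝ} (hp : I.Good p) (hz : I.F z < I.F p) : ¬ I.IsVertex z :=
  fun h => absurd (hp.2 z h) (not_le.2 hz)

lemma Good.of_lt {p q : ℝ × ℝ} (hp : I.Good p) (hq : 0 ≤ q.1) (h : I.F q < I.F p) : I.Good q :=
  ⟨hq, fun v hv => h.le.trans (hp.2 v hv)⟩

lemma IsStart.good {p : ℝ × ℝ} (h : I.IsStart p) : I.Good p := ⟨h.1.1, h.2⟩

lemma con_ray_dir (c : Option (Fin n × Fin 4)) (p d : ℝ × ℝ) (τ : ℝ) :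
    I.con above c (ray p d τ) =
      I.con above c p + τ * (I.con above c (ray p d 1) - I.con above c p) := by
  have h1 : ray p d τ = ray p (ray p d 1 - p) τ := by ext <;> simp
  conv_lhs => rw [h1]
  rw [con_ray]

/-! ### Region steps -/

lemma RegionStep.lt (hI : I.Admissible) {Γ : Set (ℝ × ℝ)} {p q : ℝ × ℝ} (h : I.RegionStep Γ p q) :
    I.F q < I.F p := by
  obtain ⟨hΓ, hp, G, m, hG, hm, hlt, hne, ⟨hq, hqΓ⟩, -⟩ := h
  obtain ⟨above, rfl, z, hz⟩ := isRegion_iff.1 hΓ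
  rw [continuation_unique hI hz hG] at hlt
  obtain ⟨τ, h0, h1, rfl⟩ := mem_segment_iff_ray.1 hq
  have hτ : 0 < τ := lt_of_le_of_ne h0 fun h => hne (by rw [← h, ray_zero])
  rw [F_eq_FG hI hqΓ]
  rw [F_eq_FG hI hp] at hlt ⊢
  have := FG_ray_le hI (I.kform above) p m h0 h1
  nlinarith

lemma RegionStep.mem {Γ : Set (ℝ × ℝ)} {p q : ℝ × ℝ} (h : I.RegionStep Γ p q) : q ∈ Γ := by
  obtain ⟨-, -, G, m, -, -, -, -, ⟨-, hqΓ⟩, -⟩ := h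
  exact hqΓ

/-- On a cell where all forms are constant `F` is nowhere below its value at a vertex on the axis,
so such a cell offers no descent. In all other cells the explicit minimizer is available. -/
lemma exists_active (hn : 1 ≤ n) (hI : I.Admissible) (hB : BddBelow (I.F '' halfPlane))
    {p q : ℝ × ℝ} (hp : I.Good p) (hq : q ∈ I.Cell above) (h : I.F q < I.F p) :
    ∃ a, I.kform above a ≠ 0 := by
  by_contra hall
  push Not at hall
  have := F_axis_le_of_inactive hn hI hB hq.1 fun i => by
    have h1 := con_some_nonneg hq i I.theta
    rwa [if_pos ((kform_eq_zero_iff i).1 (hall i))] at h1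
  linarith [hp.2 _ (isVertex_axis hn I.theta)]

/-- What a region step is, in terms of the explicit minimizer. -/
lemma regionStep_iff (hn : 1 ≤ n) (hI : I.Admissible) (hB : BddBelow (I.F '' halfPlane))
    {p q z : ℝ × ℝ} (hg : I.Good p) (hz : I.StrictIn above z) (hp : p ∈ I.Cell above) :
    I.RegionStep (I.Cell above) p q ↔ (∃ a, I.kform above a ≠ 0) ∧
      I.FG (I.kform above) (I.nearMin (I.kform above) p) < I.F p ∧ q ≠ p ∧
      q ∈ segment ℝ p (I.nearMin (I.kform above) p) ∩ I.Cell above ∧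
      ∀ y ∈ segment ℝ p (I.nearMin (I.kform above) p) ∩ I.Cell above, y ∈ segment ℝ p q := by
  constructor
  · intro h
    obtain ⟨a, ha⟩ := exists_active hn hI hB hg h.mem (h.lt hI)
    obtain ⟨-, -, G, m, hG, hm, hlt, hrest⟩ := h
    rw [continuation_unique hI hz hG] at hlt hm
    have := nearestMinimizer_unique hI hm (isNearestMinimizer_region hI hB hz ha p)
    subst this
    exact ⟨⟨a, ha⟩, hlt, hrest⟩
  · rintro ⟨⟨a, ha⟩, hlt, hrest⟩
    exact ⟨isRegion_iff.2 ⟨above, rfl, z, hz⟩, hp, _, _, isContinuationFrom_kform hI,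
      isNearestMinimizer_region hI hB hz ha p, hlt, hrest⟩

/-- It suffices that the path to `m` stays in the cell for a short time; the step then goes to the
exit point. -/
lemma exists_regionStep (hI : I.Admissible) {p m z : ℝ × ℝ} (hz : I.StrictIn above z)
    (hp : p ∈ I.Cell above) (hm : IsNearestMinimizer (I.FG (I.kform above)) p m)
    (hlt : I.FG (I.kform above) m < I.F p) {η : ℝ} (hη0 : 0 < η) (hη1 : η ≤ 1)
    (hη : ray p (m - p) η ∈ I.Cell above) : ∃ q, I.RegionStep (I.Cell above) p q := by
  obtain ⟨τ, h0, h1, hin, -, hmax⟩ := exists_exit (fun c => I.con above c p)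
    (fun c => I.con above c m) (mem_Cell.1 hp)
  have hτη : η ≤ τ := hmax η hη1 fun c => by rw [← con_ray]; exact mem_Cell.1 hη c
  have hne : ray p (m - p) τ ≠ p := by
    intro h
    have e1 : τ * (m.1 - p.1) = 0 := by simpa using congrArg Prod.fst h
    have e2 : τ * (m.2 - p.2) = 0 := by simpa using congrArg Prod.snd h
    have hτ : τ ≠ 0 := by linarith
    have e1 := (mul_eq_zero.1 e1).resolve_left hτ
    have e2 := (mul_eq_zero.1 e2).resolve_left hτ
    have : m = p := by ext <;> linarith
    rw [this, F_eq_FG hI hp] at hlt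
    exact lt_irrefl _ hlt
  refine ⟨ray p (m - p) τ, isRegion_iff.2 ⟨above, rfl, z, hz⟩, hp, _, m,
    isContinuationFrom_kform hI, hm, hlt, hne,
    ⟨mem_segment_iff_ray.2 ⟨τ, h0, h1, rfl⟩, mem_Cell.2 fun c => ?_⟩, fun y hy => ?_⟩
  · rw [con_ray]; exact hin c
  · obtain ⟨t, ht0, ht1, rfl⟩ := mem_segment_iff_ray.1 hy.1
    have ht : t ≤ τ := hmax t ht1 fun c => by rw [← con_ray]; exact mem_Cell.1 hy.2 c
    have hτ : 0 < τ := by linarith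
    refine mem_segment_iff_ray.2 ⟨t / τ, by positivity, (div_le_one hτ).2 ht, ?_⟩
    ext <;> simp <;> field_simp

/-- A cell near one of its points is a cone. -/
lemma eventually_mem_Cell {p y : ℝ × ℝ} (hp : p ∈ I.Cell above) (hy : 0 ≤ y.1)
    (h : ∀ i j, I.s i p + I.β j = 0 → 0 ≤ I.con above (some (i, j)) y) :
    ∀ᶠ τ in 𝓝[>] (0 : ℝ), ray p (y - p) τ ∈ I.Cell above := by
  simp only [mem_Cell]
  rw [eventually_all]
  rintro (_ | ⟨i, j⟩)
  · filter_upwards [eventually_small one_pos] with τ hτ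
    have : 0 ≤ p.1 := hp.1
    rw [con_ray]
    change 0 ≤ p.1 + τ * (y.1 - p.1)
    nlinarith
  · rcases (mem_Cell.1 hp (some (i, j))).eq_or_lt with h0 | h0
    · filter_upwards [eventually_small one_pos] with τ hτ
      rw [con_ray, ← h0]
      have := h i j ((con_eq_zero_iff (above := above) i j p).1 h0.symm)
      nlinarith
    · filter_upwards [eventually_pos h0 (I.con above (some (i, j)) y -
        I.con above (some (i, j)) p)] with τ hτ
      rw [con_ray]; exact hτ.le

/-! ### Steps along segments -/

/-- Along a line on which the objective decreases from `p`, it is a strictly convex quadratic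
function as long as it is below its value at `p`. -/
lemma descent_along_line (hI : I.Admissible) (hB : BddBelow (I.F '' halfPlane)) {p d : ℝ × ℝ}
    (hg : I.Good p) (hp : p ∈ I.Cell above) {i : Fin n} {j : Fin 4} (hij : I.s i p + I.β j = 0)
    (hd : I.s i d = 0) {η : ℝ} (hη : 0 < η) (hηc : ray p d η ∈ I.Cell above)
    (hlt : I.F (ray p d η) < I.F p) :
    0 < I.quadA (I.kform above) d ∧ I.quadB (I.kform above) p d < 0 ∧
      ∀ T, 0 ≤ T → I.quadA (I.kform above) d * T + I.quadB (I.kform above) p d < 0 →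
        ray p d T ∈ I.Cell above := by
  set A := I.quadA (I.kform above) d
  set B := I.quadB (I.kform above) p d
  have hA : 0 ≤ A := quadA_nonneg hI _ _
  have hF : ∀ τ, ray p d τ ∈ I.Cell above → I.F (ray p d τ) = A * τ ^ 2 + B * τ + I.F p := by
    intro τ hτ
    rw [F_eq_FG hI hτ, F_eq_FG hI hp, FG_ray hI]
  have hBneg : B < 0 := by
    rw [hF η hηc] at hlt
    by_contra hh
    push Not at hh
    nlinarith [mul_nonneg hh hη.le, mul_nonneg hA (sq_nonneg η)]
  -- As long as `A T + B < 0` the quadratic is below its value at `p`. Leaving the cell at such a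
  -- time would mean meeting the axis or another line at a point that is lower than all vertices.
  have hin : ∀ T, 0 ≤ T → A * T + B < 0 → ray p d T ∈ I.Cell above := by
    intro T hT hAT
    rcases hT.eq_or_lt with rfl | hT
    · rwa [ray_zero]
    obtain ⟨τ, h0, h1, hin, hex, -⟩ := exists_exit (fun c => I.con above c p)
      (fun c => I.con above c (ray p d T)) (mem_Cell.1 hp)
    have hray : ray p (ray p d T - p) τ = ray p d (τ * T) := by
      ext <;> simp <;> ring
    have hzc : ray p d (τ * T) ∈ I.Cell above := by
      rw [← hray]
      exact mem_Cell.2 fun c => by rw [con_ray]; exact hin c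
    rcases hex with rfl | ⟨c, hc0, hcT⟩
    · rwa [one_mul] at hzc
    exfalso
    rw [← con_ray, hray] at hc0
    -- An exit at time 0 contradicts that the ray is still in the cell at time `η`.
    rcases h0.eq_or_lt with rfl | h0
    · rw [zero_mul, ray_zero] at hc0
      have e1 := con_ray_dir (I := I) (above := above) c p d T
      have e2 := con_ray_dir (I := I) (above := above) c p d η
      have e3 := mem_Cell.1 hηc c
      rw [hc0] at e1 e2
      rw [e1] at hcT
      rw [e2] at e3
      have : I.con above c (ray p d 1) - 0 < 0 := by
        by_contra hh
        push Not at hh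
        nlinarith
      nlinarith
    · have hτT : 0 < τ * T := mul_pos h0 hT
      have hlow : I.F (ray p d (τ * T)) < I.F p := by
        rw [hF _ hzc]
        have : A * (τ * T) + B < 0 := by nlinarith
        nlinarith
      have hnv := hg.not_isVertex hlow
      have hline : ∀ t, I.s i (ray p d t) + I.β j = 0 := by
        intro t; rw [s_ray, hd]; linarith
      rcases c with _ | ⟨i', j'⟩
      · exact hnv (isVertex_iff.2 ⟨hzc.1, i, j, hline _, Or.inl hc0⟩)
      · rw [con_eq_zero_iff] at hc0
        obtain ⟨hx, hβ⟩ := line_unique hzc.1 hnv (hline _) hc0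
        have : I.con above (some (i', j')) (ray p d T) = 0 := by
          rw [con_eq_zero_iff, s_congr hx, hβ]; exact hline T
        linarith
  -- With `A = 0` the ray would stay in the cell forever and `F` would tend to `-∞` on it.
  refine ⟨lt_of_le_of_ne hA fun h0 => ?_, hBneg, hin⟩
  obtain ⟨M, hM⟩ := exists_lowerBound hB
  have := slope_nonneg_of_bddBelow (M := M) (a := I.F p) (b := B) fun τ hτ => by
    have hc := hin τ hτ (by rw [← h0]; linarith)
    have := hM _ hc.1
    rw [hF _ hc, ← h0] at this
    linarith
  linarith

lemma rayCritical_of_descent (hI : I.Admissible) (hB : BddBelow (I.F '' halfPlane))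
    {p d z : ℝ × ℝ} (hg : I.Good p) (hz : I.StrictIn above z) (hp : p ∈ I.Cell above) {i : Fin n}
    {j : Fin 4} (hij : I.s i p + I.β j = 0) (hd : I.s i d = 0) {η : ℝ} (hη : 0 < η)
    (hηc : ray p d η ∈ I.Cell above) (hlt : I.F (ray p d η) < I.F p) :
    I.RayCritical (I.Cell above ∩ {p | p.2 = I.L i j p.1}) p
      (ray p d (-I.quadB (I.kform above) p d / (2 * I.quadA (I.kform above) d))) := by
  obtain ⟨hA, hBn, hin⟩ := descent_along_line hI hB hg hp hij hd hη hηc hlt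
  set A := I.quadA (I.kform above) d with hAdef
  set B := I.quadB (I.kform above) p d with hBdef
  set T := -B / (2 * A) with hT
  have hT0 : 0 < T := div_pos (by linarith) (by linarith)
  have hTA : 2 * A * T = -B := by rw [hT]; field_simp
  have hF : ∀ τ, ray p d τ ∈ I.Cell above → I.F (ray p d τ) = A * τ ^ 2 + B * τ + I.F p := by
    intro τ hτ
    rw [F_eq_FG hI hτ, F_eq_FG hI hp, FG_ray hI]
  have hqc : ray p d T ∈ I.Cell above := hin T hT0.le (by nlinarith)
  have hFq : I.F (ray p d T) < I.F p := by rw [hF T hqc]; nlinarith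
  have hline : ∀ t, I.s i (ray p d t) + I.β j = 0 := by
    intro t; rw [s_ray, hd]; linarith
  refine ⟨⟨_, i, j, isRegion_iff.2 ⟨above, rfl, z, hz⟩, rfl, ?_⟩, ⟨hp, ?_⟩, ⟨hqc, ?_⟩, hFq, ?_⟩
  · refine ⟨p, ⟨hp, (eq_L_iff I i j p).2 hij⟩, ray p d T, ⟨hqc, (eq_L_iff I i j _).2 (hline T)⟩, ?_⟩
    intro h; rw [← h] at hFq; exact lt_irrefl _ hFq
  · exact (eq_L_iff I i j p).2 hij
  · exact (eq_L_iff I i j _).2 (hline T)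
  -- The quadratic formula is valid up to time `-B / A = 2 T`, hence on both sides of the minimum at
  -- `T`, also if `T` is reached at the end of what is known of the segment.
  · have hev : (fun t : ℝ => I.F (ray p d T + t • (ray p d T - p))) =ᶠ[𝓝 0]
        fun t => A * T ^ 2 * (t ^ 2 - 1) + I.F p := by
      have : Set.Ioo (-1 / 2 : ℝ) (1 / 2) ∈ 𝓝 (0 : ℝ) := Ioo_mem_nhds (by norm_num) (by norm_num)
      filter_upwards [this] with t ht
      have e1 : ray p d T + t • (ray p d T - p) = ray p d ((1 + t) * T) := by
        ext <;> simp <;> ring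
      have hpos : 0 ≤ (1 + t) * T := mul_nonneg (by linarith [ht.1]) hT0.le
      have hc := hin ((1 + t) * T) hpos (by
        have : A * ((1 + t) * T) = -B * ((1 + t) / 2) := by rw [← hTA]; ring
        rw [this]; nlinarith [ht.2])
      rw [e1, hF _ hc]
      have : B = -(2 * A * T) := by linarith
      rw [this]; ring
    have hder : HasDerivAt (fun t : ℝ => A * T ^ 2 * (t ^ 2 - 1) + I.F p) 0 0 := by
      have := (((hasDerivAt_pow 2 (0 : ℝ)).sub_const 1).const_mul (A * T ^ 2)).add_const (I.F p)
      simpa using this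
    exact hder.congr_of_eventuallyEq hev

lemma RayCritical.exists_cell {e : Set (ℝ × ℝ)} {p q : ℝ × ℝ} (h : I.RayCritical e p q) :
    ∃ above i j z, I.StrictIn above z ∧ e = I.Cell above ∩ {p | p.2 = I.L i j p.1} ∧
      p ∈ I.Cell above ∧ q ∈ I.Cell above ∧ I.s i p + I.β j = 0 ∧ I.s i q + I.β j = 0 := by
  obtain ⟨⟨Γ, i, j, hΓ, rfl, -⟩, hp, hq, -, -⟩ := h
  obtain ⟨above, rfl, z, hz⟩ := isRegion_iff.1 hΓ
  exact ⟨above, i, j, z, hz, rfl, hp.1, hq.1, (eq_L_iff I i j p).1 hp.2, (eq_L_iff I i j q).1 hq.2⟩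

/-- A critical point is the strict minimum point of the objective on its line. -/
lemma RayCritical.lt_line (hI : I.Admissible) (hB : BddBelow (I.F '' halfPlane))
    {e : Set (ℝ × ℝ)} {p q : ℝ × ℝ} (hg : I.Good p) (h : I.RayCritical e p q) {t : ℝ} (ht : t ≠ 1) :
    I.F q < I.F (ray p (q - p) t) := by
  obtain ⟨above, i, j, z, hz, rfl, hp, hq, hpl, hql⟩ := h.exists_cell
  obtain ⟨-, -, -, hlt, hder⟩ := h
  have hd : I.s i (q - p) = 0 := by rw [s_sub]; linarith
  obtain ⟨hA, hBn, hin⟩ := descent_along_line hI hB hg hp hpl hd one_pos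
    (by rwa [ray_sub_one]) (by rwa [ray_sub_one])
  set A := I.quadA (I.kform above) (q - p)
  set B := I.quadB (I.kform above) p (q - p)
  have hF : ∀ τ, ray p (q - p) τ ∈ I.Cell above →
      I.F (ray p (q - p) τ) = A * τ ^ 2 + B * τ + I.F p := by
    intro τ hτ
    rw [F_eq_FG hI hτ, F_eq_FG hI hp, FG_ray hI]
  have hFq : I.F q = A + B + I.F p := by
    have := hF 1 (by rwa [ray_sub_one])
    rw [ray_sub_one] at this; linarith
  -- Between `p` and `q` the objective is the quadratic, so its one-sided derivative at `q` is `2 A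
  -- + B`; a derivative on a nondegenerate interval is unique.
  have hAB : 2 * A + B = 0 := by
    have h1 : HasDerivWithinAt (fun t : ℝ => I.F (q + t • (q - p))) 0 (Set.Icc (-1) 0) 0 :=
      HasDerivAt.hasDerivWithinAt hder
    have h2 : HasDerivWithinAt (fun t : ℝ => A * (1 + t) ^ 2 + B * (1 + t) + I.F p) (2 * A + B)
        (Set.Icc (-1) 0) 0 := by
      have h0 : HasDerivAt (fun t : ℝ => 1 + t) 1 0 := (hasDerivAt_id (0 : ℝ)).const_add 1
      have := (((h0.pow 2).const_mul A).add (h0.const_mul B)).add_const (I.F p)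
      refine HasDerivAt.hasDerivWithinAt ?_
      convert this using 1
      simp; ring
    have h3 : HasDerivWithinAt (fun t : ℝ => I.F (q + t • (q - p))) (2 * A + B)
        (Set.Icc (-1) 0) 0 := by
      refine h2.congr (fun t ht => ?_) ?_
      · have e1 : q + t • (q - p) = ray p (q - p) (1 + t) := by
          ext <;> simp <;> ring
        have hc : ray p (q - p) (1 + t) ∈ I.Cell above := by
          refine mem_Cell.2 fun c => ?_
          rw [con_ray]
          have h1 := mem_Cell.1 hp c
          have h2 := mem_Cell.1 hq c
          nlinarith [mul_nonneg h1 (by linarith [ht.2] : 0 ≤ -t),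
            mul_nonneg h2 (by linarith [ht.1] : 0 ≤ 1 + t)]
        rw [e1, hF _ hc]
      · simp [hFq]
    exact (uniqueDiffOn_Icc (by norm_num) 0 (by simp)).eq_deriv _ h3 h1
  have hloc : ∀ τ, 0 ≤ τ → τ < 2 → τ ≠ 1 → I.F q < I.F (ray p (q - p) τ) := by
    intro τ h0 h2 hne
    have hc := hin τ h0 (by nlinarith)
    rw [hF _ hc, hFq]
    have : 0 < A * (τ - 1) ^ 2 := mul_pos hA (pow_pos_of_sq (sub_ne_zero.2 hne))
    nlinarith
  -- A point `1 + ε (t - 1)` close to 1 lies in the range of the local strict minimum; convexity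
  -- carries the inequality to `t`.
  obtain ⟨ε, hε0, hε1⟩ := (eventually_small (c := 1 / (|t - 1| + 1)) (by positivity)).exists
  rw [lt_div_iff₀ (by positivity)] at hε1
  have habs := abs_nonneg (t - 1)
  have hεt : |ε * (t - 1)| < 1 := by rw [abs_mul, abs_of_pos hε0]; nlinarith
  obtain ⟨ha, hb⟩ := abs_lt.1 hεt
  have h1 := hloc (1 + ε * (t - 1)) (by linarith) (by linarith) (by
    intro hh
    have : ε * (t - 1) = 0 := by linarith
    rcases mul_eq_zero.1 this with h | h
    · linarith
    · exact ht (by linarith))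
  have h2 := F_ray_le hI q (ray p (q - p) t) hε0.le (by nlinarith)
  have e : ray q (ray p (q - p) t - q) ε = ray p (q - p) (1 + ε * (t - 1)) := by
    ext <;> simp <;> ring
  rw [e] at h2
  nlinarith
where pow_pos_of_sq {a : ℝ} (h : a ≠ 0) : 0 < a ^ 2 := by positivity

/-- Each of two critical points on one line would be strictly lower than the other. In particular
there is no second one in the opposite direction. -/
lemma RayCritical.unique (hI : I.Admissible) (hB : BddBelow (I.F '' halfPlane))
    {e e' : Set (ℝ × ℝ)} {p q q' : ℝ × ℝ} (hg : I.Good p) (h : I.RayCritical e p q)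
    (h' : I.RayCritical e' p q') {i : Fin n} (hi : I.s i (q - p) = 0) (hi' : I.s i (q' - p) = 0) :
    q = q' := by
  simp only [s, Prod.fst_sub, Prod.snd_sub] at hi hi'
  have hne : ∀ r, I.F r < I.F p → 2 * (r.1 - p.1) * I.x i - (r.2 - p.2) = 0 → r.1 - p.1 ≠ 0 := by
    intro r hr hr' h0
    rw [h0] at hr'
    have : r = p := by ext <;> linarith
    rw [this] at hr
    exact lt_irrefl _ hr
  have h1 := hne q h.2.2.2.1 hi
  have h2 := hne q' h'.2.2.2.1 hi'
  have e1 : q' = ray p (q - p) ((q'.1 - p.1) / (q.1 - p.1)) := by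
    ext
    · simp; field_simp; ring
    · have : q.2 - p.2 = 2 * (q.1 - p.1) * I.x i := by linarith
      simp only [ray_snd, Prod.snd_sub, this]; field_simp; linarith
  have e2 : q = ray p (q' - p) ((q.1 - p.1) / (q'.1 - p.1)) := by
    ext
    · simp; field_simp; ring
    · have : q'.2 - p.2 = 2 * (q'.1 - p.1) * I.x i := by linarith
      simp only [ray_snd, Prod.snd_sub, this]; field_simp; linarith
  by_contra hqq
  have k1 := h.lt_line hI hB hg (t := (q'.1 - p.1) / (q.1 - p.1)) (fun hh => hqq (by
    rw [hh, ray_sub_one] at e1; exact e1.symm))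
  have k2 := h'.lt_line hI hB hg (t := (q.1 - p.1) / (q'.1 - p.1)) (fun hh => hqq (by
    rw [hh, ray_sub_one] at e2; exact e2))
  rw [← e1] at k1
  rw [← e2] at k2
  linarith

/-- If the objective falls below `F p` on a line through `p`, there is a critical point. -/
lemma exists_rayCritical (hI : I.Admissible) (hB : BddBelow (I.F '' halfPlane)) {p y : ℝ × ℝ}
    (hg : I.Good p) {i : Fin n} {j : Fin 4} (hij : I.s i p + I.β j = 0) (hy0 : 0 ≤ y.1)
    (hy : I.s i y + I.β j = 0) (hlt : I.F y < I.F p) : ∃ e q, I.RayCritical e p q := by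
  classical
  -- The cell just below `y`: lines not through `y` fix their side, and lines through `y` are put
  -- above the cell.
  set above : Fin n → Fin 4 → Bool := fun i' j' => decide (I.s i' y + I.β j' < 0) with hab
  have hcon : ∀ i' j', (I.con above (some (i', j')) y = 0 ∧ above i' j' = false ∧
      I.s i' y + I.β j' = 0) ∨ 0 < I.con above (some (i', j')) y := by
    intro i' j'
    simp only [con, hab, decide_eq_true_eq]
    split_ifs with h
    · right; linarith
    · rcases (not_lt.1 h).eq_or_lt with h0 | h0
      · left; exact ⟨h0.symm, by simp [← h0], h0.symm⟩
      · right; exact h0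
  have hstrict : ∃ z, I.StrictIn above z := by
    have : ∀ᶠ τ in 𝓝[>] (0 : ℝ), ∀ i' j', 0 < I.con above (some (i', j')) (ray y (0, -1) τ) := by
      rw [eventually_all]; intro i'
      rw [eventually_all]; intro j'
      rcases hcon i' j' with ⟨-, h2, h3⟩ | h
      · filter_upwards [eventually_small one_pos] with τ hτ
        simp only [con, h2, s_ray]
        simp [s] at h3 ⊢
        linarith
      · filter_upwards [eventually_pos h (I.con above (some (i', j')) (ray y (0, -1) 1) -
          I.con above (some (i', j')) y)] with τ hτ
        rw [con_ray_dir]; exact hτ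
    obtain ⟨τ, hτ⟩ := this.exists
    exact ⟨ray y (0, -1) τ, by simpa using hy0, hτ⟩
  obtain ⟨z, hz⟩ := hstrict
  have hyc : y ∈ I.Cell above := mem_Cell.2 fun c => match c with
    | none => hy0
    | some (i', j') => by rcases hcon i' j' with h | h; exacts [h.1.ge, h.le]
  -- A line separating `p` from `y` would meet the path between them in a vertex lower than `p`.
  have hpc : p ∈ I.Cell above := by
    refine mem_Cell.2 fun c => ?_
    rcases c with _ | ⟨i', j'⟩
    · exact hg.1
    by_contra hneg
    push Not at hneg
    rcases hcon i' j' with ⟨-, -, h3⟩ | hpos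
    · obtain ⟨hx, hβ⟩ := line_unique hy0 (hg.not_isVertex hlt) hy h3
      have : I.con above (some (i', j')) p = 0 := by
        rw [con_eq_zero_iff, s_congr hx, hβ]; exact hij
      linarith
    · set a := I.con above (some (i', j')) p
      set b := I.con above (some (i', j')) y
      have hba : 0 < b - a := by linarith
      have hτ0 : 0 < -a / (b - a) := div_pos (by linarith) hba
      have hτ1 : -a / (b - a) ≤ 1 := (div_le_one hba).2 (by linarith)
      have hw0 : I.con above (some (i', j')) (ray p (y - p) (-a / (b - a))) = 0 := by
        rw [con_ray]; change a + -a / (b - a) * (b - a) = 0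
        rw [div_mul_cancel₀ _ hba.ne']; ring
      have hwF := F_ray_lt hI hlt hτ0 hτ1
      have hwl : I.s i (ray p (y - p) (-a / (b - a))) + I.β j = 0 := by
        rw [s_ray, s_sub, show I.s i y = I.s i p by linarith]; linarith
      have hwH : 0 ≤ (ray p (y - p) (-a / (b - a))).1 := by
        have := hg.1
        simp only [ray_fst, Prod.fst_sub]
        nlinarith [mul_nonneg this (sub_nonneg.2 hτ1)]
      rw [con_eq_zero_iff] at hw0
      obtain ⟨hx, hβ⟩ := line_unique hwH (hg.not_isVertex hwF) hwl hw0
      have : I.con above (some (i', j')) y = 0 := by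
        rw [con_eq_zero_iff, s_congr hx, hβ]; exact hy
      exact hpos.ne' this
  have hd : I.s i (y - p) = 0 := by rw [s_sub]; linarith
  exact ⟨_, _, rayCritical_of_descent hI hB hg hz hpc hij hd one_pos (by rwa [ray_sub_one])
    (by rwa [ray_sub_one])⟩

/-! ### The exit test -/

theorem optimal_of_stops (hn : 1 ≤ n) (hI : I.Admissible) (hB : BddBelow (I.F '' halfPlane))
    {p : ℝ × ℝ} (hg : I.Good p) (hs : I.Stops p) {z : ℝ × ℝ} (hz0 : 0 ≤ z.1) : I.F p ≤ I.F z := by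
  classical
  by_contra hlt
  push Not at hlt
  have hline : ∀ i j, I.s i p + I.β j = 0 → ∀ y : ℝ × ℝ, 0 ≤ y.1 → I.s i y + I.β j = 0 →
      I.F p ≤ I.F y := by
    intro i j hij y hy0 hy
    by_contra hh
    push Not at hh
    obtain ⟨e, q, h⟩ := exists_rayCritical hI hB hg hij hy0 hy hh
    exact hs.2 e q h
  -- The cell entered by the path from `p` to `z`; by `hline` the point `z` is on no line through
  -- `p`, so the path goes into its interior.
  set above : Fin n → Fin 4 → Bool := fun i j =>
    decide (I.s i p + I.β j < 0 ∨ (I.s i p + I.β j = 0 ∧ I.s i z + I.β j < 0)) with hab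
  have hcon : ∀ i j, 0 < I.con above (some (i, j)) p ∨ (I.con above (some (i, j)) p = 0 ∧
      0 < I.con above (some (i, j)) z) := by
    intro i j
    simp only [con, hab, decide_eq_true_eq]
    rcases lt_trichotomy (I.s i p + I.β j) 0 with h | h | h
    · left; rw [if_pos (Or.inl h)]; linarith
    · right
      rcases lt_trichotomy (I.s i z + I.β j) 0 with h' | h' | h'
      · rw [if_pos (Or.inr ⟨h, h'⟩), if_pos (Or.inr ⟨h, h'⟩)]
        constructor <;> linarith
      · exact absurd (hline i j h z hz0 h') (not_le.2 hlt)
      · have : ¬ (I.s i p + I.β j < 0 ∨ (I.s i p + I.β j = 0 ∧ I.s i z + I.β j < 0)) := by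
          rintro (h1 | ⟨-, h1⟩) <;> linarith
        rw [if_neg this, if_neg this]; exact ⟨h, h'⟩
    · left
      have : ¬ (I.s i p + I.β j < 0 ∨ (I.s i p + I.β j = 0 ∧ I.s i z + I.β j < 0)) := by
        rintro (h1 | ⟨h1, -⟩) <;> linarith
      rw [if_neg this]; exact h
  have hpc : p ∈ I.Cell above := mem_Cell.2 fun c => match c with
    | none => hg.1
    | some (i, j) => by rcases hcon i j with h | h; exacts [h.le, h.1.ge]
  have hev : ∀ᶠ τ in 𝓝[>] (0 : ℝ), ∀ i j, 0 < I.con above (some (i, j)) (ray p (z - p) τ) := by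
    rw [eventually_all]; intro i
    rw [eventually_all]; intro j
    rcases hcon i j with h | ⟨h, h'⟩
    · filter_upwards [eventually_pos h (I.con above (some (i, j)) z -
        I.con above (some (i, j)) p)] with τ hτ
      rw [con_ray]; exact hτ
    · filter_upwards [eventually_small one_pos] with τ hτ
      rw [con_ray, h]
      nlinarith
  obtain ⟨ε, hε, hε0, hε1⟩ := (hev.and (eventually_small one_pos)).exists
  set a := ray p (z - p) ε with ha
  have ha0 : 0 ≤ a.1 := by
    have := hg.1
    simp only [ha, ray_fst, Prod.fst_sub]
    nlinarith
  have hastrict : I.StrictIn above a := ⟨ha0, hε⟩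
  have haF : I.F a < I.F p := F_ray_lt hI hlt hε0 hε1.le
  obtain ⟨c, hc⟩ := exists_active hn hI hB hg hastrict.mem haF
  have hm := isNearestMinimizer_region hI hB hastrict hc p
  set k := I.kform above with hk
  set m := I.nearMin k p
  have hFm : I.FG k m < I.F p := by
    refine lt_of_le_of_lt (hm.1.2 a ha0) ?_
    rwa [hk, ← F_eq_FG hI hastrict.mem]
  have hFa : I.FG k a < I.F p := by rwa [hk, ← F_eq_FG hI hastrict.mem]
  -- A point with `F_Γ` below `F p` in the cone of `Γ` at `p`, but on a line through `p`, gives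
  -- descent of `F` along this line near `p`, where `F = F_Γ`.
  have hcone : ∀ y : ℝ × ℝ, 0 ≤ y.1 → I.FG k y < I.F p →
      (∀ i j, I.s i p + I.β j = 0 → 0 ≤ I.con above (some (i, j)) y) →
      ∀ i j, I.s i p + I.β j = 0 → I.s i y + I.β j = 0 → False := by
    intro y hy0 hyF hyc i j hij hyl
    obtain ⟨η, hη, hη0, hη1⟩ := ((eventually_mem_Cell hpc hy0 hyc).and
      (eventually_small one_pos)).exists
    have h1 := hline i j hij _ hη.1 (by
      rw [s_ray, s_sub, show I.s i y = I.s i p by linarith]; linarith)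
    rw [F_eq_FG hI hη] at h1
    have h2 := FG_ray_le hI k p y hη0.le hη1.le
    have h3 : I.FG k p = I.F p := (F_eq_FG hI hpc).symm
    nlinarith
  -- Only the lines through `p` count here. The path from `a` to `m` remains below `F p` for `F_Γ`,
  -- so it cannot reach the border of the cone.
  have hmcone : ∀ i j, I.s i p + I.β j = 0 → 0 ≤ I.con above (some (i, j)) m := by
    obtain ⟨τ, h0, h1, hin, hex, -⟩ := exists_exit
      (fun c : {c : Fin n × Fin 4 // I.s c.1 p + I.β c.2 = 0} => I.con above (some c.1) a)
      (fun c => I.con above (some c.1) m) (fun c => (hε c.1.1 c.1.2).le)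
    rcases hex with rfl | ⟨⟨⟨i, j⟩, hij⟩, hc0, -⟩
    · intro i j hij
      have := hin ⟨(i, j), hij⟩
      linarith
    · exfalso
      refine hcone (ray a (m - a) τ) ?_ ?_ (fun i j hij => ?_) i j hij ?_
      · have : 0 ≤ m.1 := hm.1.1
        simp only [ray_fst, Prod.fst_sub]
        nlinarith
      · have := FG_ray_le hI k a m h0 h1
        nlinarith [hm.1.2 a ha0]
      · rw [con_ray]; exact hin ⟨(i, j), hij⟩
      · rw [← con_eq_zero_iff (above := above), con_ray]; exact hc0
  obtain ⟨η, hη, hη0, hη1⟩ := ((eventually_mem_Cell hpc hm.1.1 hmcone).and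
      (eventually_small one_pos)).exists
  obtain ⟨q, hq⟩ := exists_regionStep hI hastrict hpc hm hFm hη0 hη1.le hη
  exact hs.1 _ _ hq

/-- Each slope admits at most one critical point, by uniqueness on a line through `p`. Finiteness
ensures that a nearest critical point exists. -/
lemma finite_rayCritical (hI : I.Admissible) (hB : BddBelow (I.F '' halfPlane)) {p : ℝ × ℝ}
    (hg : I.Good p) : {q | ∃ e, I.RayCritical e p q}.Finite := by
  have hex : ∀ q : {q | ∃ e, I.RayCritical e p q}, ∃ i, I.s i (q.1 - p) = 0 := by
    rintro ⟨q, e, h⟩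
    obtain ⟨above, i, j, z, -, -, -, -, h1, h2⟩ := h.exists_cell
    exact ⟨i, by rw [s_sub]; linarith⟩
  choose f hf using hex
  refine Set.finite_coe_iff.1 ?_
  refine Finite.of_injective f ?_
  rintro ⟨q, e, h⟩ ⟨q', e', h'⟩ hff
  have h1 := hf ⟨q, e, h⟩
  have h2 := hf ⟨q', e', h'⟩
  rw [← hff] at h2
  exact Subtype.ext (h.unique hI hB hg h' h1 h2)

theorem exists_step_of_not_stops (hI : I.Admissible) (hB : BddBelow (I.F '' halfPlane))
    {p : ℝ × ℝ} (hg : I.Good p) (hs : ¬ I.Stops p) : ∃ R q, I.Step R p q := by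
  by_cases h : ∃ Γ q, I.RegionStep Γ p q
  · obtain ⟨Γ, q, h⟩ := h
    exact ⟨Γ, q, Or.inl h⟩
  · push Not at h
    have : ∃ e q, I.RayCritical e p q := by
      by_contra hh
      push Not at hh
      exact hs ⟨h, hh⟩
    obtain ⟨e, q, hq⟩ := this
    obtain ⟨q, ⟨e, hq⟩, hmin⟩ := (finite_rayCritical hI hB hg).exists_minimalFor
      (fun q => sqDist p q) _ ⟨q, e, hq⟩
    refine ⟨e, q, Or.inr ⟨h, hq, fun e' q' h' => ?_⟩⟩
    by_contra hlt
    push Not at hlt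
    exact absurd (hmin ⟨e', h'⟩ hlt.le) (not_le.2 hlt)

lemma Step.lt (hI : I.Admissible) {R : Set (ℝ × ℝ)} {p q : ℝ × ℝ} (h : I.Step R p q) :
    I.F q < I.F p := by
  rcases h with h | h
  · exact h.lt hI
  · exact h.2.1.2.2.2.1

lemma IsSegment.nonneg {e : Set (ℝ × ℝ)} (h : I.IsSegment e) {p : ℝ × ℝ} (hp : p ∈ e) :
    0 ≤ p.1 := by
  obtain ⟨Γ, i, j, hΓ, rfl, -⟩ := h
  obtain ⟨above, rfl, -⟩ := isRegion_iff.1 hΓ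
  exact hp.1.1

lemma Step.mem {R : Set (ℝ × ℝ)} {p q : ℝ × ℝ} (h : I.Step R p q) : p ∈ R ∧ q ∈ R ∧ 0 ≤ q.1 := by
  rcases h with h | ⟨-, h, -⟩
  · refine ⟨h.2.1, h.mem, ?_⟩
    obtain ⟨above, rfl, -⟩ := isRegion_iff.1 h.1
    exact h.mem.1
  · exact ⟨h.2.1, h.2.2.1, h.1.nonneg h.2.2.1⟩

end Newsvendor

namespace Newsvendor

/-! ### Sign patterns of affine functions -/

/-- The strict sign patterns that functions `h c` take on `K` (`true` for negative). -/
def signPatterns {ι X : Type*} (h : ι → X → ℝ) (K : Set X) : Set (ι → Bool) :=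
  {σ | ∃ p ∈ K, ∀ c, if σ c then h c p < 0 else 0 < h c p}

/-- Deletion and restriction: a pattern of the first `N` functions that extends with both signs of
the last one is realized at points on both sides of its zero set, hence by the hypothesis also on
the zero set. -/
lemma ncard_signPatterns_succ {N : ℕ} {X : Type*} (h : Fin (N + 1) → X → ℝ) (K : Set X)
    (hK : ∀ p ∈ K, ∀ q ∈ K, h (Fin.last N) p < 0 → 0 < h (Fin.last N) q →
      ∃ r ∈ K, h (Fin.last N) r = 0 ∧ ∀ c, (h c p < 0 → h c q < 0 → h c r < 0) ∧
        (0 < h c p → 0 < h c q → 0 < h c r)) :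
    (signPatterns h K).ncard ≤ (signPatterns (fun c : Fin N => h c.castSucc) K).ncard +
      (signPatterns (fun c : Fin N => h c.castSucc) (K ∩ {p | h (Fin.last N) p = 0})).ncard := by
  classical
  set R : Bool → Set (Fin N → Bool) := fun b => {σ | Fin.snoc (α := fun _ => Bool) σ b ∈ signPatterns h K} with hR
  have h1 : signPatterns h K ⊆ ((fun σ => Fin.snoc (α := fun _ => Bool) σ true) '' R true) ∪
      ((fun σ => Fin.snoc (α := fun _ => Bool) σ false) '' R false) := by
    intro σ hσ
    have e := Fin.snoc_init_self σ
    cases hb : σ (Fin.last N)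
    · rw [hb] at e
      exact Or.inr ⟨Fin.init σ, show Fin.snoc (α := fun _ => Bool) (Fin.init σ) false ∈ _ from
        e.symm ▸ hσ, e⟩
    · rw [hb] at e
      exact Or.inl ⟨Fin.init σ, show Fin.snoc (α := fun _ => Bool) (Fin.init σ) true ∈ _ from
        e.symm ▸ hσ, e⟩
  have h2 : R true ∪ R false ⊆ signPatterns (fun c : Fin N => h c.castSucc) K := by
    rintro σ (⟨p, hp, hσ⟩ | ⟨p, hp, hσ⟩)
    all_goals
      refine ⟨p, hp, fun c => ?_⟩
      have := hσ c.castSucc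
      rwa [Fin.snoc_castSucc] at this
  have h3 : R true ∩ R false ⊆
      signPatterns (fun c : Fin N => h c.castSucc) (K ∩ {p | h (Fin.last N) p = 0}) := by
    rintro σ ⟨⟨p, hp, hσ⟩, q, hq, hσ'⟩
    have e1 := hσ (Fin.last N)
    have e2 := hσ' (Fin.last N)
    rw [Fin.snoc_last] at e1 e2
    obtain ⟨r, hr, hr0, hrc⟩ := hK p hp q hq (by simpa using e1) (by simpa using e2)
    refine ⟨r, ⟨hr, hr0⟩, fun c => ?_⟩
    have e1 := hσ c.castSucc
    have e2 := hσ' c.castSucc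
    rw [Fin.snoc_castSucc] at e1 e2
    split_ifs at e1 e2 ⊢
    · exact (hrc _).1 e1 e2
    · exact (hrc _).2 e1 e2
  calc (signPatterns h K).ncard
      ≤ _ := Set.ncard_le_ncard h1 (Set.toFinite _)
    _ ≤ _ := Set.ncard_union_le _ _
    _ ≤ (R true).ncard + (R false).ncard :=
      add_le_add (Set.ncard_image_le (Set.toFinite _)) (Set.ncard_image_le (Set.toFinite _))
    _ = (R true ∪ R false).ncard + (R true ∩ R false).ncard :=
      (Set.ncard_union_add_ncard_inter _ _ (Set.toFinite _) (Set.toFinite _)).symm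
    _ ≤ _ := add_le_add (Set.ncard_le_ncard h2 (Set.toFinite _))
      (Set.ncard_le_ncard h3 (Set.toFinite _))

lemma ncard_signPatterns_subsingleton {ι X : Type*} [Finite ι] (h : ι → X → ℝ) {K : Set X}
    (hK : K.Subsingleton) : (signPatterns h K).ncard ≤ 1 := by
  refine (Set.ncard_le_one (Set.toFinite _)).2 ?_
  rintro σ ⟨p, hp, hσ⟩ σ' ⟨q, hq, hσ'⟩
  obtain rfl := hK hp hq
  funext c
  have e1 := hσ c
  have e2 := hσ' c
  cases h1 : σ c <;> cases h2 : σ' c <;> simp [h1, h2] at e1 e2 ⊢ <;> linarith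

/-- A nonzero affine function on the half-line has at most one zero, so each function adds at most
one pattern; the zero function admits no strict pattern at all. -/
lemma ncard_signPatterns_line : ∀ {N : ℕ} (a b : Fin N → ℝ),
    (signPatterns (fun c t => a c + t * b c) (Set.Ici (0 : ℝ))).ncard ≤ N + 1
  | 0, a, b => by
    refine (Set.ncard_le_one (Set.toFinite _)).2 fun σ _ σ' _ => Subsingleton.elim _ _
  | N + 1, a, b => by
    by_cases hb : b (Fin.last N) = 0 ∧ a (Fin.last N) = 0
    · have : signPatterns (fun c t => a c + t * b c) (Set.Ici (0 : ℝ)) = ∅ := by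
        refine Set.eq_empty_of_forall_notMem ?_
        rintro σ ⟨p, -, hσ⟩
        have := hσ (Fin.last N)
        simp [hb.1, hb.2] at this
      rw [this]; simp
    have ih := ncard_signPatterns_line (fun c : Fin N => a c.castSucc) fun c => b c.castSucc
    have hs := ncard_signPatterns_succ (fun c t => a c + t * b c) (Set.Ici (0 : ℝ)) (by
      intro p hp q hq hneg hpos
      set u := a (Fin.last N) + p * b (Fin.last N)
      set v := a (Fin.last N) + q * b (Fin.last N)
      have huv : 0 < v - u := by linarith
      have e0 : 0 ≤ v / (v - u) := div_nonneg hpos.le huv.le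
      have e0' : 0 < v / (v - u) := div_pos hpos huv
      have e1 : 0 < -u / (v - u) := div_pos (by linarith) huv
      have e2 : v / (v - u) + -u / (v - u) = 1 := by field_simp; ring
      have hp' : 0 ≤ p := hp
      have hq' : 0 ≤ q := hq
      have key : ∀ c, a c + (v / (v - u) * p + -u / (v - u) * q) * b c =
          v / (v - u) * (a c + p * b c) + -u / (v - u) * (a c + q * b c) := by
        intro c
        have : a c = (v / (v - u) + -u / (v - u)) * a c := by rw [e2, one_mul]
        nlinarith
      refine ⟨v / (v - u) * p + -u / (v - u) * q, ?_, ?_, fun c => ⟨fun h1 h2 => ?_, fun h1 h2 => ?_⟩⟩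
      · exact add_nonneg (mul_nonneg e0 hp') (mul_nonneg e1.le hq')
      · rw [key]; change v / (v - u) * u + -u / (v - u) * v = 0
        field_simp; ring
      · rw [key]; nlinarith
      · rw [key]; nlinarith [mul_pos e0' h1, mul_pos e1 h2])
    refine hs.trans (add_le_add ih ?_)
    refine ncard_signPatterns_subsingleton _ ?_
    rintro p ⟨-, hp⟩ q ⟨-, hq⟩
    simp only [Set.mem_ofPred_eq] at hp hq
    by_contra hne
    have : (p - q) * b (Fin.last N) = 0 := by linarith
    rcases mul_eq_zero.1 this with h | h
    · exact hne (by linarith)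
    · exact hb ⟨h, by rw [h] at hp; linarith⟩

/-- The restriction to the last line is a system of affine functions of `λ₁ ≥ 0`, which contributes
at most `N + 1` patterns; `(N² + 1) + (N + 1) ≤ (N + 1)² + 1`. -/
lemma ncard_signPatterns_halfPlane : ∀ {N : ℕ} (a b : Fin N → ℝ),
    (signPatterns (fun c (p : ℝ × ℝ) => 2 * p.1 * a c - p.2 + b c) halfPlane).ncard ≤ N ^ 2 + 1
  | 0, a, b => by
    refine (Set.ncard_le_one (Set.toFinite _)).2 fun σ _ σ' _ => Subsingleton.elim _ _
  | N + 1, a, b => by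
    have ih := ncard_signPatterns_halfPlane (fun c : Fin N => a c.castSucc) fun c => b c.castSucc
    have hs := ncard_signPatterns_succ (fun c (p : ℝ × ℝ) => 2 * p.1 * a c - p.2 + b c) halfPlane (by
      intro p hp q hq hneg hpos
      set u := 2 * p.1 * a (Fin.last N) - p.2 + b (Fin.last N)
      set v := 2 * q.1 * a (Fin.last N) - q.2 + b (Fin.last N)
      have huv : 0 < v - u := by linarith
      have e0' : 0 < v / (v - u) := div_pos hpos huv
      have e1 : 0 < -u / (v - u) := div_pos (by linarith) huv
      have e2 : v / (v - u) + -u / (v - u) = 1 := by field_simp; ring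
      have hp' : 0 ≤ p.1 := hp
      have hq' : 0 ≤ q.1 := hq
      set y := v / (v - u) with hy
      set z := -u / (v - u) with hz
      have key : ∀ c, 2 * (y * p.1 + z * q.1) * a c - (y * p.2 + z * q.2) + b c =
          y * (2 * p.1 * a c - p.2 + b c) + z * (2 * q.1 * a c - q.2 + b c) := by
        intro c
        have : b c = (y + z) * b c := by rw [e2, one_mul]
        nlinarith
      refine ⟨(y * p.1 + z * q.1, y * p.2 + z * q.2), ?_, ?_,
        fun c => ⟨fun h1 h2 => ?_, fun h1 h2 => ?_⟩⟩
      · exact add_nonneg (mul_nonneg e0'.le hp') (mul_nonneg e1.le hq')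
      · rw [key]; change y * u + z * v = 0
        rw [hy, hz]; field_simp; ring
      · rw [key]; nlinarith
      · rw [key]; nlinarith [mul_pos e0' h1, mul_pos e1 h2])
    have hl := ncard_signPatterns_line (fun c : Fin N => b c.castSucc - b (Fin.last N))
      (fun c => 2 * (a c.castSucc - a (Fin.last N)))
    have hsub : signPatterns (fun (c : Fin N) (p : ℝ × ℝ) => 2 * p.1 * a c.castSucc - p.2 + b c.castSucc)
        (halfPlane ∩ {p | 2 * p.1 * a (Fin.last N) - p.2 + b (Fin.last N) = 0}) ⊆
        signPatterns (fun (c : Fin N) t => (b c.castSucc - b (Fin.last N)) +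
          t * (2 * (a c.castSucc - a (Fin.last N)))) (Set.Ici 0) := by
      rintro σ ⟨p, ⟨hp, hp0⟩, hσ⟩
      refine ⟨p.1, hp, fun c => ?_⟩
      have h1 := hσ c
      have h0 : 2 * p.1 * a (Fin.last N) - p.2 + b (Fin.last N) = 0 := hp0
      split_ifs at h1 ⊢ <;> linarith
    have := Set.ncard_le_ncard hsub (Set.toFinite _)
    calc _ ≤ _ := hs
      _ ≤ (N ^ 2 + 1) + (N + 1) := add_le_add ih (this.trans hl)
      _ ≤ (N + 1) ^ 2 + 1 := by nlinarith

lemma ncard_signPatterns_equiv {ι κ X : Type*} [Finite κ] (e : ι ≃ κ) (h : ι → X → ℝ) (K : Set X) :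
    (signPatterns h K).ncard ≤ (signPatterns (fun c => h (e.symm c)) K).ncard := by
  refine Set.ncard_le_ncard_of_injOn (fun σ c => σ (e.symm c)) ?_ ?_ (Set.toFinite _)
  · rintro σ ⟨p, hp, hσ⟩
    exact ⟨p, hp, fun c => hσ _⟩
  · intro σ _ σ' _ hh
    funext c
    have := congrFun hh (e c)
    simpa using this

/-! ### Size of the arrangement -/

variable {n : ℕ} {I : Newsvendor n}

variable (I) in
lemma regions_bound (hn : 1 ≤ n) : I.regions.Finite ∧ I.regions.ncard ≤ 17 * n ^ 2 := by
  classical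
  let h : Fin n × Fin 4 → ℝ × ℝ → ℝ := fun c p => 2 * p.1 * I.x c.1 - p.2 + I.β c.2
  have hsub : I.regions ⊆ (fun σ : Fin n × Fin 4 → Bool => I.Cell fun i j => σ (i, j)) ''
      signPatterns h halfPlane := by
    rintro Γ hΓ
    obtain ⟨above, rfl, z, hz⟩ := isRegion_iff.1 hΓ
    refine ⟨fun c => above c.1 c.2, ⟨z, hz.1, fun c => ?_⟩, rfl⟩
    have := hz.2 c.1 c.2
    simp only [con, s] at this
    simp only [h]
    split_ifs at this ⊢ <;> linarith
  have hfin : ((fun σ : Fin n × Fin 4 → Bool => I.Cell fun i j => σ (i, j)) ''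
      signPatterns h halfPlane).Finite := (Set.toFinite _).image _
  refine ⟨hfin.subset hsub, ?_⟩
  calc I.regions.ncard ≤ _ := Set.ncard_le_ncard hsub hfin
    _ ≤ _ := Set.ncard_image_le (Set.toFinite _)
    _ ≤ _ := ncard_signPatterns_equiv finProdFinEquiv h halfPlane
    _ ≤ (n * 4) ^ 2 + 1 := ncard_signPatterns_halfPlane _ _
    _ ≤ 17 * n ^ 2 := by nlinarith

variable (I) in
lemma segments_bound (hn : 1 ≤ n) : I.segments.Finite ∧ I.segments.ncard ≤ 20 * n ^ 2 := by
  classical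
  -- On a fixed line a line of another slope is an affine function of `λ₁`; parallel lines, which
  -- may even coincide with it, are replaced by the constant 1 so that strict patterns exist.
  let h : Fin n × Fin 4 → Fin n × Fin 4 → ℝ → ℝ := fun c c' t =>
    (if I.x c'.1 ≠ I.x c.1 then I.β c'.2 - I.β c.2 else 1) +
      t * (if I.x c'.1 ≠ I.x c.1 then 2 * (I.x c'.1 - I.x c.1) else 0)
  let E : Fin n × Fin 4 → (Fin n × Fin 4 → Bool) → Set (ℝ × ℝ) := fun c σ =>
    {p | p.2 = I.L c.1 c.2 p.1 ∧ 0 ≤ p.1 ∧ ∀ c', I.x c'.1 ≠ I.x c.1 →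
      0 ≤ I.con (fun i j => σ (i, j)) (some c') p}
  have hsub : I.segments ⊆ ⋃ c, E c '' signPatterns (h c) (Set.Ici 0) := by
    rintro e ⟨Γ, i, j, hΓ, rfl, ⟨p, hp, q, hq, hne⟩⟩
    obtain ⟨above, rfl, z, hz⟩ := isRegion_iff.1 hΓ
    refine Set.mem_iUnion.2 ⟨(i, j), ?_⟩
    have hpl := (eq_L_iff I i j p).1 hp.2
    have hql := (eq_L_iff I i j q).1 hq.2
    have hpq : p.1 ≠ q.1 := by
      intro h0
      apply hne
      ext
      · exact h0
      · have h1 : p.2 = I.L i j p.1 := hp.2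
        have h2 : q.2 = I.L i j q.1 := hq.2
        rw [h1, h2, h0]
    -- The midpoint of two points of the segment is strictly on the prescribed side of every
    -- transversal line: weak inequalities at both ends cannot both be equalities.
    refine ⟨fun c => if I.x c.1 ≠ I.x i then above c.1 c.2 else false,
      ⟨(p.1 + q.1) / 2, ?_, fun c => ?_⟩, ?_⟩
    · have h1 : 0 ≤ p.1 := hp.1.1
      have h2 : 0 ≤ q.1 := hq.1.1
      change 0 ≤ (p.1 + q.1) / 2
      linarith
    · by_cases hx : I.x c.1 ≠ I.x i
      · have h1 := mem_Cell.1 hp.1 (some c)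
        have h2 := mem_Cell.1 hq.1 (some c)
        have hd : (p.1 - q.1) * (I.x c.1 - I.x i) ≠ 0 :=
          mul_ne_zero (sub_ne_zero.2 hpq) (sub_ne_zero.2 hx)
        have ep : I.s c.1 p + I.β c.2 = (I.β c.2 - I.β j) + p.1 * (2 * (I.x c.1 - I.x i)) := by
          simp only [s] at hpl ⊢; linarith
        have eq : I.s c.1 q + I.β c.2 = (I.β c.2 - I.β j) + q.1 * (2 * (I.x c.1 - I.x i)) := by
          simp only [s] at hql ⊢; linarith
        simp only [con, ep, eq] at h1 h2
        simp only [h, if_pos hx]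
        split_ifs at h1 h2 ⊢
        · refine lt_of_le_of_ne (by linarith) fun h0 => hd (by linarith)
        · refine lt_of_le_of_ne (by linarith) fun h0 => hd (by linarith)
      · simp only [h, if_neg hx]; simp
    · ext y
      constructor
      · rintro ⟨hyl, hy0, hy⟩
        refine ⟨mem_Cell.2 fun c => ?_, hyl⟩
        rcases c with _ | c
        · exact hy0
        by_cases hx : I.x c.1 ≠ I.x i
        · have := hy c hx
          simpa only [con, if_pos hx] using this
        · push Not at hx
          have h1 := mem_Cell.1 hp.1 (some c)
          have hyl' := (eq_L_iff I i j y).1 hyl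
          have : I.s c.1 y = I.s c.1 p := by rw [s_congr hx, s_congr hx]; linarith
          simpa only [con, this] using h1
      · rintro ⟨hyc, hyl⟩
        refine ⟨hyl, hyc.1, fun c hx => ?_⟩
        have := mem_Cell.1 hyc (some c)
        simpa only [con, if_pos hx] using this
  have hfin : (⋃ c, E c '' signPatterns (h c) (Set.Ici 0)).Finite :=
    Set.finite_iUnion fun c => (Set.toFinite _).image _
  refine ⟨hfin.subset hsub, ?_⟩
  calc I.segments.ncard ≤ _ := Set.ncard_le_ncard hsub hfin
    _ ≤ _ := Set.ncard_iUnion_le_of_fintype _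
    _ ≤ ∑ _c : Fin n × Fin 4, (n * 4 + 1) := Finset.sum_le_sum fun c _ =>
      (Set.ncard_image_le (Set.toFinite _)).trans
        ((ncard_signPatterns_equiv finProdFinEquiv (h c) _).trans (ncard_signPatterns_line _ _))
    _ ≤ 20 * n ^ 2 := by simp; nlinarith

variable (I) in
lemma vertices_bound (hn : 1 ≤ n) : I.vertices.Finite ∧ I.vertices.ncard ≤ 20 * n ^ 2 := by
  classical
  -- Every vertex is the intersection of a line with the axis (`none`) or with a second line; for
  -- parallel lines the value is meaningless and harmless.
  let v : (Fin n × Fin 4) × Option (Fin n × Fin 4) → ℝ × ℝ := fun c => match c.2 with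
    | none => (0, I.β c.1.2)
    | some c' => ((I.β c'.2 - I.β c.1.2) / (2 * (I.x c.1.1 - I.x c'.1)),
        I.L c.1.1 c.1.2 ((I.β c'.2 - I.β c.1.2) / (2 * (I.x c.1.1 - I.x c'.1))))
  have hsub : I.vertices ⊆ v '' Set.univ := by
    rintro p ⟨hp0, i, j, hl, h | ⟨i', j', hl', hx⟩⟩
    · refine ⟨((i, j), none), trivial, ?_⟩
      ext
      · exact h.symm
      · rw [hl, h]; simp [v, L]
    · have hx' : I.x i - I.x i' ≠ 0 := sub_ne_zero.2 (Ne.symm hx)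
      have : (I.β j' - I.β j) / (2 * (I.x i - I.x i')) = p.1 := by
        rw [hl] at hl'
        simp only [L] at hl'
        field_simp
        linarith
      refine ⟨((i, j), some (i', j')), trivial, ?_⟩
      ext
      · exact this
      · simp only [v, this]; exact hl.symm
  have hfin : (v '' Set.univ).Finite := (Set.toFinite _).image _
  refine ⟨hfin.subset hsub, ?_⟩
  calc I.vertices.ncard ≤ _ := Set.ncard_le_ncard hsub hfin
    _ ≤ _ := Set.ncard_image_le (Set.toFinite _)
    _ = n * 4 * (n * 4 + 1) := by rw [Set.ncard_univ]; simp
    _ ≤ 20 * n ^ 2 := by nlinarith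

lemma exists_isStart (hn : 1 ≤ n) : ∃ p, I.IsStart p := by
  obtain ⟨p, hp, hmin⟩ := Set.exists_min_image I.vertices I.F (vertices_bound I hn).1
    ⟨(0, I.β 0), isVertex_axis hn 0⟩
  exact ⟨p, hp, hmin⟩

end Newsvendor

namespace Newsvendor

open Filter Topology

variable {n : ℕ} {I : Newsvendor n} {above : Fin n → Fin 4 → Bool}

/-! ### Cells around points below the vertices -/

lemma exists_ray_of_line {i : Fin n} {p q r : ℝ × ℝ} (hq : I.s i (q - p) = 0)
    (hr : I.s i (r - p) = 0) (hne : q ≠ p) : ∃ t, r = ray p (q - p) t := by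
  simp only [s, Prod.fst_sub, Prod.snd_sub] at hq hr
  have h1 : q.1 - p.1 ≠ 0 := by
    intro h0
    rw [h0] at hq
    exact hne (by ext <;> linarith)
  refine ⟨(r.1 - p.1) / (q.1 - p.1), ?_⟩
  ext
  · simp; field_simp; ring
  · have : q.2 - p.2 = 2 * (q.1 - p.1) * I.x i := by linarith
    simp only [ray_snd, Prod.snd_sub, this]; field_simp; linarith

/-- Two points below the vertices on the same line lie in the same cells. -/
lemma mem_Cell_of_line (hI : I.Admissible) {g a b : ℝ × ℝ} (hg : I.Good g) (hb0 : 0 ≤ b.1)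
    (ha : I.F a < I.F g) (hb : I.F b < I.F g) {i : Fin n} {j : Fin 4} (hal : I.s i a + I.β j = 0)
    (hbl : I.s i b + I.β j = 0) (hac : a ∈ I.Cell above) : b ∈ I.Cell above := by
  refine mem_Cell.2 fun c => ?_
  rcases c with _ | ⟨i', j'⟩
  · exact hb0
  by_contra hneg
  push Not at hneg
  have hca := mem_Cell.1 hac (some (i', j'))
  set u := I.con above (some (i', j')) a
  set v := I.con above (some (i', j')) b with hv
  have huv : 0 < u - v := by linarith
  have hτ0 : 0 ≤ u / (u - v) := div_nonneg hca huv.le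
  have hτ1 : u / (u - v) ≤ 1 := (div_le_one huv).2 (by linarith)
  have hw0 : I.con above (some (i', j')) (ray a (b - a) (u / (u - v))) = 0 := by
    rw [con_ray]; change u + u / (u - v) * (v - u) = 0
    field_simp; ring
  have hwF : I.F (ray a (b - a) (u / (u - v))) < I.F g := by
    have h1 := F_ray_le hI a b hτ0 hτ1
    have h2 := mul_le_mul_of_nonneg_left (le_max_left (I.F a) (I.F b)) (sub_nonneg.2 hτ1)
    have h3 := mul_le_mul_of_nonneg_left (le_max_right (I.F a) (I.F b)) hτ0
    have h4 := max_lt ha hb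
    linarith
  have hwl : I.s i (ray a (b - a) (u / (u - v))) + I.β j = 0 := by
    rw [s_ray, s_sub, show I.s i b = I.s i a by linarith]; linarith
  have hwH : 0 ≤ (ray a (b - a) (u / (u - v))).1 := by
    have := hac.1
    simp only [ray_fst, Prod.fst_sub]
    nlinarith
  rw [con_eq_zero_iff] at hw0
  obtain ⟨hx, hβ⟩ := line_unique hwH (hg.not_isVertex hwF) hwl hw0
  have : v = 0 := by
    rw [hv, con_eq_zero_iff, s_congr hx, hβ]; exact hbl
  linarith

lemma above_eq_of_con_ne {above' : Fin n → Fin 4 → Bool} {a : ℝ × ℝ} (h : a ∈ I.Cell above)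
    (h' : a ∈ I.Cell above') {i : Fin n} {j : Fin 4} (hl : I.s i a + I.β j ≠ 0) :
    above i j = above' i j := by
  have h1 := con_some_nonneg h i j
  have h2 := con_some_nonneg h' i j
  cases e1 : above i j <;> cases e2 : above' i j <;> simp [e1, e2] at h1 h2 ⊢ <;>
    exact hl (by linarith)

/-- At a point that is no vertex all lines through it coincide, so the side of one of them
determines the cell. Hence at most two regions are adjacent. -/
lemma above_unique {above' : Fin n → Fin 4 → Bool} {a z z' : ℝ × ℝ} (hv : ¬ I.IsVertex a)
    (hz : I.StrictIn above z) (hz' : I.StrictIn above' z') (h : a ∈ I.Cell above)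
    (h' : a ∈ I.Cell above') {i : Fin n} {j : Fin 4} (hl : I.s i a + I.β j = 0)
    (hij : above i j = above' i j) : above = above' := by
  funext i' j'
  by_cases hl' : I.s i' a + I.β j' = 0
  · obtain ⟨hx, hβ⟩ := line_unique h.1 hv hl hl'
    rw [hz.congr_above hx hβ, hz'.congr_above hx hβ, hij]
  · exact above_eq_of_con_ne h h' hl'

lemma regionsAt_finite (hn : 1 ≤ n) (a : ℝ × ℝ) : (I.regionsAt a).Finite :=
  (regions_bound I hn).1.subset fun _ h => h.1

lemma segmentsAt_finite (hn : 1 ≤ n) (a : ℝ × ℝ) : (I.segmentsAt a).Finite :=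
  (segments_bound I hn).1.subset fun _ h => h.1

lemma ncard_regionsAt_le (a : ℝ × ℝ) (hv : ¬ I.IsVertex a) : (I.regionsAt a).ncard ≤ 2 := by
  by_cases hl : ∃ i j, I.s i a + I.β j = 0
  · obtain ⟨i, j, hl⟩ := hl
    let R : Bool → Set (Set (ℝ × ℝ)) := fun b =>
      {Γ | ∃ above z, I.StrictIn above z ∧ Γ = I.Cell above ∧ a ∈ I.Cell above ∧ above i j = b}
    have hR : ∀ b, (R b).Subsingleton := by
      rintro b _ ⟨ab, z, hz, rfl, ha, hb⟩ _ ⟨ab', z', hz', rfl, ha', hb'⟩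
      rw [above_unique hv hz hz' ha ha' hl (hb.trans hb'.symm)]
    have hfin : ∀ b, (R b).Finite := fun b => (hR b).finite
    have hsub : I.regionsAt a ⊆ R true ∪ R false := by
      rintro Γ ⟨hΓ, ha⟩
      obtain ⟨above, rfl, z, hz⟩ := isRegion_iff.1 hΓ
      cases hb : above i j
      · exact Or.inr ⟨above, z, hz, rfl, ha, hb⟩
      · exact Or.inl ⟨above, z, hz, rfl, ha, hb⟩
    calc (I.regionsAt a).ncard ≤ _ := Set.ncard_le_ncard hsub ((hfin _).union (hfin _))
      _ ≤ _ := Set.ncard_union_le _ _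
      _ ≤ 1 + 1 := add_le_add ((Set.ncard_le_one (hfin _)).2 fun _ h _ h' => hR _ h h')
        ((Set.ncard_le_one (hfin _)).2 fun _ h _ h' => hR _ h h')
  · push Not at hl
    have hs : (I.regionsAt a).Subsingleton := by
      rintro Γ ⟨hΓ, ha⟩ Γ' ⟨hΓ', ha'⟩
      obtain ⟨above, rfl, -⟩ := isRegion_iff.1 hΓ
      obtain ⟨above', rfl, -⟩ := isRegion_iff.1 hΓ'
      have : above = above' := by
        funext i j; exact above_eq_of_con_ne ha ha' (hl i j)
      rw [this]
    exact ((Set.ncard_le_one hs.finite).2 fun _ h _ h' => hs h h').trans one_le_two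

lemma line_set_eq {i i' : Fin n} {j j' : Fin 4} (hx : I.x i' = I.x i) (hβ : I.β j' = I.β j) :
    {p : ℝ × ℝ | p.2 = I.L i' j' p.1} = {p | p.2 = I.L i j p.1} := by
  simp only [L, hx, hβ]

/-- Only one line passes through the point, so a segment there is determined by an adjacent region.
-/
lemma ncard_segmentsAt_le (hn : 1 ≤ n) (a : ℝ × ℝ) (hv : ¬ I.IsVertex a) :
    (I.segmentsAt a).ncard ≤ 2 := by
  by_cases hl : ∃ i j, I.s i a + I.β j = 0
  · obtain ⟨i, j, hl⟩ := hl
    have hsub : I.segmentsAt a ⊆ (fun Γ => Γ ∩ {p | p.2 = I.L i j p.1}) '' I.regionsAt a := by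
      rintro e ⟨⟨Γ, i', j', hΓ, rfl, -⟩, ha⟩
      refine ⟨Γ, ⟨hΓ, ha.1⟩, ?_⟩
      obtain ⟨above, rfl, -⟩ := isRegion_iff.1 hΓ
      obtain ⟨hx, hβ⟩ := line_unique ha.1.1 hv hl ((eq_L_iff I i' j' a).1 ha.2)
      rw [line_set_eq hx hβ]
    calc _ ≤ _ := Set.ncard_le_ncard hsub ((regionsAt_finite hn a).image _)
      _ ≤ _ := Set.ncard_image_le (regionsAt_finite hn a)
      _ ≤ 2 := ncard_regionsAt_le a hv
  · have : I.segmentsAt a = ∅ := by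
      refine Set.eq_empty_of_forall_notMem ?_
      rintro e ⟨⟨Γ, i, j, hΓ, rfl, -⟩, ha⟩
      exact hl ⟨i, j, (eq_L_iff I i j a).1 ha.2⟩
    rw [this]; simp

lemma not_isSegment_of_isRegion {Γ : Set (ℝ × ℝ)} (h : I.IsRegion Γ) : ¬ I.IsSegment Γ := by
  rintro ⟨Γ', i, j, -, he, -⟩
  obtain ⟨above, rfl, z, hz⟩ := isRegion_iff.1 h
  obtain ⟨τ, hτ, h0, -⟩ := ((hz.eventually (0, 1)).and (eventually_small one_pos)).exists
  have h1 : z ∈ I.Cell above := hz.mem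
  have h2 : ray z (0, 1) τ ∈ I.Cell above := StrictIn.mem ⟨by simpa using hz.1, hτ⟩
  rw [he] at h1 h2
  have e1 : z.2 = I.L i j z.1 := h1.2
  have e2 : z.2 + τ * 1 = I.L i j (z.1 + τ * 0) := h2.2
  rw [mul_zero, add_zero, ← e1] at e2
  linarith

/-- How a region step ends. -/
lemma RegionStep.exit (hI : I.Admissible) {p q z : ℝ × ℝ} (hz : I.StrictIn above z)
    (h : I.RegionStep (I.Cell above) p q) : ∃ m τ,
      IsNearestMinimizer (I.FG (I.kform above)) p m ∧ 0 < τ ∧ τ ≤ 1 ∧ q = ray p (m - p) τ ∧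
      (q = m ∨ ∃ i j, I.s i q + I.β j = 0 ∧ I.con above (some (i, j)) m < 0) := by
  obtain ⟨-, hp, G, m, hG, hm, -, hne, ⟨hq, hqc⟩, hmax⟩ := h
  rw [continuation_unique hI hz hG] at hm
  obtain ⟨τ, h0, h1, rfl⟩ := mem_segment_iff_ray.1 hq
  have hτ : 0 < τ := lt_of_le_of_ne h0 fun h => hne (by rw [← h, ray_zero])
  refine ⟨m, τ, hm, hτ, h1, rfl, ?_⟩
  obtain ⟨t, t0, t1, hin, hex, htmax⟩ := exists_exit (fun c => I.con above c p)
    (fun c => I.con above c m) (mem_Cell.1 hp)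
  have hle : τ ≤ t := htmax τ h1 fun c => by rw [← con_ray]; exact mem_Cell.1 hqc c
  have hmem := hmax (ray p (m - p) t) ⟨mem_segment_iff_ray.2 ⟨t, t0, t1, rfl⟩,
    mem_Cell.2 fun c => by rw [con_ray]; exact hin c⟩
  obtain ⟨r, r0, r1, hr⟩ := mem_segment_iff_ray.1 hmem
  have hge : t ≤ τ := by
    have e1 : t * (m.1 - p.1) = r * (τ * (m.1 - p.1)) := by simpa using congrArg Prod.fst hr
    have e2 : t * (m.2 - p.2) = r * (τ * (m.2 - p.2)) := by simpa using congrArg Prod.snd hr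
    by_contra hlt
    push Not at hlt
    -- The exit point lies on the path from `p` to `q`; if it came later than `q`, the direction `m
    -- - p` would have to vanish.
    have hsub : t - r * τ ≠ 0 := by nlinarith
    have e1 : (t - r * τ) * (m.1 - p.1) = 0 := by linarith
    have e2 : (t - r * τ) * (m.2 - p.2) = 0 := by linarith
    have e1 := (mul_eq_zero.1 e1).resolve_left hsub
    have e2 := (mul_eq_zero.1 e2).resolve_left hsub
    exact hne (by ext <;> simp [e1, e2])
  obtain rfl : t = τ := le_antisymm hge hle
  rcases hex with rfl | ⟨c, hc0, hcm⟩
  · left; exact ray_sub_one p m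
  · right
    rw [← con_ray] at hc0
    rcases c with _ | ⟨i, j⟩
    · have : 0 ≤ m.1 := hm.1.1
      exact absurd this (not_le.2 hcm)
    · exact ⟨i, j, (con_eq_zero_iff i j _).1 hc0, hcm⟩

/-- A search point off the lines is optimal. -/
lemma Step.optimal_of_off_lines (hI : I.Admissible) {R : Set (ℝ × ℝ)} {p q : ℝ × ℝ}
    (h : I.Step R p q) (hq : ∀ i j, I.s i q + I.β j ≠ 0) {y : ℝ × ℝ} (hy : 0 ≤ y.1) :
    I.F q ≤ I.F y := by
  rcases h with h | ⟨-, h, -⟩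
  · obtain ⟨above, rfl, z, hz⟩ := isRegion_iff.1 h.1
    have hqc := h.mem
    obtain ⟨m, τ, hm, -, -, -, rfl | ⟨i, j, hl, -⟩⟩ := h.exit hI hz
    · by_contra hlt
      push Not at hlt
      obtain ⟨η, hη, hη0, hη1⟩ := ((eventually_mem_Cell hqc hy
        fun i j hl => absurd hl (hq i j)).and (eventually_small one_pos)).exists
      have h1 := F_ray_lt hI hlt hη0 hη1.le
      rw [F_eq_FG hI hη, F_eq_FG hI hqc] at h1
      exact absurd (hm.1.2 _ hη.1) (not_le.2 h1)
    · exact absurd hl (hq i j)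
  · obtain ⟨above, i, j, z, -, -, -, -, -, hl⟩ := h.exists_cell
    exact absurd hl (hq i j)

/-! ### Runs -/

section Run

variable {K : ℕ} {p : ℕ → ℝ × ℝ} {P : ℕ → Set (ℝ × ℝ)}

lemma IsRun.lt (hI : I.Admissible) (h : I.IsRun K p P) {a b : ℕ} (hab : a < b) (hb : b ≤ K) :
    I.F (p b) < I.F (p a) := by
  induction b, hab using Nat.le_induction with
  | base => exact (h.2 a hb).lt hI
  | succ b hb' ih => exact ((h.2 b hb).lt hI).trans (ih (by omega))

lemma IsRun.nonneg (h : I.IsRun K p P) {k : ℕ} (hk : k ≤ K) : 0 ≤ (p k).1 := by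
  rcases k with _ | k
  · exact h.1.1.1
  · exact (h.2 k hk).mem.2.2

lemma IsRun.good (hI : I.Admissible) (h : I.IsRun K p P) {k : ℕ} (hk : k ≤ K) : I.Good (p k) := by
  rcases Nat.eq_zero_or_pos k with rfl | hk0
  · exact h.1.good
  · exact h.1.good.of_lt (h.nonneg hk) (h.lt hI hk0 hk)

lemma IsRun.not_isVertex (hI : I.Admissible) (h : I.IsRun K p P) {k : ℕ} (hk0 : 0 < k)
    (hk : k ≤ K) : ¬ I.IsVertex (p k) :=
  h.1.good.not_isVertex (h.lt hI hk0 hk)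

/-- After leaving a region through a line and reaching the lowest point on this line, the objective
cannot fall further in the region. -/
lemma no_return (hI : I.Admissible) {m r y : ℝ × ℝ} (hm : m ∈ halfPlane)
    (hmin : ∀ y ∈ halfPlane, I.FG (I.kform above) m ≤ I.FG (I.kform above) y) {i : Fin n} {j : Fin 4}
    (hmc : I.con above (some (i, j)) m < 0) (hrv : ¬ I.IsVertex r) (hrl : I.s i r + I.β j = 0)
    (hr : r ∈ I.Cell above) (hlow : ∀ y ∈ I.Cell above, I.s i y + I.β j = 0 → I.F r ≤ I.F y)
    (hy : y ∈ I.Cell above) : I.F r ≤ I.F y := by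
  by_contra hlt
  push Not at hlt
  have hyc := mem_Cell.1 hy (some (i, j))
  set u := I.con above (some (i, j)) y
  set v := I.con above (some (i, j)) m with hv
  have huv : 0 < u - v := by linarith
  have hτ0 : 0 ≤ u / (u - v) := div_nonneg hyc huv.le
  have hτ1 : u / (u - v) ≤ 1 := (div_le_one huv).2 (by linarith)
  set w := ray y (m - y) (u / (u - v)) with hw
  have hw0 : I.con above (some (i, j)) w = 0 := by
    rw [hw, con_ray]; change u + u / (u - v) * (v - u) = 0
    field_simp; ring
  have hwH : 0 ≤ w.1 := by
    have h1 : 0 ≤ y.1 := hy.1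
    have h2 : 0 ≤ m.1 := hm
    simp only [hw, ray_fst, Prod.fst_sub]
    nlinarith
  have hwl := (con_eq_zero_iff i j w).1 hw0
  have hwF : I.FG (I.kform above) w < I.F r := by
    have h1 := FG_ray_le hI (I.kform above) y m hτ0 hτ1
    have h2 := hmin y hy.1
    rw [F_eq_FG hI hy] at hlt
    nlinarith
  obtain ⟨η, hη, hη0, hη1⟩ := ((eventually_mem_Cell hr hwH fun i' j' hl' => by
    obtain ⟨hx, hβ⟩ := line_unique hr.1 hrv hrl hl'
    refine ((con_eq_zero_iff i' j' w).2 ?_).ge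
    rw [s_congr hx, hβ]; exact hwl).and (eventually_small one_pos)).exists
  have h1 := hlow _ hη (by
    rw [s_ray, s_sub, show I.s i w = I.s i r by linarith]; linarith)
  have h2 := FG_ray_le hI (I.kform above) r w hη0.le hη1.le
  rw [F_eq_FG hI hη] at h1
  rw [F_eq_FG hI hr] at h1 hwF
  nlinarith

lemma con_neg_of_ne {above' : Fin n → Fin 4 → Bool} {i : Fin n} {j : Fin 4}
    (h : above' i j ≠ above i j) (y : ℝ × ℝ) :
    I.con above' (some (i, j)) y = -I.con above (some (i, j)) y := by
  cases e1 : above i j <;> cases e2 : above' i j <;> simp [e1, e2] at h <;> simp [con, e1, e2]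

theorem IsRun.ne (hI : I.Admissible) (hB : BddBelow (I.F '' halfPlane)) (h : I.IsRun K p P)
    {k' : ℕ} : k' < K → ∀ k < k', P k ≠ P k' := by
  induction k' using Nat.strong_induction_on with
  | _ k' ih =>
  intro hk' k hk heq
  have hg0 := h.1.good
  have hlow : ∀ a, 0 < a → a ≤ K → I.F (p a) < I.F (p 0) := fun a h0 ha => h.lt hI h0 ha
  have hend : p (k' + 1) ∈ P k := heq ▸ (h.2 k' hk').mem.2.1
  have hendF : I.F (p (k' + 1)) < I.F (p (k + 1)) := h.lt hI (by omega) (by omega)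
  have hstep := h.2 k (by omega)
  rcases hstep with hstep | ⟨-, hstep, -⟩
  swap
  · obtain ⟨above, i, j, z, hz, hPe, -, -, hpl, hql⟩ := hstep.exists_cell
    rw [hPe] at hend
    have hrl := (eq_L_iff I i j _).1 hend.2
    have hne : p (k + 1) ≠ p k := by
      intro hh
      have := h.lt hI (Nat.lt_succ_self k) (by omega)
      rw [Nat.succ_eq_add_one, hh] at this
      exact lt_irrefl _ this
    obtain ⟨t, ht⟩ := exists_ray_of_line (i := i) (p := p k) (q := p (k + 1)) (r := p (k' + 1))
      (by rw [s_sub]; linarith) (by rw [s_sub]; linarith) hne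
    by_cases h1 : t = 1
    · rw [h1, ray_sub_one] at ht
      rw [ht] at hendF
      exact lt_irrefl _ hendF
    · have := hstep.lt_line hI hB (h.good hI (by omega)) h1
      rw [← ht] at this
      linarith
  · obtain ⟨above, hPk, z, hz⟩ := isRegion_iff.1 hstep.1
    rw [hPk] at hstep hend
    have hqc := hstep.mem
    obtain ⟨m, τ, hm, hτ0, hτ1, hq, hex⟩ := hstep.exit hI hz
    have hmend : I.FG (I.kform above) m ≤ I.F (p (k' + 1)) := by
      rw [F_eq_FG hI hend]; exact hm.1.2 _ hend.1
    rcases hex with hqm | ⟨i, j, hql, hmc⟩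
    · rw [← hqm, ← F_eq_FG hI hqc] at hmend
      linarith
    have hqm := isNearestMinimizer_ray hI hm hτ1
    rw [← hq] at hqm
    have hqv := h.not_isVertex hI (k := k + 1) (by omega) (by omega)
    have hstep2 := h.2 (k + 1) (by omega)
    -- the region itself cannot be used at the exit point
    have hnotsame : P (k + 1) ≠ P k := by
      intro hsame
      rw [hsame, hPk] at hstep2
      rcases hstep2 with h2 | ⟨-, h2, -⟩
      · have h2c := h2.mem
        obtain ⟨m', τ', hm', hτ'0, -, hr, -⟩ := h2.exit hI hz
        obtain rfl := nearestMinimizer_unique hI hm' hqm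
        have h3 := mem_Cell.1 h2c (some (i, j))
        rw [hr, con_ray, (con_eq_zero_iff i j _).2 hql] at h3
        nlinarith
      · exact not_isSegment_of_isRegion (isRegion_iff.2 ⟨above, rfl, z, hz⟩) h2.1
    have hk2 : k + 2 ≤ k' := by
      by_contra hh
      obtain rfl : k' = k + 1 := by omega
      exact hnotsame heq.symm
    have hrF : I.F (p (k' + 1)) < I.F (p (k + 1 + 1)) := h.lt hI (by omega) (by omega)
    have hrlow := hlow (k + 1 + 1) (by omega) (by omega)
    have hqlow := hlow (k + 1) (by omega) (by omega)
    have hr0 := h.nonneg (k := k + 1 + 1) (by omega)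
    have hrv := h.not_isVertex hI (k := k + 1 + 1) (by omega) (by omega)
    have hqr : p (k + 1 + 1) ≠ p (k + 1) := by
      intro hh
      have := hstep2.lt hI
      rw [hh] at this
      exact lt_irrefl _ this
    -- moving along the line to its lowest point
    have hA : I.s i (p (k + 1 + 1)) + I.β j = 0 →
        (∀ y ∈ I.Cell above, I.s i y + I.β j = 0 → I.F (p (k + 1 + 1)) ≤ I.F y) → False := by
      intro hrl hmin
      have hrc : p (k + 1 + 1) ∈ I.Cell above := mem_Cell_of_line hI hg0 hr0 hqlow hrlow hql hrl hqc
      have := no_return hI hm.1.1 hm.1.2 hmc hrv hrl hrc hmin hend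
      linarith
    rcases hstep2 with h2 | ⟨-, h2, -⟩
    swap
    · obtain ⟨above', i', j', z', -, -, -, -, hl1, hl2⟩ := h2.exists_cell
      obtain ⟨hx, hβ⟩ := line_unique hqc.1 hqv hql hl1
      rw [s_congr hx, hβ] at hl2
      refine hA hl2 fun y _ hyl => ?_
      obtain ⟨t, ht⟩ := exists_ray_of_line (i := i) (p := p (k + 1)) (q := p (k + 1 + 1)) (r := y)
        (by rw [s_sub]; linarith) (by rw [s_sub]; linarith) hqr
      by_cases h1 : t = 1
      · rw [ht, h1, ray_sub_one]
      · rw [ht]; exact (h2.lt_line hI hB (h.good hI (by omega)) h1).le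
    · obtain ⟨above₂, hP2, z₂, hz₂⟩ := isRegion_iff.1 h2.1
      rw [hP2] at h2
      have hq2 : p (k + 1) ∈ I.Cell above₂ := h2.2.1
      have hr2 := h2.mem
      -- Only two cells surround the exit point, and the one just left is excluded.
      have hside : above₂ i j ≠ above i j := by
        intro hh
        have := above_unique hqv hz₂ hz hq2 hqc hql hh
        exact hnotsame (by rw [hP2, hPk, this])
      -- First the case that the step through the neighbouring region runs along the common line. It
      -- cannot end by crossing a line, as its target would lie on that same line, so it ends in the
      -- minimizer, the lowest point of the line.
      by_cases hrl : I.s i (p (k + 1 + 1)) + I.β j = 0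
      · obtain ⟨m₂, τ₂, hm₂, hτ₂0, -, hr, hrm | ⟨i₂, j₂, hl₂, hc₂⟩⟩ := h2.exit hI hz₂
        · refine hA hrl fun y hy hyl => ?_
          by_contra hlt
          push Not at hlt
          have hy2 : y ∈ I.Cell above₂ :=
            mem_Cell_of_line hI hg0 hy.1 hqlow (hlt.trans hrlow) hql hyl hq2
          rw [F_eq_FG hI hy2, F_eq_FG hI hr2] at hlt
          have := hm₂.1.2 y hy.1
          rw [← hrm] at this
          linarith
        · obtain ⟨hx, hβ⟩ := line_unique hr0 hrv hrl hl₂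
          have hml : I.s i m₂ + I.β j = 0 := by
            have h3 := hrl
            rw [hr, s_ray, s_sub] at h3
            have h4 : τ₂ * (I.s i m₂ - I.s i (p (k + 1))) = 0 := by linarith
            have := (mul_eq_zero.1 h4).resolve_left hτ₂0.ne'
            linarith
          have : I.con above₂ (some (i₂, j₂)) m₂ = 0 := by
            rw [con_eq_zero_iff, s_congr hx, hβ]; exact hml
          linarith
      · have hrneg : I.con above (some (i, j)) (p (k + 1 + 1)) < 0 := by
          have h3 := mem_Cell.1 hr2 (some (i, j))
          rw [con_neg_of_ne hside] at h3
          refine lt_of_le_of_ne (by linarith) fun h0 => hrl ((con_eq_zero_iff i j _).1 h0)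
        -- The run is strictly beyond the line after pass `k + 1` and in `Γ` after pass `k'`, so
        -- some pass in between comes back to the line.
        obtain ⟨a, ha1, ha2, haneg, hapos⟩ : ∃ a, k + 1 + 1 ≤ a ∧ a ≤ k' ∧
            I.con above (some (i, j)) (p a) < 0 ∧ 0 ≤ I.con above (some (i, j)) (p (a + 1)) := by
          by_contra hno
          push Not at hno
          have : ∀ a, k + 1 + 1 ≤ a → a ≤ k' + 1 → I.con above (some (i, j)) (p a) < 0 := by
            intro a ha
            induction a, ha using Nat.le_induction with
            | base => exact fun _ => hrneg
            | succ a ha ih' => exact fun hak => hno a ha (by omega) (ih' (by omega))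
          exact absurd (mem_Cell.1 hend (some (i, j))) (not_le.2 (this _ (by omega) le_rfl))
        have hstepa := h.2 a (by omega)
        have hav := h.not_isVertex hI (k := a + 1) (by omega) (by omega)
        have ha0 := h.nonneg (k := a + 1) (by omega)
        have hcell : ∀ above', p a ∈ I.Cell above' → p (a + 1) ∈ I.Cell above' →
            above' i j ≠ above i j ∧ I.s i (p (a + 1)) + I.β j = 0 := by
          intro above' h3 h4
          have hne : above' i j ≠ above i j := by
            intro hh
            have h5 := mem_Cell.1 h3 (some (i, j))
            simp only [con, hh] at h5
            simp only [con] at haneg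
            linarith
          have h5 := mem_Cell.1 h4 (some (i, j))
          rw [con_neg_of_ne hne] at h5
          exact ⟨hne, (con_eq_zero_iff (above := above) i j _).1 (by linarith)⟩
        rcases hstepa with h3 | ⟨-, h3, -⟩
        swap
        · obtain ⟨above', i', j', z', -, -, hc1, hc2, hl1, hl2⟩ := h3.exists_cell
          obtain ⟨-, hal⟩ := hcell above' hc1 hc2
          obtain ⟨hx, hβ⟩ := line_unique ha0 hav hal hl2
          rw [s_congr hx, hβ, ← con_eq_zero_iff (above := above)] at hl1
          linarith
        · obtain ⟨above', hPa, z', hz'⟩ := isRegion_iff.1 h3.1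
          rw [hPa] at h3
          obtain ⟨hne, hal⟩ := hcell above' h3.2.1 h3.mem
          have hq' : p (k + 1) ∈ I.Cell above' := mem_Cell_of_line hI hg0 hqc.1
            (hlow (a + 1) (by omega) (by omega)) hqlow hal hql h3.mem
          -- The returning pass uses a region on the far side that touches the line below the
          -- vertices. It then also touches the line at the first exit point, where the only
          -- far-side region is the one used in pass `k + 1`.
          have hsame : above' = above₂ := above_unique hqv hz' hz₂ hq' hq2 hql (by
            cases e1 : above i j <;> cases e2 : above' i j <;> cases e3 : above₂ i j <;>
              simp_all)
          have hPP : P (k + 1) = P a := by rw [hP2, hPa, hsame]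
          rcases ha2.eq_or_lt with rfl | ha3
          · exact hnotsame (hPP.trans heq.symm)
          · exact ih a ha3 (by omega) (k + 1) (by omega) hPP

theorem IsRun.injOn (hI : I.Admissible) (hB : BddBelow (I.F '' halfPlane)) (h : I.IsRun K p P) :
    Set.InjOn P (Set.Iio K) := by
  intro a ha b hb hab
  rcases lt_trichotomy a b with hlt | rfl | hlt
  · exact absurd hab (h.ne hI hB hb a hlt)
  · rfl
  · exact absurd hab.symm (h.ne hI hB ha b hlt)

/-- The cells around the points of a line below the vertices. -/
lemma ncard_cells_on_line_le (hn : 1 ≤ n) (hI : I.Admissible) {g : ℝ × ℝ} (hg : I.Good g)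
    (i : Fin n) (j : Fin 4) : ({X | ∃ a : ℝ × ℝ, 0 ≤ a.1 ∧ I.F a < I.F g ∧ I.s i a + I.β j = 0 ∧
      X ∈ I.regionsAt a ∪ I.segmentsAt a}).ncard ≤ 4 := by
  by_cases hex : ∃ a : ℝ × ℝ, 0 ≤ a.1 ∧ I.F a < I.F g ∧ I.s i a + I.β j = 0
  · obtain ⟨a, ha0, haF, hal⟩ := hex
    have hav := hg.not_isVertex haF
    have hsub : {X | ∃ a : ℝ × ℝ, 0 ≤ a.1 ∧ I.F a < I.F g ∧ I.s i a + I.β j = 0 ∧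
        X ∈ I.regionsAt a ∪ I.segmentsAt a} ⊆ I.regionsAt a ∪ I.segmentsAt a := by
      rintro X ⟨b, hb0, hbF, hbl, ⟨hX, hb⟩ | ⟨hX, hb⟩⟩
      · refine Or.inl ⟨hX, ?_⟩
        obtain ⟨above, rfl, -⟩ := isRegion_iff.1 hX
        exact mem_Cell_of_line hI hg ha0 hbF haF hbl hal hb
      · refine Or.inr ⟨hX, ?_⟩
        obtain ⟨Γ, i', j', hΓ, rfl, -⟩ := hX
        obtain ⟨above, rfl, -⟩ := isRegion_iff.1 hΓ
        refine ⟨mem_Cell_of_line hI hg ha0 hbF haF hbl hal hb.1, ?_⟩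
        obtain ⟨hx, hβ⟩ := line_unique hb0 (hg.not_isVertex hbF) hbl ((eq_L_iff I i' j' b).1 hb.2)
        rw [line_set_eq hx hβ]
        exact (eq_L_iff I i j a).2 hal
    calc _ ≤ _ := Set.ncard_le_ncard hsub ((regionsAt_finite hn a).union (segmentsAt_finite hn a))
      _ ≤ _ := Set.ncard_union_le _ _
      _ ≤ 2 + 2 := add_le_add (ncard_regionsAt_le a hav) (ncard_segmentsAt_le hn a hav)
  · have : {X | ∃ a : ℝ × ℝ, 0 ≤ a.1 ∧ I.F a < I.F g ∧ I.s i a + I.β j = 0 ∧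
        X ∈ I.regionsAt a ∪ I.segmentsAt a} = ∅ := by
      refine Set.eq_empty_of_forall_notMem ?_
      rintro X ⟨a, h1, h2, h3, -⟩
      exact hex ⟨a, h1, h2, h3⟩
    rw [this]; simp

/-- A run has linearly many steps. -/
theorem IsRun.length_le (hn : 1 ≤ n) (hI : I.Admissible) (hB : BddBelow (I.F '' halfPlane))
    (h : I.IsRun K p P) : K ≤ 16 * n + 1 := by
  classical
  let A : Fin n × Fin 4 → Set (Set (ℝ × ℝ)) := fun c => {X | ∃ a : ℝ × ℝ, 0 ≤ a.1 ∧
    I.F a < I.F (p 0) ∧ I.s c.1 a + I.β c.2 = 0 ∧ X ∈ I.regionsAt a ∪ I.segmentsAt a}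
  have hfin : (⋃ c, A c).Finite := by
    refine ((regions_bound I hn).1.union (segments_bound I hn).1).subset ?_
    refine Set.iUnion_subset fun c => ?_
    rintro X ⟨a, -, -, -, hX | hX⟩
    · exact Or.inl hX.1
    · exact Or.inr hX.1
  -- Pass 0 is left out, since it starts at a vertex. A later pass starts on a line, because a
  -- search point off the lines is optimal and admits no further step.
  have hmaps : ∀ k ∈ Set.Ico 1 K, P k ∈ ⋃ c, A c := by
    rintro k ⟨hk1, hkK⟩
    have hstep := h.2 k hkK
    have hl : ∃ i j, I.s i (p k) + I.β j = 0 := by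
      by_contra hno
      push Not at hno
      obtain ⟨k, rfl⟩ : ∃ l, k = l + 1 := ⟨k - 1, by omega⟩
      have := (h.2 k (by omega)).optimal_of_off_lines hI hno hstep.mem.2.2
      exact absurd (hstep.lt hI) (not_lt.2 this)
    obtain ⟨i, j, hl⟩ := hl
    refine Set.mem_iUnion.2 ⟨(i, j), p k, h.nonneg hkK.le, h.lt hI hk1 hkK.le, hl, ?_⟩
    rcases hstep with h1 | ⟨-, h1, -⟩
    · exact Or.inl ⟨h1.1, h1.2.1⟩
    · exact Or.inr ⟨h1.1, h1.2.1⟩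
  have hcard := Set.ncard_le_ncard_of_injOn P hmaps
    ((h.injOn hI hB).mono fun k hk => hk.2) hfin
  have h2 : (⋃ c, A c).ncard ≤ ∑ _c : Fin n × Fin 4, 4 :=
    (Set.ncard_iUnion_le_of_fintype A).trans
      (Finset.sum_le_sum fun c _ => ncard_cells_on_line_le hn hI h.1.good c.1 c.2)
  have h3 : (Set.Ico 1 K).ncard = K - 1 := by
    rw [← Finset.coe_Ico, Set.ncard_coe_finset, Nat.card_Ico]
  simp at h2
  omega

/-- Only the starting vertex can have many neighbours. The vertices give 20, the start `17 + 20`,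
and at most `16 n + 1` later points at most 4 each, so `20 + 37 + 4 · 17 = 125` suffices. -/
theorem IsRun.searchCount_le (hn : 1 ≤ n) (hI : I.Admissible) (hB : BddBelow (I.F '' halfPlane))
    (h : I.IsRun K p P) : I.searchCount K p ≤ 125 * n ^ 2 := by
  have hK := h.length_le hn hI hB
  have h0 : (I.regionsAt (p 0)).ncard ≤ 17 * n ^ 2 :=
    (Set.ncard_le_ncard (fun _ h => h.1) (regions_bound I hn).1).trans (regions_bound I hn).2
  have h0' : (I.segmentsAt (p 0)).ncard ≤ 20 * n ^ 2 :=
    (Set.ncard_le_ncard (fun _ h => h.1) (segments_bound I hn).1).trans (segments_bound I hn).2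
  have hv := (vertices_bound I hn).2
  have hsum : ∑ k ∈ Finset.range K, ((I.regionsAt (p (k + 1))).ncard +
      (I.segmentsAt (p (k + 1))).ncard) ≤ ∑ _k ∈ Finset.range K, 4 := by
    refine Finset.sum_le_sum fun k hk => ?_
    have hvk := h.not_isVertex hI (k := k + 1) (by omega) (Finset.mem_range.1 hk)
    have := ncard_regionsAt_le _ hvk
    have := ncard_segmentsAt_le hn _ hvk
    omega
  rw [searchCount, Finset.sum_range_succ']
  simp at hsum
  nlinarith

end Run

/-! ### Existence of complete runs -/

/-- A run that has not stopped can be prolonged, and lengths are bounded. Through `isLeast_f` this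
also yields that the infimum is attained, without a compactness argument. -/
theorem exists_complete_run (hn : 1 ≤ n) (hI : I.Admissible) (hB : BddBelow (I.F '' halfPlane)) :
    ∃ K p P, I.IsRun K p P ∧ I.Stops (p K) := by
  by_contra hno
  push Not at hno
  have : ∀ K, ∃ p P, I.IsRun K p P := by
    intro K
    induction K with
    | zero =>
      obtain ⟨p, hp⟩ := exists_isStart (I := I) hn
      exact ⟨fun _ => p, fun _ => ∅, hp, fun k hk => absurd hk (Nat.not_lt_zero k)⟩
    | succ K ih =>
      obtain ⟨p, P, h⟩ := ih
      obtain ⟨R, q, hq⟩ := exists_step_of_not_stops hI hB (h.good hI le_rfl) (hno K p P h)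
      refine ⟨Function.update p (K + 1) q, Function.update P K R, ?_, fun k hk => ?_⟩
      · rw [Function.update_of_ne (by omega)]; exact h.1
      · rcases Nat.lt_succ_iff_lt_or_eq.1 hk with hlt | rfl
        · rw [Function.update_of_ne (by omega), Function.update_of_ne (by omega),
            Function.update_of_ne (by omega)]
          exact h.2 k hlt
        · rw [Function.update_self, Function.update_self, Function.update_of_ne (by omega)]
          exact hq
  obtain ⟨p, P, h⟩ := this (16 * n + 2)
  have := h.length_le hn hI hB
  omega

theorem isLeast_f (hn : 1 ≤ n) (hI : I.Admissible) (hB : BddBelow (I.F '' halfPlane)) :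
    IsLeast (I.F '' halfPlane) I.f := by
  obtain ⟨K, p, P, h, hs⟩ := exists_complete_run hn hI hB
  have hl : IsLeast (I.F '' halfPlane) (I.F (p K)) := by
    refine ⟨⟨p K, h.nonneg le_rfl, rfl⟩, ?_⟩
    rintro _ ⟨z, hz, rfl⟩
    exact optimal_of_stops hn hI hB (h.good hI le_rfl) hs hz
  rwa [f, hl.csInf_eq]

lemma F_eq_f_of_stops (hn : 1 ≤ n) (hI : I.Admissible) (hB : BddBelow (I.F '' halfPlane))
    {q : ℝ × ℝ} (hq : I.Good q) (hs : I.Stops q) : I.F q = I.f := by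
  obtain ⟨⟨z, hz, hzf⟩, hlb⟩ := isLeast_f hn hI hB
  refine le_antisymm ?_ (hlb ⟨q, hq.1, rfl⟩)
  rw [← hzf]
  exact optimal_of_stops hn hI hB hq hs hz

end Newsvendor

/-! ### A calculus for computation trees

A node of a computation tree is described by the set `A` of the numbers computed so far, as
functions of the input `ω`, and the set `D` of the inputs that lead to this node. -/

structure Ctx (Ω : Type) where
  A : Set (Ω → ℝ)
  D : Set Ω

namespace Ctx

variable {Ω : Type} {R : Ω → List ℝ → Prop}

instance : LE (Ctx Ω) := ⟨fun σ σ' => σ.A ⊆ σ'.A ∧ σ'.D ⊆ σ.D⟩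

lemma le_refl (σ : Ctx Ω) : σ ≤ σ := ⟨subset_rfl, subset_rfl⟩

lemma le_trans {σ σ' σ'' : Ctx Ω} (h : σ ≤ σ') (h' : σ' ≤ σ'') : σ ≤ σ'' :=
  ⟨h.1.trans h'.1, h'.2.trans h.2⟩

/-- The number `u` is available. -/
def Have (σ : Ctx Ω) (u : Ω → ℝ) : Prop := ∃ a ∈ σ.A, ∀ ω ∈ σ.D, a ω = u ω

/-- It is known whether `P` holds. -/
def Known (σ : Ctx Ω) (P : Ω → Prop) : Prop := (∀ ω ∈ σ.D, P ω) ∨ ∀ ω ∈ σ.D, ¬ P ω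

lemma Have.mono {σ σ' : Ctx Ω} {u : Ω → ℝ} (h : σ.Have u) (hle : σ ≤ σ') : σ'.Have u := by
  obtain ⟨a, ha, h⟩ := h
  exact ⟨a, hle.1 ha, fun ω hω => h ω (hle.2 hω)⟩

lemma Have.congr {σ : Ctx Ω} {u v : Ω → ℝ} (h : σ.Have u) (e : ∀ ω ∈ σ.D, u ω = v ω) :
    σ.Have v := by
  obtain ⟨a, ha, h⟩ := h
  exact ⟨a, ha, fun ω hω => (h ω hω).trans (e ω hω)⟩

lemma Known.mono {σ σ' : Ctx Ω} {P : Ω → Prop} (h : σ.Known P) (hle : σ ≤ σ') : σ'.Known P :=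
  h.imp (fun h ω hω => h ω (hle.2 hω)) fun h ω hω => h ω (hle.2 hω)

/-- From the node `σ`, an output satisfying `R` can be produced with at most `c` operations. -/
inductive Comp (R : Ω → List ℝ → Prop) : Ctx Ω → ℕ → Prop
  | out {σ : Ctx Ω} {c : ℕ} (l : List (Ω → ℝ)) (hl : ∀ u ∈ l, σ.Have u)
      (h : ∀ ω ∈ σ.D, R ω (l.map fun u => u ω)) (hc : l.length ≤ c) : Comp R σ c
  | const {σ : Ctx Ω} {c : ℕ} (q : ℚ) (h : Comp R ⟨insert (fun _ => (q : ℝ)) σ.A, σ.D⟩ c) :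
      Comp R σ (c + 1)
  | arith {σ : Ctx Ω} {c : ℕ} (o : ArithOp) (u v : Ω → ℝ) (hu : σ.Have u) (hv : σ.Have v)
      (h : Comp R ⟨insert (fun ω => o.eval (u ω) (v ω)) σ.A, σ.D⟩ c) : Comp R σ (c + 1)
  | sqrt {σ : Ctx Ω} {c : ℕ} (u : Ω → ℝ) (hu : σ.Have u)
      (h : Comp R ⟨insert (fun ω => Real.sqrt (u ω)) σ.A, σ.D⟩ c) : Comp R σ (c + 1)
  | ite {σ : Ctx Ω} {c : ℕ} (u v : Ω → ℝ) (hu : σ.Have u) (hv : σ.Have v)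
      (h₁ : Comp R ⟨σ.A, {ω | ω ∈ σ.D ∧ u ω ≤ v ω}⟩ c)
      (h₂ : Comp R ⟨σ.A, {ω | ω ∈ σ.D ∧ ¬ u ω ≤ v ω}⟩ c) : Comp R σ (c + 1)

lemma exists_position {σ : Ctx Ω} {mem : List (Ω → ℝ)} (hmem : ∀ a ∈ σ.A, a ∈ mem)
    {u : Ω → ℝ} (hu : σ.Have u) :
    ∃ i, ∀ ω ∈ σ.D, (mem.map fun a => a ω).getD i 0 = u ω := by
  obtain ⟨a, ha, h⟩ := hu
  obtain ⟨i, hi, rfl⟩ := List.getElem_of_mem (hmem a ha)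
  refine ⟨i, fun ω hω => ?_⟩
  rw [List.getD_eq_getElem _ _ (by simpa using hi)]
  simpa using h ω hω

lemma exists_positions {σ : Ctx Ω} {mem : List (Ω → ℝ)} (hmem : ∀ a ∈ σ.A, a ∈ mem)
    (l : List (Ω → ℝ)) (hl : ∀ u ∈ l, σ.Have u) : ∃ out : List ℕ, out.length = l.length ∧
      ∀ ω ∈ σ.D, (out.map fun i => (mem.map fun a => a ω).getD i 0) = l.map fun u => u ω := by
  induction l with
  | nil => exact ⟨[], rfl, fun _ _ => rfl⟩
  | cons u l ih =>
    obtain ⟨out, h1, h2⟩ := ih fun v hv => hl v (List.mem_cons_of_mem _ hv)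
    obtain ⟨i, hi⟩ := exists_position hmem (hl u List.mem_cons_self)
    exact ⟨i :: out, by simp [h1], fun ω hω => by rw [List.map_cons, List.map_cons, h2 ω hω, hi ω hω]⟩

/-- Soundness of the calculus. -/
theorem Comp.exists_tree {σ : Ctx Ω} {c : ℕ} (h : Comp R σ c) : ∀ mem : List (Ω → ℝ),
    (∀ a ∈ σ.A, a ∈ mem) → ∃ T : CompTree, ∀ ω ∈ σ.D,
      T.cost (mem.map fun a => a ω) ≤ c ∧ R ω (T.result (mem.map fun a => a ω)) := by
  induction h with
  | out l hl h hc =>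
    intro mem hmem
    obtain ⟨out, h1, h2⟩ := exists_positions hmem l hl
    refine ⟨.output out, fun ω hω => ⟨by rw [CompTree.cost, h1]; exact hc, ?_⟩⟩
    rw [CompTree.result, h2 ω hω]; exact h ω hω
  | const q h ih =>
    intro mem hmem
    obtain ⟨T, hT⟩ := ih (mem ++ [fun _ => (q : ℝ)]) (by
      rintro a (rfl | ha)
      · simp
      · simp [hmem a ha])
    refine ⟨.const q T, fun ω hω => ?_⟩
    have := hT ω hω
    rw [List.map_append, List.map_singleton] at this
    exact ⟨Nat.succ_le_succ this.1, this.2⟩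
  | arith o u v hu hv h ih =>
    intro mem hmem
    obtain ⟨i, hi⟩ := exists_position hmem hu
    obtain ⟨j, hj⟩ := exists_position hmem hv
    obtain ⟨T, hT⟩ := ih (mem ++ [fun ω => o.eval (u ω) (v ω)]) (by
      rintro a (rfl | ha)
      · simp
      · simp [hmem a ha])
    refine ⟨.arith o i j T, fun ω hω => ?_⟩
    have := hT ω hω
    rw [List.map_append, List.map_singleton] at this
    rw [CompTree.cost, CompTree.result, hi ω hω, hj ω hω]
    exact ⟨Nat.succ_le_succ this.1, this.2⟩
  | sqrt u hu h ih =>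
    intro mem hmem
    obtain ⟨i, hi⟩ := exists_position hmem hu
    obtain ⟨T, hT⟩ := ih (mem ++ [fun ω => Real.sqrt (u ω)]) (by
      rintro a (rfl | ha)
      · simp
      · simp [hmem a ha])
    refine ⟨.sqrt i T, fun ω hω => ?_⟩
    have := hT ω hω
    rw [List.map_append, List.map_singleton] at this
    rw [CompTree.cost, CompTree.result, hi ω hω]
    exact ⟨Nat.succ_le_succ this.1, this.2⟩
  | ite u v hu hv h₁ h₂ ih₁ ih₂ =>
    intro mem hmem
    obtain ⟨i, hi⟩ := exists_position hmem hu
    obtain ⟨j, hj⟩ := exists_position hmem hv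
    obtain ⟨T₁, hT₁⟩ := ih₁ mem hmem
    obtain ⟨T₂, hT₂⟩ := ih₂ mem hmem
    refine ⟨.ifLe i j T₁ T₂, fun ω hω => ?_⟩
    rw [CompTree.cost, CompTree.result, hi ω hω, hj ω hω]
    by_cases hle : u ω ≤ v ω
    · rw [if_pos hle, if_pos hle]
      have := hT₁ ω ⟨hω, hle⟩
      exact ⟨Nat.succ_le_succ this.1, this.2⟩
    · rw [if_neg hle, if_neg hle]
      have := hT₂ ω ⟨hω, hle⟩
      exact ⟨Nat.succ_le_succ this.1, this.2⟩

lemma Comp.mono {σ : Ctx Ω} {c : ℕ} (h : Comp R σ c) : ∀ {d : ℕ}, c ≤ d → Comp R σ d := by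
  induction h with
  | out l hl h hc => exact fun hd => .out l hl h (hc.trans hd)
  | const q h ih =>
    intro d hd
    obtain ⟨d, rfl⟩ : ∃ e, d = e + 1 := ⟨d - 1, by omega⟩
    exact .const q (ih (by omega))
  | arith o u v hu hv h ih =>
    intro d hd
    obtain ⟨d, rfl⟩ : ∃ e, d = e + 1 := ⟨d - 1, by omega⟩
    exact .arith o u v hu hv (ih (by omega))
  | sqrt u hu h ih =>
    intro d hd
    obtain ⟨d, rfl⟩ : ∃ e, d = e + 1 := ⟨d - 1, by omega⟩
    exact .sqrt u hu (ih (by omega))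
  | ite u v hu hv h₁ h₂ ih₁ ih₂ =>
    intro d hd
    obtain ⟨d, rfl⟩ : ∃ e, d = e + 1 := ⟨d - 1, by omega⟩
    exact .ite u v hu hv (ih₁ (by omega)) (ih₂ (by omega))

/-- A property that stays true as the computation goes on. -/
def Persistent (Q : Ctx Ω → Prop) : Prop := ∀ σ σ', σ ≤ σ' → Q σ → Q σ'

variable (R) in
/-- With `c` operations, a situation in which `Q` holds can be reached from `σ`. -/
def Can (σ : Ctx Ω) (c : ℕ) (Q : Ctx Ω → Prop) : Prop :=
  ∀ b, (∀ σ', σ ≤ σ' → Q σ' → Comp R σ' b) → Comp R σ (b + c)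

namespace Can

variable {σ : Ctx Ω} {c d : ℕ} {Q Q' : Ctx Ω → Prop}

lemma pure (h : Q σ) : Can R σ 0 Q := fun _ hb => hb σ (le_refl σ) h

lemma bind (h : Can R σ c Q) (h' : ∀ σ', σ ≤ σ' → Q σ' → Can R σ' d Q') : Can R σ (c + d) Q' := by
  intro b hb
  have := h (b + d) fun σ' hle hQ => h' σ' hle hQ b fun σ'' hle' hQ' => hb σ'' (le_trans hle hle') hQ'
  rwa [show b + (c + d) = b + d + c by ring]

lemma mono (h : Can R σ c Q) (hc : c ≤ d) (hQ : ∀ σ', σ ≤ σ' → Q σ' → Q' σ') : Can R σ d Q' :=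
  fun b hb => (h b fun σ' hle h' => hb σ' hle (hQ σ' hle h')).mono (by omega)

lemma le (h : Can R σ c Q) (hc : c ≤ d) : Can R σ d Q := h.mono hc fun _ _ h => h

lemma imp (h : Can R σ c Q) (hQ : ∀ σ', σ ≤ σ' → Q σ' → Q' σ') : Can R σ c Q' := h.mono le_rfl hQ

lemma finish (h : Can R σ c Q) (h' : ∀ σ', σ ≤ σ' → Q σ' → Comp R σ' d) : Comp R σ (d + c) :=
  h d h'

lemma compare {u v : Ω → ℝ} (hu : σ.Have u) (hv : σ.Have v) :
    Can R σ 1 fun τ => τ.Known fun ω => u ω ≤ v ω := by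
  intro b hb
  refine .ite u v hu hv (hb _ ⟨subset_rfl, fun ω h => h.1⟩ (Or.inl fun ω h => h.2))
    (hb _ ⟨subset_rfl, fun ω h => h.1⟩ (Or.inr fun ω h => h.2))

/-- A loop over a fixed index set, unrolled; persistence keeps earlier results valid while later
ones are computed. -/
lemma forall_finset {ι : Type*} (s : Finset ι) {Q : ι → Ctx Ω → Prop}
    (hp : ∀ i ∈ s, Persistent (Q i)) (h : ∀ i ∈ s, ∀ σ', σ ≤ σ' → Can R σ' c (Q i)) :
    Can R σ (s.card * c) fun τ => ∀ i ∈ s, Q i τ := by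
  classical
  induction s using Finset.induction_on generalizing σ with
  | empty => simpa using pure (Q := fun τ => ∀ i ∈ (∅ : Finset ι), Q i τ) (by simp)
  | insert a s ha ih =>
    rw [Finset.card_insert_of_notMem ha, show (s.card + 1) * c = c + s.card * c by ring]
    refine bind (h a (Finset.mem_insert_self a s) σ (le_refl σ)) fun σ' hle hQ => ?_
    refine (ih (fun i hi => hp i (Finset.mem_insert_of_mem hi)) fun i hi σ'' hle' =>
      h i (Finset.mem_insert_of_mem hi) σ'' (le_trans hle hle')).imp fun σ'' hle' hall i hi => ?_
    rcases Finset.mem_insert.1 hi with rfl | hi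
    · exact hp i (Finset.mem_insert_self i s) _ _ hle' hQ
    · exact hall i hi

lemma forall_fintype {ι : Type*} [Fintype ι] {Q : ι → Ctx Ω → Prop}
    (hp : ∀ i, Persistent (Q i)) (h : ∀ i, ∀ σ', σ ≤ σ' → Can R σ' c (Q i)) :
    Can R σ (Fintype.card ι * c) fun τ => ∀ i, Q i τ :=
  (forall_finset Finset.univ (fun i _ => hp i) fun i _ => h i).imp
    fun _ _ h i => h i (Finset.mem_univ i)

/-- The winning index is not a computed number but is fixed at each node reached, so later
operations may depend on it for free. -/
lemma argmin {ι : Type*} (s : Finset ι) (hs : s.Nonempty) {u : ι → Ω → ℝ}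
    (hu : ∀ i ∈ s, σ.Have (u i)) :
    Can R σ s.card fun τ => ∃ i ∈ s, ∀ j ∈ s, ∀ ω ∈ τ.D, u i ω ≤ u j ω := by
  classical
  induction hs using Finset.Nonempty.cons_induction generalizing σ with
  | singleton a =>
    exact (pure (Q := fun τ => ∃ i ∈ ({a} : Finset ι), ∀ j ∈ ({a} : Finset ι), ∀ ω ∈ τ.D,
      u i ω ≤ u j ω) (by simp)).le (by simp)
  | cons a s ha hs ih =>
    rw [Finset.card_cons]
    refine bind (ih fun i hi => hu i (Finset.mem_cons_of_mem hi)) fun σ' hle hQ => ?_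
    obtain ⟨i, hi, hmin⟩ := hQ
    refine (compare ((hu i (Finset.mem_cons_of_mem hi)).mono hle)
      ((hu a (Finset.mem_cons_self a s)).mono hle)).imp fun σ'' hle' hk => ?_
    rcases hk with hk | hk
    · refine ⟨i, Finset.mem_cons_of_mem hi, fun j hj ω hω => ?_⟩
      rcases Finset.mem_cons.1 hj with rfl | hj
      · exact hk ω hω
      · exact hmin j hj ω (hle'.2 hω)
    · refine ⟨a, Finset.mem_cons_self a s, fun j hj ω hω => ?_⟩
      rcases Finset.mem_cons.1 hj with rfl | hj
      · exact _root_.le_refl _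
      · exact (not_le.1 (hk ω hω)).le.trans (hmin j hj ω (hle'.2 hω))

end Can

lemma persistent_have (u : Ω → ℝ) : Persistent fun τ : Ctx Ω => τ.Have u :=
  fun _ _ hle h => h.mono hle

lemma persistent_known (P : Ω → Prop) : Persistent fun τ : Ctx Ω => τ.Known P :=
  fun _ _ hle h => h.mono hle

variable (R) in
/-- The number `u` can be computed with `c` operations. -/
def Cheap (σ : Ctx Ω) (c : ℕ) (u : Ω → ℝ) : Prop :=
  ∀ σ', σ ≤ σ' → Can R σ' c fun τ => τ.Have u

lemma Have.cheap {σ : Ctx Ω} {u : Ω → ℝ} (h : σ.Have u) : Cheap R σ 0 u :=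
  fun _ hle => Can.pure (h.mono hle)

namespace Cheap

variable {σ : Ctx Ω} {c d : ℕ} {u v : Ω → ℝ}

lemma bind (h : Cheap R σ c u) (h' : ∀ σ', σ ≤ σ' → σ'.Have u → Cheap R σ' d v) :
    Cheap R σ (c + d) v := fun σ' hle =>
  Can.bind (h σ' hle) fun σ'' hle' hu => (h' σ'' (le_trans hle hle') hu) σ'' (le_refl σ'')

lemma can (h : Cheap R σ c u) : Can R σ c fun τ => τ.Have u := h σ (le_refl σ)

lemma mono {σ' : Ctx Ω} (h : Cheap R σ c u) (hle : σ ≤ σ') : Cheap R σ' c u :=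
  fun τ hτ => h τ (le_trans hle hτ)

lemma congr (h : Cheap R σ c u) (e : ∀ ω ∈ σ.D, u ω = v ω) : Cheap R σ c v :=
  fun σ' hle => (h σ' hle).imp fun _ hle' h' => h'.congr fun ω hω => e ω (hle.2 (hle'.2 hω))

lemma le (h : Cheap R σ c u) (hc : c ≤ d) : Cheap R σ d u := fun σ' hle => (h σ' hle).le hc

lemma const (q : ℚ) : Cheap R σ 1 fun _ => (q : ℝ) := fun _ _ _ hb =>
  .const q (hb _ ⟨Set.subset_insert _ _, subset_rfl⟩ ⟨_, Set.mem_insert _ _, fun _ _ => rfl⟩)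

lemma natCast (m : ℕ) : Cheap R σ 1 fun _ => (m : ℝ) := by
  simpa using const (R := R) (σ := σ) (m : ℚ)

lemma arith (o : ArithOp) (hu : Cheap R σ c u) (hv : Cheap R σ d v) :
    Cheap R σ (c + d + 1) fun ω => o.eval (u ω) (v ω) := by
  intro σ' hle
  rw [add_assoc]
  refine Can.bind (hu σ' hle) fun σ₁ h₁ h₁' => Can.bind (hv σ₁ (le_trans hle h₁)) fun σ₂ h₂ h₂' => ?_
  exact fun b hb => .arith o u v (h₁'.mono h₂) h₂'
    (hb _ ⟨Set.subset_insert _ _, subset_rfl⟩ ⟨_, Set.mem_insert _ _, fun _ _ => rfl⟩)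

lemma add (hu : Cheap R σ c u) (hv : Cheap R σ d v) :
    Cheap R σ (c + d + 1) fun ω => u ω + v ω := arith .add hu hv

lemma sub (hu : Cheap R σ c u) (hv : Cheap R σ d v) :
    Cheap R σ (c + d + 1) fun ω => u ω - v ω := arith .sub hu hv

lemma mul (hu : Cheap R σ c u) (hv : Cheap R σ d v) :
    Cheap R σ (c + d + 1) fun ω => u ω * v ω := arith .mul hu hv

lemma div (hu : Cheap R σ c u) (hv : Cheap R σ d v) :
    Cheap R σ (c + d + 1) fun ω => u ω / v ω := arith .div hu hv

lemma neg (hu : Cheap R σ c u) : Cheap R σ (c + 2) fun ω => -u ω := by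
  refine (((const 0).sub hu).congr fun ω _ => ?_).le (by omega)
  simp

lemma sq (hu : Cheap R σ c u) : Cheap R σ (c + c + 1) fun ω => u ω ^ 2 :=
  (hu.mul hu).congr fun ω _ => (pow_two (u ω)).symm

lemma sqrt (hu : Cheap R σ c u) : Cheap R σ (c + 1) fun ω => Real.sqrt (u ω) := fun σ' hle =>
  Can.bind (hu σ' hle) fun _ _ h₁ _ hb => .sqrt u h₁
    (hb _ ⟨Set.subset_insert _ _, subset_rfl⟩ ⟨_, Set.mem_insert _ _, fun _ _ => rfl⟩)

lemma max (hu : Cheap R σ c u) (hv : Cheap R σ d v) :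
    Cheap R σ (c + d + 1) fun ω => Max.max (u ω) (v ω) := by
  intro σ' hle
  rw [add_assoc]
  refine Can.bind (hu σ' hle) fun σ₁ h₁ h₁' => Can.bind (hv σ₁ (le_trans hle h₁)) fun σ₂ h₂ h₂' => ?_
  refine (Can.compare (h₁'.mono h₂) h₂').imp fun σ₃ h₃ hk => ?_
  rcases hk with hk | hk
  · exact (h₂'.mono h₃).congr fun ω hω => (max_eq_right (hk ω hω)).symm
  · exact ((h₁'.mono h₂).mono h₃).congr fun ω hω => (max_eq_left (not_le.1 (hk ω hω)).le).symm

lemma sum {ι : Type*} (s : Finset ι) {u : ι → Ω → ℝ} (h : ∀ i ∈ s, Cheap R σ c (u i)) :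
    Cheap R σ (s.card * (c + 1) + 1) fun ω => ∑ i ∈ s, u i ω := by
  classical
  induction s using Finset.induction_on with
  | empty => simpa using const (R := R) (σ := σ) 0
  | insert a s ha ih =>
    refine (((h a (Finset.mem_insert_self a s)).add
      (ih fun i hi => h i (Finset.mem_insert_of_mem hi))).congr fun ω _ => by
        rw [Finset.sum_insert ha]).le ?_
    rw [Finset.card_insert_of_notMem ha]
    nlinarith

lemma compare (hu : Cheap R σ c u) (hv : Cheap R σ d v) :
    Can R σ (c + d + 1) fun τ => τ.Known fun ω => u ω ≤ v ω := by
  rw [add_assoc]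
  exact Can.bind (hu σ (le_refl σ)) fun σ₁ h₁ h₁' => Can.bind (hv σ₁ h₁) fun σ₂ h₂ h₂' =>
    Can.compare (h₁'.mono h₂) h₂'

end Cheap

end Ctx

/-! ### Operation counts for the basic quantities -/

namespace Newsvendor

open Ctx

/-- The inputs for which the method is to work. -/
abbrev Adm (n : ℕ) := {I : Newsvendor n // I.Admissible ∧ BddBelow (I.F '' halfPlane)}

variable {n : ℕ} {R : Adm n → List ℝ → Prop} {σ : Ctx (Adm n)}

/-- The data that are available throughout the computation. -/
structure Base (σ : Ctx (Adm n)) : Prop where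
  x : ∀ i, σ.Have fun I => I.1.x i
  c₁ : σ.Have fun I => I.1.c₁
  c₂ : σ.Have fun I => I.1.c₂
  w : σ.Have fun I => I.1.w
  ξ : σ.Have fun I => I.1.ξ
  Q : σ.Have fun I => I.1.Q
  δ : σ.Have fun I => I.1.δ
  μ : σ.Have fun I => I.1.μ
  sd : σ.Have fun I => I.1.σ
  β : ∀ j, σ.Have fun I => I.1.β j
  sumsq : σ.Have fun I => ∑ i, I.1.x i ^ 2
  big : σ.Known fun I => I.1.Big
  xle : ∀ i i', σ.Known fun I => I.1.x i ≤ I.1.x i'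
  βle : ∀ j j', σ.Known fun I => I.1.β j ≤ I.1.β j'

lemma Base.mono {σ σ' : Ctx (Adm n)} (h : Base σ) (hle : σ ≤ σ') : Base σ' where
  x i := (h.x i).mono hle
  c₁ := h.c₁.mono hle
  c₂ := h.c₂.mono hle
  w := h.w.mono hle
  ξ := h.ξ.mono hle
  Q := h.Q.mono hle
  δ := h.δ.mono hle
  μ := h.μ.mono hle
  sd := h.sd.mono hle
  β j := (h.β j).mono hle
  sumsq := h.sumsq.mono hle
  big := h.big.mono hle
  xle i i' := (h.xle i i').mono hle
  βle j j' := (h.βle j j').mono hle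

/-- Both coordinates of a point are available. -/
def HavePt (σ : Ctx (Adm n)) (p : Adm n → ℝ × ℝ) : Prop :=
  (σ.Have fun I => (p I).1) ∧ σ.Have fun I => (p I).2

lemma HavePt.mono {σ σ' : Ctx (Adm n)} {p : Adm n → ℝ × ℝ} (h : HavePt σ p) (hle : σ ≤ σ') :
    HavePt σ' p := ⟨h.1.mono hle, h.2.mono hle⟩

lemma can_pt {p : Adm n → ℝ × ℝ} {c d : ℕ} (h1 : Cheap R σ c fun I => (p I).1)
    (h2 : Cheap R σ d fun I => (p I).2) : Can R σ (c + d) fun τ => HavePt τ p :=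
  h1.can.bind fun _ h h1' => ((h2.mono h).can).imp fun _ h' h2' => ⟨h1'.mono h', h2'⟩

lemma cheap_s (hb : Base σ) {p : Adm n → ℝ × ℝ} (hp : HavePt σ p) (i : Fin n) :
    Cheap R σ 4 fun I => I.1.s i (p I) :=
  ((((Cheap.natCast 2).mul hp.1.cheap).mul (hb.x i).cheap).sub hp.2.cheap).congr fun I _ => by
    simp [s]

lemma cheap_lin (hb : Base σ) {p : Adm n → ℝ × ℝ} (hp : HavePt σ p) :
    Cheap R σ 13 fun I => I.1.lin (p I) :=
  (((((hp.1.cheap.mul hb.δ.cheap).add (hp.2.cheap.mul hb.μ.cheap)).add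
    ((hb.ξ.cheap.sub hp.1.cheap).mul (hb.sd.cheap.sq.add hb.μ.cheap.sq))).sub
    ((hb.w.cheap.mul hp.1.cheap).mul hb.sumsq.cheap)).congr fun I _ => by
    rw [lin]).le (by norm_num)

lemma cheap_phi (hb : Base σ) {t : Adm n → ℝ} (ht : σ.Have t) :
    Cheap R σ 31 fun I => I.1.phi (t I) := by
  have h1 := (ht.cheap (R := R)).sub hb.c₂.cheap |>.max (Cheap.natCast 0)
  have h2 := (ht.cheap (R := R)).add hb.c₁.cheap |>.max (Cheap.natCast 0)
  have h4 := (Cheap.natCast (R := R) 4).mul hb.ξ.cheap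
  have := ((hb.c₂.cheap.mul hb.Q.cheap).add (h1.sq.div h4)).max
    ((hb.c₁.cheap.mul hb.Q.cheap).neg.add (h2.sq.div h4))
  exact (this.congr fun I _ => by simp [phi]).le (by norm_num)

lemma cheap_F (hb : Base σ) {p : Adm n → ℝ × ℝ} (hp : HavePt σ p) :
    Cheap R σ (36 * n + 16) fun I => I.1.F (p I) := by
  have h1 : ∀ i ∈ Finset.univ, Cheap R σ 35 fun I => I.1.phi (I.1.s i (p I)) := fun i _ =>
    ((cheap_s hb hp i).bind fun σ' hle h => cheap_phi (hb.mono hle) h)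
  have := (cheap_lin hb hp).add (hb.w.cheap.mul (Cheap.sum Finset.univ h1))
  exact (this.congr fun I _ => by rw [F_eq I.2.1]).le (by simp; omega)

lemma cheap_ac (k : Fin 3) : Cheap R σ 1 fun _ => ac k := by
  fin_cases k
  · simpa [ac] using Cheap.natCast (R := R) (σ := σ) 0
  · simpa [ac] using Cheap.natCast (R := R) (σ := σ) 1
  · simpa [ac] using Cheap.natCast (R := R) (σ := σ) 1

lemma cheap_ev (hb : Base σ) (k : Fin 3) : Cheap R σ 2 fun I => I.1.ev k := by
  fin_cases k
  · simpa [ev] using (Cheap.natCast (R := R) (σ := σ) 0).le one_le_two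
  · simpa [ev] using hb.c₂.cheap.neg
  · simpa [ev] using hb.c₁.cheap.le (Nat.zero_le 2)

lemma cheap_hv (hb : Base σ) (k : Fin 3) : Cheap R σ 3 fun I => I.1.hv k := by
  fin_cases k
  · simpa [hv] using (hb.c₂.cheap.mul hb.Q.cheap).le (by norm_num : _ ≤ 3)
  · simpa [hv] using (hb.c₂.cheap.mul hb.Q.cheap).le (by norm_num : _ ≤ 3)
  · simpa [hv] using (hb.c₁.cheap.mul hb.Q.cheap).neg.le (by norm_num : _ ≤ 3)

lemma cheap_quadA (hb : Base σ) (k : Fin n → Fin 3) {d : Adm n → ℝ × ℝ} (hd : HavePt σ d) :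
    Cheap R σ (15 * n + 2) fun I => I.1.quadA k (d I) := by
  have h1 : ∀ i ∈ Finset.univ, Cheap R σ 14 fun I => ac (k i) * I.1.s i (d I) ^ 2 / (4 * I.1.ξ) :=
    fun i _ => (((cheap_s hb hd i).bind fun σ' hle h => (((cheap_ac (k i)).mul h.cheap.sq).div
      ((Cheap.natCast 4).mul (hb.mono hle).ξ.cheap)).congr fun I _ => by simp).le (by norm_num))
  have := hb.w.cheap.mul (Cheap.sum Finset.univ h1)
  exact (this.congr fun I _ => by rw [quadA]).le (by simp; omega)

lemma cheap_quadB (hb : Base σ) (k : Fin n → Fin 3) {p d : Adm n → ℝ × ℝ} (hp : HavePt σ p)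
    (hd : HavePt σ d) : Cheap R σ (23 * n + 15) fun I => I.1.quadB k (p I) (d I) := by
  have h1 : ∀ i ∈ Finset.univ, Cheap R σ 22 fun I =>
      ac (k i) * (2 * (I.1.s i (p I) + I.1.ev (k i)) * I.1.s i (d I)) / (4 * I.1.ξ) :=
    fun i _ => ((((cheap_ac (k i)).mul (((Cheap.natCast 2).mul ((cheap_s hb hp i).add
      (cheap_ev hb (k i)))).mul (cheap_s hb hd i))).div
      ((Cheap.natCast 4).mul hb.ξ.cheap)).congr fun I _ => by simp).le (by norm_num)
  have h2 := (((hd.1.cheap (R := R)).mul hb.δ.cheap).add (hd.2.cheap.mul hb.μ.cheap)).sub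
    (hd.1.cheap.mul (hb.sd.cheap.sq.add hb.μ.cheap.sq))
  have h3 := h2.sub ((hb.w.cheap.mul hd.1.cheap).mul hb.sumsq.cheap)
  have := h3.add (hb.w.cheap.mul (Cheap.sum Finset.univ h1))
  exact (this.congr fun I _ => by rw [quadB]).le (by simp; omega)

lemma cheap_FG (hb : Base σ) (k : Fin n → Fin 3) {p : Adm n → ℝ × ℝ} (hp : HavePt σ p) :
    Cheap R σ (27 * n + 16) fun I => I.1.FG k (p I) := by
  have h1 : ∀ i ∈ Finset.univ, Cheap R σ 26 fun I =>
      ac (k i) * (I.1.s i (p I) + I.1.ev (k i)) ^ 2 / (4 * I.1.ξ) + I.1.hv (k i) :=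
    fun i _ => (((((cheap_ac (k i)).mul ((cheap_s hb hp i).add (cheap_ev hb (k i))).sq).div
      ((Cheap.natCast 4).mul hb.ξ.cheap)).add (cheap_hv hb (k i))).congr fun I _ => by simp).le
      (by norm_num)
  have := (cheap_lin hb hp).add (hb.w.cheap.mul (Cheap.sum Finset.univ h1))
  exact (this.congr fun I _ => by rw [FG_eq I.2.1]).le (by simp; omega)

lemma cheap_acSum (k : Fin n → Fin 3) : Cheap R σ (2 * n + 1) fun _ => acSum k := by
  have := Cheap.sum (R := R) (σ := σ) Finset.univ fun i _ => cheap_ac (k i)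
  exact (this.congr fun I _ => rfl).le (by simp; omega)

lemma cheap_mSlope (hb : Base σ) (k : Fin n → Fin 3) :
    Cheap R σ (5 * n + 5) fun I => I.1.mSlope k := by
  have h1 : ∀ i ∈ Finset.univ, Cheap R σ 2 fun I => ac (k i) * I.1.x i :=
    fun i _ => (cheap_ac (k i)).mul (hb.x i).cheap
  have := ((Cheap.natCast 2).mul (Cheap.sum Finset.univ h1)).div (cheap_acSum k)
  exact (this.congr fun I _ => by simp [mSlope]).le (by simp; omega)

lemma cheap_mIcpt (hb : Base σ) (k : Fin n → Fin 3) :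
    Cheap R σ (7 * n + 8) fun I => I.1.mIcpt k := by
  have h1 : ∀ i ∈ Finset.univ, Cheap R σ 4 fun I => ac (k i) * I.1.ev (k i) :=
    fun i _ => ((cheap_ac (k i)).mul (cheap_ev hb (k i)))
  have := ((Cheap.sum Finset.univ h1).sub ((((Cheap.natCast 2).mul hb.ξ.cheap).mul hb.μ.cheap).div
    hb.w.cheap)).div (cheap_acSum k)
  exact (this.congr fun I _ => by simp [mIcpt]).le (by simp; omega)

/-- The initial node. -/
def inputCtx (n : ℕ) : Ctx (Adm n) where
  A := (Set.range fun i I => I.1.x i) ∪ {fun I => I.1.c₁, fun I => I.1.c₂, fun I => I.1.w,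
    fun I => I.1.ξ, fun I => I.1.Q, fun I => I.1.δ, fun I => I.1.μ, fun I => I.1.σ}
  D := Set.univ

/-- All `n²` comparisons between observations are made once and for all; afterwards the sorted order
and the coincidences are known at every node. -/
lemma can_base (hn : 1 ≤ n) : Can R (inputCtx n) (82 * n ^ 2) Base := by
  have have_of_mem : ∀ {σ : Ctx (Adm n)} {u : Adm n → ℝ}, u ∈ σ.A → σ.Have u :=
    fun h => ⟨_, h, fun _ _ => rfl⟩
  have hx : ∀ i, (inputCtx n).Have fun I => I.1.x i := fun i => have_of_mem (Or.inl ⟨i, rfl⟩)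
  have hc₁ : (inputCtx n).Have fun I => I.1.c₁ := have_of_mem (Or.inr (by simp))
  have hc₂ : (inputCtx n).Have fun I => I.1.c₂ := have_of_mem (Or.inr (by simp))
  have hw : (inputCtx n).Have fun I => I.1.w := have_of_mem (Or.inr (by simp))
  have hξ : (inputCtx n).Have fun I => I.1.ξ := have_of_mem (Or.inr (by simp))
  have hQ : (inputCtx n).Have fun I => I.1.Q := have_of_mem (Or.inr (by simp))
  have hδ : (inputCtx n).Have fun I => I.1.δ := have_of_mem (Or.inr (by simp))
  have hμ : (inputCtx n).Have fun I => I.1.μ := have_of_mem (Or.inr (by simp))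
  have hs : (inputCtx n).Have fun I => I.1.σ := have_of_mem (Or.inr (by simp))
  have hβ : ∀ j, Cheap R (inputCtx n) 13 fun I => I.1.β j := by
    intro j
    fin_cases j
    · exact (hc₁.cheap.congr fun I _ => rfl).le (by norm_num)
    · exact (hc₂.cheap.neg.congr fun I _ => rfl).le (by norm_num)
    · exact ((((hc₁.cheap.sub hc₂.cheap).div (Cheap.natCast 2)).sub
        (((Cheap.natCast 2).mul hξ.cheap).mul hQ.cheap)).congr fun I _ => by
          simp [β]).le (by norm_num)
    · exact ((hc₁.cheap.sub ((Cheap.natCast 2).mul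
        ((hξ.cheap.mul (hc₁.cheap.add hc₂.cheap)).mul hQ.cheap).sqrt)).congr fun I _ => by
          simp [β]).le (by norm_num)
  have hbig : Cheap R (inputCtx n) 1 fun I => I.1.c₁ + I.1.c₂ := hc₁.cheap.add hc₂.cheap
  have hbig' : Cheap R (inputCtx n) 3 fun I => 4 * I.1.ξ * I.1.Q :=
    (((Cheap.natCast 4).mul hξ.cheap).mul hQ.cheap).congr fun I _ => by simp
  have hsq : Cheap R (inputCtx n) (2 * n + 1) fun I => ∑ i, I.1.x i ^ 2 := by
    have := Cheap.sum (R := R) (σ := inputCtx n) Finset.univ fun i _ => (hx i).cheap.sq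
    exact this.le (by simp; omega)
  have step1 := Can.forall_fintype (R := R) (σ := inputCtx n) (c := 13)
    (Q := fun j τ => τ.Have fun I => I.1.β j) (fun j => persistent_have _)
    fun j σ' hle => hβ j σ' hle
  refine (step1.bind fun σ₁ h₁ hβ₁ => Can.bind (d := 5 + n * n + 4 * 4) (hsq σ₁ h₁)
    fun σ₂ h₂ hsq₂ => ?_).le
    (by simp; nlinarith : Fintype.card (Fin 4) * 13 + (2 * n + 1 + (5 + n * n + 4 * 4)) ≤ _)
  have h02 := le_trans h₁ h₂
  rw [add_assoc]
  refine Can.bind ((hbig.mono h02).compare (hbig'.mono h02)) fun σ₃ h₃ hb₃ => ?_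
  have h03 := le_trans h02 h₃
  refine Can.bind ((Can.forall_fintype (ι := Fin n × Fin n) (c := 1)
    (Q := fun c τ => τ.Known fun I => I.1.x c.1 ≤ I.1.x c.2) (fun c => persistent_known _)
    fun c σ' hle => Can.compare (((hx c.1).mono h03).mono hle)
      (((hx c.2).mono h03).mono hle)).le (by simp)) fun σ₄ h₄ hx₄ => ?_
  have h24 := le_trans h₂ (le_trans h₃ h₄)
  refine ((Can.forall_fintype (ι := Fin 4 × Fin 4) (c := 1)
    (Q := fun c τ => τ.Known fun I => I.1.β c.1 ≤ I.1.β c.2) (fun c => persistent_known _)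
    fun c σ' hle => Can.compare (((hβ₁ c.1).mono h24).mono hle)
      (((hβ₁ c.2).mono h24).mono hle)).le (by simp)).imp fun σ₅ h₅ hβ₅ => ?_
  have h05 := le_trans h03 (le_trans h₄ h₅)
  have h35 := le_trans h₄ h₅
  exact
  { x := fun i => (hx i).mono h05
    c₁ := hc₁.mono h05
    c₂ := hc₂.mono h05
    w := hw.mono h05
    ξ := hξ.mono h05
    Q := hQ.mono h05
    δ := hδ.mono h05
    μ := hμ.mono h05
    sd := hs.mono h05
    β := fun j => (hβ₁ j).mono (le_trans h24 h₅)
    sumsq := hsq₂.mono (le_trans h₃ h35)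
    big := hb₃.mono h35
    xle := fun i i' => (hx₄ (i, i')).mono h₅
    βle := fun j j' => hβ₅ (j, j') }

end Newsvendor

namespace Newsvendor

open Filter Topology

variable {n : ℕ} {I : Newsvendor n} {above : Fin n → Fin 4 → Bool}

/-! ### Enumerating the cells around a point -/

/-- The region step that ends at time `τ`. -/
lemma regionStep_of_time (hn : 1 ≤ n) (hI : I.Admissible) (hB : BddBelow (I.F '' halfPlane))
    {p z : ℝ × ℝ} (hg : I.Good p) (hz : I.StrictIn above z) (hp : p ∈ I.Cell above)
    (ha : ∃ a, I.kform above a ≠ 0)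
    (hlt : I.FG (I.kform above) (I.nearMin (I.kform above) p) < I.F p) {τ : ℝ} (h0 : 0 < τ)
    (h1 : τ ≤ 1) (hin : ∀ i j, 0 ≤ I.con above (some (i, j)) p + τ *
      (I.con above (some (i, j)) (I.nearMin (I.kform above) p) - I.con above (some (i, j)) p))
    (hex : τ = 1 ∨ ∃ i j, I.con above (some (i, j)) p + τ *
      (I.con above (some (i, j)) (I.nearMin (I.kform above) p) - I.con above (some (i, j)) p) = 0 ∧
      I.con above (some (i, j)) (I.nearMin (I.kform above) p) < 0) :
    I.RegionStep (I.Cell above) p (ray p (I.nearMin (I.kform above) p - p) τ) := by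
  obtain ⟨a, ha⟩ := ha
  have hm := isNearestMinimizer_region hI hB hz ha p
  set m := I.nearMin (I.kform above) p
  have hm0 : 0 ≤ m.1 := hm.1.1
  have hp0 : 0 ≤ p.1 := hp.1
  refine (regionStep_iff hn hI hB hg hz hp).2 ⟨⟨a, ha⟩, hlt, ?_, ⟨mem_segment_iff_ray.2
    ⟨τ, h0.le, h1, rfl⟩, mem_Cell.2 fun c => ?_⟩, fun y hy => ?_⟩
  · intro h
    have e1 : τ * (m.1 - p.1) = 0 := by simpa using congrArg Prod.fst h
    have e2 : τ * (m.2 - p.2) = 0 := by simpa using congrArg Prod.snd h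
    have e1 := (mul_eq_zero.1 e1).resolve_left h0.ne'
    have e2 := (mul_eq_zero.1 e2).resolve_left h0.ne'
    have : m = p := by ext <;> linarith
    rw [this, F_eq_FG hI hp] at hlt
    exact lt_irrefl _ hlt
  · rw [con_ray]
    rcases c with _ | ⟨i, j⟩
    · change 0 ≤ p.1 + τ * (m.1 - p.1)
      nlinarith
    · exact hin i j
  · obtain ⟨t, ht0, ht1, rfl⟩ := mem_segment_iff_ray.1 hy.1
    have ht : t ≤ τ := by
      rcases hex with rfl | ⟨i, j, e, hneg⟩
      · exact ht1
      · have h3 := mem_Cell.1 hy.2 (some (i, j))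
        have h4 := mem_Cell.1 hp (some (i, j))
        rw [con_ray] at h3
        by_contra hlt'
        push Not at hlt'
        nlinarith
    refine mem_segment_iff_ray.2 ⟨t / τ, by positivity, (div_le_one h0).2 ht, ?_⟩
    ext <;> simp <;> field_simp <;> rfl

/-- A constraint that is tight at `p` and violated at the minimizer is violated at once along the
path. -/
lemma not_regionStep_of_con (hI : I.Admissible) (hB : BddBelow (I.F '' halfPlane)) {p q z : ℝ × ℝ}
    (hz : I.StrictIn above z) (hp : p ∈ I.Cell above) (ha : ∃ a, I.kform above a ≠ 0) {i : Fin n}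
    {j : Fin 4} (h0 : I.con above (some (i, j)) p ≤ 0)
    (h1 : I.con above (some (i, j)) (I.nearMin (I.kform above) p) < 0) :
    ¬ I.RegionStep (I.Cell above) p q := by
  intro h
  obtain ⟨a, ha⟩ := ha
  have hqc := mem_Cell.1 h.mem (some (i, j))
  obtain ⟨m, τ, hm, hτ0, -, rfl, -⟩ := h.exit hI hz
  obtain rfl := nearestMinimizer_unique hI hm (isNearestMinimizer_region hI hB hz ha p)
  have := mem_Cell.1 hp (some (i, j))
  rw [con_ray] at hqc
  nlinarith

variable (I)

/-- Whether `x i` is at most the value marked by `κ` (`none` stands for `-∞`). -/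
def Cut (κ : Option (Fin n)) (i : Fin n) : Prop := ∃ a ∈ κ, I.x i ≤ I.x a

open Classical in
/-- The sides of the cell at `p` that is entered by the directions `±(1, 2 d)` with `d` just above
the value marked by `κ`, to the right if `o = true` and to the left if `o = false`. -/
noncomputable def cand (p : ℝ × ℝ) (κ : Option (Fin n)) (o : Bool) (i : Fin n) (j : Fin 4) : Bool :=
  decide (I.s i p + I.β j < 0 ∨ (I.s i p + I.β j = 0 ∧ (I.Cut κ i ↔ o = true)))

/-- The line of some index `j` of observation `i` passes through `p`. -/
def Thru (p : ℝ × ℝ) (i : Fin n) : Prop := ∃ j, I.s i p + I.β j = 0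

open Classical in
/-- Representatives of the slopes of the lines through `p`. -/
noncomputable def reps (p : ℝ × ℝ) : Finset (Fin n) :=
  Finset.univ.filter fun i => I.Thru p i ∧ ∀ i' < i, I.Thru p i' → I.x i' ≠ I.x i

open Classical in
/-- Indices of the cells around `p`. -/
noncomputable def cands (p : ℝ × ℝ) : Finset (Option (Fin n) × Bool) :=
  Finset.univ.filter fun c => (∀ a ∈ c.1, a ∈ I.reps p) ∧ (c.2 = true ∨ 0 < p.1)

/-- The direction `±(1, 2 d)`. -/
def sdir (o : Bool) (d : ℝ) : ℝ × ℝ := if o then (1, 2 * d) else (-1, -(2 * d))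

variable {I}

lemma s_sdir (i : Fin n) (o : Bool) (d : ℝ) :
    I.s i (sdir o d) = if o then 2 * (I.x i - d) else 2 * (d - I.x i) := by
  cases o <;> simp [s, sdir] <;> ring

lemma card_cands_le (p : ℝ × ℝ) : (I.cands p).card ≤ 2 * ((I.reps p).card + 1) := by
  classical
  have : I.cands p ⊆ (insert none ((I.reps p).image some)) ×ˢ (Finset.univ : Finset Bool) := by
    rintro ⟨κ, o⟩ h
    simp only [cands, Finset.mem_filter, Finset.mem_univ, true_and] at h
    simp only [Finset.mem_product, Finset.mem_univ, and_true, Finset.mem_insert, Finset.mem_image]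
    rcases κ with _ | a
    · exact Or.inl rfl
    · exact Or.inr ⟨a, h.1 a rfl, rfl⟩
  have h2 := Finset.card_le_card this
  rw [Finset.card_product] at h2
  have h3 := Finset.card_insert_le (none : Option (Fin n)) ((I.reps p).image some)
  have h4 : ((I.reps p).image some).card ≤ (I.reps p).card := Finset.card_image_le
  simp only [Finset.card_univ, Fintype.card_bool] at h2
  omega

lemma card_reps_le (p : ℝ × ℝ) : (I.reps p).card ≤ n := by
  simpa using Finset.card_le_univ (I.reps p)

lemma card_reps_le_one {p : ℝ × ℝ} (hp : 0 ≤ p.1) (hv : ¬ I.IsVertex p) :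
    (I.reps p).card ≤ 1 := by
  classical
  refine Finset.card_le_one.2 fun a ha b hb => ?_
  simp only [reps, Finset.mem_filter, Finset.mem_univ, true_and] at ha hb
  obtain ⟨⟨j, hj⟩, ha⟩ := ha
  obtain ⟨⟨j', hj'⟩, hb⟩ := hb
  have hx := (line_unique hp hv hj hj').1
  rcases lt_trichotomy a b with h | h | h
  · exact absurd hx.symm (hb a h ⟨j, hj⟩)
  · exact h
  · exact absurd hx (ha b h ⟨j', hj'⟩)

lemma exists_rep {p : ℝ × ℝ} {i : Fin n} (h : I.Thru p i) :
    ∃ a ∈ I.reps p, I.x a = I.x i ∧ I.Thru p a := by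
  classical
  obtain ⟨a, ha, hmin⟩ := Finset.exists_min_image
    (Finset.univ.filter fun a => I.Thru p a ∧ I.x a = I.x i) id ⟨i, by simpa using h⟩
  simp only [Finset.mem_filter, Finset.mem_univ, true_and] at ha
  refine ⟨a, ?_, ha.2, ha.1⟩
  simp only [reps, Finset.mem_filter, Finset.mem_univ, true_and]
  refine ⟨ha.1, fun b hb hbt hx => ?_⟩
  have := hmin b (by simp only [Finset.mem_filter, Finset.mem_univ, true_and]
                     exact ⟨hbt, hx.trans ha.2⟩)
  exact absurd hb (not_lt.2 this)

lemma thru_of_mem_reps {p : ℝ × ℝ} {a : Fin n} (h : a ∈ I.reps p) : I.Thru p a := by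
  classical
  simp only [reps, Finset.mem_filter, Finset.mem_univ, true_and] at h
  exact h.1

lemma cand_eq_true_iff {p : ℝ × ℝ} {κ : Option (Fin n)} {o : Bool} {i : Fin n} {j : Fin 4} :
    I.cand p κ o i j = true ↔
      I.s i p + I.β j < 0 ∨ (I.s i p + I.β j = 0 ∧ (I.Cut κ i ↔ o = true)) := by
  classical
  exact decide_eq_true_iff

/-- On a line through `p` the slack of the cell along a direction. -/
lemma con_cand_sdir {p : ℝ × ℝ} (κ : Option (Fin n)) (o : Bool) {i : Fin n} {j : Fin 4}
    (hl : I.s i p + I.β j = 0) (d τ : ℝ) (hc : I.Cut κ i → I.x i ≤ d)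
    (hc' : ¬ I.Cut κ i → d ≤ I.x i) :
    I.con (I.cand p κ o) (some (i, j)) (ray p (sdir o d) τ) = 2 * τ * |I.x i - d| := by
  have e : I.s i (ray p (sdir o d) τ) + I.β j = τ * I.s i (sdir o d) := by
    rw [s_ray]; linarith
  have hcon : I.con (I.cand p κ o) (some (i, j)) (ray p (sdir o d) τ) =
      if I.cand p κ o i j then -(I.s i (ray p (sdir o d) τ) + I.β j)
        else I.s i (ray p (sdir o d) τ) + I.β j := by
    simp only [con]
  rw [hcon, e, s_sdir]
  have h0 : I.cand p κ o i j = true ↔ (I.Cut κ i ↔ o = true) := by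
    rw [cand_eq_true_iff]; simp [hl]
  by_cases h : I.Cut κ i
  · rw [abs_of_nonpos (by linarith [hc h])]
    cases o
    · rw [if_neg (by rw [h0]; simp [h])]; simp; ring
    · rw [if_pos (by rw [h0]; simp [h])]; simp; ring
  · rw [abs_of_nonneg (by linarith [hc' h])]
    cases o
    · rw [if_pos (by rw [h0]; simp [h])]; simp; ring
    · rw [if_neg (by rw [h0]; simp [h])]; simp; ring

lemma mem_Cell_cand {p : ℝ × ℝ} (hp : 0 ≤ p.1) (κ : Option (Fin n)) (o : Bool) :
    p ∈ I.Cell (I.cand p κ o) := by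
  refine mem_Cell.2 fun c => ?_
  rcases c with _ | ⟨i, j⟩
  · exact hp
  · simp only [con]
    split_ifs with h
    · rcases cand_eq_true_iff.1 h with h | ⟨h, -⟩ <;> linarith
    · rw [cand_eq_true_iff, not_or] at h
      exact not_lt.1 h.1

/-- A value that separates the observations below the mark from those above it. -/
lemma exists_gap (κ : Option (Fin n)) :
    ∃ d, ∀ i, (I.Cut κ i → I.x i < d) ∧ (¬ I.Cut κ i → d < I.x i) := by
  rcases κ with _ | a
  · obtain ⟨M, hM⟩ := (Set.finite_range I.x).bddBelow
    refine ⟨M - 1, fun i => ⟨?_, fun _ => ?_⟩⟩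
    · rintro ⟨a, ha, -⟩; cases ha
    · have := hM ⟨i, rfl⟩; linarith
  · have : ∀ᶠ τ in 𝓝[>] (0 : ℝ), ∀ i, I.x a < I.x i → 0 < (I.x i - I.x a) + τ * (-1) := by
      rw [eventually_all]; intro i
      by_cases h : I.x a < I.x i
      · filter_upwards [eventually_pos (sub_pos.2 h) (-1)] with τ hτ _ using hτ
      · exact Eventually.of_forall fun τ h' => absurd h' h
    obtain ⟨τ, hτ, h0, -⟩ := (this.and (eventually_small one_pos)).exists
    refine ⟨I.x a + τ, fun i => ⟨?_, fun h => ?_⟩⟩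
    · rintro ⟨b, hb, hle⟩
      obtain rfl : a = b := by simpa using hb
      linarith
    · have : I.x a < I.x i := by
        by_contra hh
        exact h ⟨a, rfl, not_lt.1 hh⟩
      have := hτ i this
      linarith

/-- With `d` in the gap after the mark, the direction `sdir o d` is parallel to no line, so a short
move along it is strictly inside. On the axis only moves to the right stay in the half-plane. -/
lemma strictIn_cand {p : ℝ × ℝ} (hp : 0 ≤ p.1) (κ : Option (Fin n)) {o : Bool}
    (ho : o = true ∨ 0 < p.1) : ∃ z, I.StrictIn (I.cand p κ o) z := by
  obtain ⟨d, hd⟩ := exists_gap (I := I) κ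
  have h1 : ∀ᶠ τ in 𝓝[>] (0 : ℝ), ∀ i j,
      0 < I.con (I.cand p κ o) (some (i, j)) (ray p (sdir o d) τ) := by
    rw [eventually_all]; intro i
    rw [eventually_all]; intro j
    by_cases hl : I.s i p + I.β j = 0
    · filter_upwards [eventually_small one_pos] with τ hτ
      rw [con_cand_sdir κ o hl d τ (fun h => ((hd i).1 h).le) fun h => ((hd i).2 h).le]
      have : I.x i - d ≠ 0 := by
        by_cases hc : I.Cut κ i
        · exact (sub_neg.2 ((hd i).1 hc)).ne
        · exact (sub_pos.2 ((hd i).2 hc)).ne'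
      have := abs_pos.2 this
      have := hτ.1
      positivity
    · have hpos : 0 < I.con (I.cand p κ o) (some (i, j)) p :=
        lt_of_le_of_ne (mem_Cell.1 (mem_Cell_cand hp κ o) _) fun h =>
          hl ((con_eq_zero_iff i j p).1 h.symm)
      filter_upwards [eventually_pos hpos (I.con (I.cand p κ o) (some (i, j)) (ray p (sdir o d) 1) -
        I.con (I.cand p κ o) (some (i, j)) p)] with τ hτ
      rw [con_ray_dir]; exact hτ
  have h2 : ∀ᶠ τ in 𝓝[>] (0 : ℝ), 0 ≤ (ray p (sdir o d) τ).1 := by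
    cases o
    · have hp' : 0 < p.1 := by simpa using ho
      filter_upwards [eventually_pos hp' (-1)] with τ hτ
      simpa [sdir] using hτ.le
    · filter_upwards [eventually_small one_pos] with τ hτ
      simp [sdir]; linarith
  obtain ⟨τ, h1, h2⟩ := (h1.and h2).exists
  exact ⟨_, h2, h1⟩

/-- Every cell at `p` is in the list. -/
lemma exists_cand {p z : ℝ × ℝ} (hz : I.StrictIn above z) (hp : p ∈ I.Cell above) :
    ∃ c ∈ I.cands p, above = I.cand p c.1 c.2 := by
  classical
  -- The interior point is moved off the vertical line through `p`, so that the direction from `p`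
  -- to it has a slope `2 d`.
  obtain ⟨z, hz, hzp⟩ : ∃ z, I.StrictIn above z ∧ z.1 ≠ p.1 := by
    by_cases h : z.1 = p.1
    · obtain ⟨τ, hτ, h0, -⟩ := ((hz.eventually (1, 0)).and (eventually_small one_pos)).exists
      have := hz.1
      exact ⟨ray z (1, 0) τ, ⟨by simp; linarith, hτ⟩, by simp [h]; linarith⟩
    · exact ⟨z, hz, h⟩
  set Δ := z.1 - p.1 with hΔ
  have hΔ0 : Δ ≠ 0 := sub_ne_zero.2 hzp
  set d := (z.2 - p.2) / (2 * Δ) with hd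
  have hs : ∀ i j, I.s i p + I.β j = 0 → I.s i z + I.β j = 2 * Δ * (I.x i - d) := by
    intro i j h
    have : 2 * Δ * d = z.2 - p.2 := by rw [hd]; field_simp
    simp only [s] at h ⊢
    nlinarith
  -- The mark is the largest slope below `d` among the lines through `p`; the sides depend on `d`
  -- only through it.
  obtain ⟨κ, hκ, hcut⟩ : ∃ κ : Option (Fin n), (∀ a ∈ κ, a ∈ I.reps p) ∧
      ∀ i, I.Thru p i → (I.Cut κ i ↔ I.x i < d) := by
    by_cases hA : ∃ i, I.Thru p i ∧ I.x i < d
    · obtain ⟨i₀, hi₀⟩ := hA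
      obtain ⟨a, ha, hmax⟩ := Finset.exists_max_image
        (Finset.univ.filter fun i => I.Thru p i ∧ I.x i < d) I.x ⟨i₀, by simpa using hi₀⟩
      simp only [Finset.mem_filter, Finset.mem_univ, true_and] at ha hmax
      obtain ⟨b, hb, hbx, -⟩ := exists_rep ha.1
      refine ⟨some b, fun c hc => by obtain rfl : b = c := by simpa using hc
                                     exact hb, fun i hi => ⟨?_, fun h => ?_⟩⟩
      · rintro ⟨c, hc, hle⟩
        obtain rfl : b = c := by simpa using hc
        linarith [ha.2]
      · exact ⟨b, rfl, by rw [hbx]; exact hmax i ⟨hi, h⟩⟩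
    · push Not at hA
      refine ⟨none, fun a ha => (by cases ha), fun i hi => ⟨?_, fun h => ?_⟩⟩
      · rintro ⟨a, ha, -⟩; cases ha
      · exact absurd h (not_lt.2 (hA i hi))
  have hmain : ∀ o : Bool, (o = true → 0 < Δ) → (o = false → Δ < 0) → above = I.cand p κ o := by
    intro o ho1 ho2
    funext i j
    rw [Bool.eq_iff_iff, hz.above_iff, cand_eq_true_iff]
    by_cases hl : I.s i p + I.β j = 0
    · have hne := hz.2 i j
      have hne : I.s i z + I.β j ≠ 0 := fun h =>
        hne.ne' ((con_eq_zero_iff (above := above) i j z).2 h)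
      rw [hs i j hl] at hne ⊢
      rw [hl, hcut i ⟨j, hl⟩]
      have hxd : I.x i ≠ d := fun h => hne (by rw [h]; ring)
      simp only [lt_irrefl, false_or, true_and]
      cases o
      · have := ho2 rfl
        constructor
        · intro h
          simp only [Bool.false_eq_true, iff_false, not_lt]
          by_contra hh
          push Not at hh
          nlinarith
        · intro h
          simp only [Bool.false_eq_true, iff_false, not_lt] at h
          have := lt_of_le_of_ne h hxd.symm
          nlinarith
      · have := ho1 rfl
        constructor
        · intro h
          simp only [iff_true]
          by_contra hh
          push Not at hh
          nlinarith
        · intro h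
          simp only [iff_true] at h
          nlinarith
    · have h1 := con_some_nonneg hp i j
      rw [← hz.above_iff]
      simp only [hl, false_and, or_false]
      split_ifs at h1 with hab
      · simp only [hab, true_iff]; exact lt_of_le_of_ne h1 hl
      · simp only [hab]
        exact ⟨fun h => absurd h (by simp), fun h => absurd h (not_lt.2 h1)⟩
  rcases lt_or_gt_of_ne hΔ0 with h | h
  · refine ⟨(κ, false), ?_, hmain false (by simp) fun _ => h⟩
    have := hz.1
    simp only [cands, Finset.mem_filter, Finset.mem_univ, true_and]
    exact ⟨hκ, Or.inr (by linarith)⟩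
  · refine ⟨(κ, true), ?_, hmain true (fun _ => h) (by simp)⟩
    simp only [cands, Finset.mem_filter, Finset.mem_univ, true_and]
    exact ⟨hκ, Or.inl trivial⟩

lemma ok_of_mem_cands {p : ℝ × ℝ} {c : Option (Fin n) × Bool} (h : c ∈ I.cands p) :
    (∀ a ∈ c.1, a ∈ I.reps p) ∧ (c.2 = true ∨ 0 < p.1) := by
  classical
  simpa only [cands, Finset.mem_filter, Finset.mem_univ, true_and] using h

/-- The ray along the line of slope `2 x_a` borders the cell marked by `a`. So the quadratic form of
that cell describes `F` on the beginning of this ray. -/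
lemma eventually_sdir_mem {p : ℝ × ℝ} (hp : 0 ≤ p.1) (a : Fin n) {o : Bool}
    (ho : o = true ∨ 0 < p.1) :
    ∀ᶠ τ in 𝓝[>] (0 : ℝ), ray p (sdir o (I.x a)) τ ∈ I.Cell (I.cand p (some a) o) := by
  simp only [mem_Cell]
  rw [eventually_all]
  rintro (_ | ⟨i, j⟩)
  · cases o
    · have hp' : 0 < p.1 := by simpa using ho
      filter_upwards [eventually_pos hp' (-1)] with τ hτ
      simpa [sdir, con] using hτ.le
    · filter_upwards [eventually_small one_pos] with τ hτ
      simp [sdir, con]; linarith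
  · by_cases hl : I.s i p + I.β j = 0
    · filter_upwards [eventually_small one_pos] with τ hτ
      rw [con_cand_sdir (some a) o hl]
      · have := hτ.1
        positivity
      · rintro ⟨b, hb, hle⟩
        obtain rfl : a = b := by simpa using hb
        exact hle
      · intro hc
        by_contra hh
        exact hc ⟨a, rfl, (not_le.1 hh).le⟩
    · have hpos : 0 < I.con (I.cand p (some a) o) (some (i, j)) p :=
        lt_of_le_of_ne (mem_Cell.1 (mem_Cell_cand hp (some a) o) _) fun h =>
          hl ((con_eq_zero_iff i j p).1 h.symm)
      filter_upwards [eventually_pos hpos (I.con (I.cand p (some a) o) (some (i, j))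
        (ray p (sdir o (I.x a)) 1) - I.con (I.cand p (some a) o) (some (i, j)) p)] with τ hτ
      rw [con_ray_dir]; exact hτ.le

/-- The critical point on a ray along which the objective decreases. -/
lemma rayCritical_sdir (hI : I.Admissible) (hB : BddBelow (I.F '' halfPlane)) {p : ℝ × ℝ}
    (hg : I.Good p) {a : Fin n} (ha : I.Thru p a) {o : Bool} (ho : o = true ∨ 0 < p.1)
    (hneg : I.quadB (I.kform (I.cand p (some a) o)) p (sdir o (I.x a)) < 0) :
    ∃ e, I.RayCritical e p (ray p (sdir o (I.x a))
      (-I.quadB (I.kform (I.cand p (some a) o)) p (sdir o (I.x a)) /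
        (2 * I.quadA (I.kform (I.cand p (some a) o)) (sdir o (I.x a))))) := by
  obtain ⟨j, hj⟩ := ha
  obtain ⟨z, hz⟩ := strictIn_cand (I := I) hg.1 (some a) ho
  have hpc := mem_Cell_cand (I := I) hg.1 (some a) o
  set k := I.kform (I.cand p (some a) o)
  set dr := sdir o (I.x a)
  have hA := quadA_nonneg hI k dr
  obtain ⟨τ, ⟨hτc, hτ⟩, h0, -⟩ := (((eventually_sdir_mem hg.1 a ho).and
    (eventually_pos (neg_pos.2 hneg) (-I.quadA k dr))).and (eventually_small one_pos)).exists
  refine ⟨_, rayCritical_of_descent hI hB hg hz hpc hj (d := dr) ?_ h0 hτc ?_⟩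
  · simp only [dr, s_sdir]; split <;> ring
  · rw [F_eq_FG hI hτc, FG_ray hI, ← F_eq_FG hI hpc]
    nlinarith

/-- Every critical point is found on one of the rays. -/
lemma RayCritical.exists_sdir (hI : I.Admissible) (hB : BddBelow (I.F '' halfPlane))
    {e : Set (ℝ × ℝ)} {p q : ℝ × ℝ} (hg : I.Good p) (h : I.RayCritical e p q) :
    ∃ a o, (some a, o) ∈ I.cands p ∧
      I.quadB (I.kform (I.cand p (some a) o)) p (sdir o (I.x a)) < 0 ∧
      q = ray p (sdir o (I.x a)) (-I.quadB (I.kform (I.cand p (some a) o)) p (sdir o (I.x a)) /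
        (2 * I.quadA (I.kform (I.cand p (some a) o)) (sdir o (I.x a)))) := by
  classical
  obtain ⟨above, i, j, z, -, -, -, hqc, hpl, hql⟩ := h.exists_cell
  obtain ⟨a, ha, hx, hat⟩ := exists_rep (I := I) (p := p) (i := i) ⟨j, hpl⟩
  have hlt := h.2.2.2.1
  have hd : I.s a (q - p) = 0 := by rw [s_congr hx, s_sub]; linarith
  have hd' := hd
  simp only [s, Prod.fst_sub, Prod.snd_sub] at hd'
  have hq0 : 0 ≤ q.1 := hqc.1
  have hne : q.1 - p.1 ≠ 0 := by
    intro h0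
    rw [h0] at hd'
    have : q = p := by ext <;> linarith
    rw [this] at hlt
    exact lt_irrefl _ hlt
  obtain ⟨o, T, hT, ho, hqr⟩ : ∃ (o : Bool) (T : ℝ), 0 < T ∧ (o = true ∨ 0 < p.1) ∧
      q = ray p (sdir o (I.x a)) T := by
    rcases lt_or_gt_of_ne hne with hn | hn
    · refine ⟨false, p.1 - q.1, by linarith, Or.inr (by linarith), ?_⟩
      ext
      · simp [sdir]
      · simp [sdir]; linarith
    · refine ⟨true, q.1 - p.1, by linarith, Or.inl rfl, ?_⟩
      ext
      · simp [sdir]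
      · simp [sdir]; linarith
  obtain ⟨τ, hτc, h0, h1⟩ := ((eventually_sdir_mem hg.1 a ho).and (eventually_small hT)).exists
  have hpc := mem_Cell_cand (I := I) hg.1 (some a) o
  obtain ⟨j', hj'⟩ := hat
  have hdir : I.s a (sdir o (I.x a)) = 0 := by rw [s_sdir]; split <;> ring
  have hτF : I.F (ray p (sdir o (I.x a)) τ) < I.F p := by
    have := F_ray_lt hI hlt (τ := τ / T) (by positivity) ((div_le_one hT).2 h1.le)
    have e : ray p (q - p) (τ / T) = ray p (sdir o (I.x a)) τ := by
      rw [hqr]; ext <;> simp <;> field_simp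
    rwa [e] at this
  have hneg := (descent_along_line hI hB hg hpc hj' hdir h0 hτc hτF).2.1
  refine ⟨a, o, ?_, hneg, ?_⟩
  · simp only [cands, Finset.mem_filter, Finset.mem_univ, true_and]
    exact ⟨fun b hb => by obtain rfl : a = b := by simpa using hb
                          exact ha, ho⟩
  · obtain ⟨e', he'⟩ := rayCritical_sdir hI hB hg ⟨j', hj'⟩ ho hneg
    refine h.unique hI hB hg he' (i := a) hd ?_
    rw [s_sub, s_ray, hdir]; ring

end Newsvendor

namespace Ctx

variable {Ω : Type} {R : Ω → List ℝ → Prop} {σ : Ctx Ω}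

/-- A node that no input reaches may be closed by any output. This disposes of impossible outcomes
of comparisons. -/
lemma Can.of_empty {c : ℕ} {Q : Ctx Ω → Prop} (h : ∀ ω, ω ∉ σ.D) : Can R σ c Q :=
  fun _ _ => .out [] (by simp) (fun ω hω => absurd hω (h ω)) (Nat.zero_le _)

/-- Decided comparisons have the same outcome for all inputs at a node, so combinatorial data can be
read off from a single representative input. -/
lemma Known.iff {P : Ω → Prop} (h : σ.Known P) {ω ω' : Ω} (hω : ω ∈ σ.D) (hω' : ω' ∈ σ.D) :
    P ω ↔ P ω' := by
  rcases h with h | h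
  · exact iff_of_true (h ω hω) (h ω' hω')
  · exact iff_of_false (h ω hω) (h ω' hω')

lemma Cheap.nonpos {c : ℕ} {u : Ω → ℝ} (h : Cheap R σ c u) :
    Can R σ (c + 2) fun τ => τ.Known fun ω => u ω ≤ 0 := by
  simpa using h.compare (Cheap.natCast 0)

lemma Cheap.nonneg {c : ℕ} {u : Ω → ℝ} (h : Cheap R σ c u) :
    Can R σ (c + 2) fun τ => τ.Known fun ω => 0 ≤ u ω := by
  simpa using (((Cheap.natCast 0).compare h).le (by omega) : Can R σ (c + 2) _)

end Ctx

namespace Newsvendor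

open Ctx

variable {n : ℕ} {R : Adm n → List ℝ → Prop} {σ : Ctx (Adm n)}

/-! ### One pass through the loop -/

lemma kform_congr {I J : Newsvendor n} (h : I.Big ↔ J.Big) (above : Fin n → Fin 4 → Bool) :
    I.kform above = J.kform above := by
  funext i
  by_cases hJ : J.Big
  · simp only [kform, if_pos hJ, if_pos (h.2 hJ)]
  · simp only [kform, if_neg hJ, if_neg fun hI => hJ (h.1 hI)]

lemma cheap_con (hb : Base σ) (above : Fin n → Fin 4 → Bool) {p : Adm n → ℝ × ℝ}
    (hp : HavePt σ p) (c : Fin n × Fin 4) : Cheap R σ 7 fun I => I.1.con above (some c) (p I) := by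
  have h := (cheap_s (R := R) hb hp c.1).add (hb.β c.2).cheap
  by_cases ha : above c.1 c.2 = true
  · exact h.neg.congr fun I _ => by simp only [con, if_pos ha]
  · exact (h.congr fun I _ => by simp only [con, if_neg ha]).le (by norm_num)

lemma can_nearMin (hb : Base σ) (k : Fin n → Fin 3) {p : Adm n → ℝ × ℝ} (hp : HavePt σ p) :
    Can R σ (50 * n + 60) fun τ => HavePt τ fun I => I.1.nearMin k (p I) := by
  refine Can.le (c := (5 * n + 5) + ((7 * n + 8) + (1 + (1 + ((15 * n + 2) + ((23 * n + 15) +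
    (2 + (2 + (10 + 2))))))))) ?_ (by omega)
  refine (cheap_mSlope hb k).can.bind fun σ₁ h₁ hs₁ => ?_
  refine ((cheap_mIcpt (hb.mono h₁) k).can).bind fun σ₂ h₂ hi₂ => ?_
  refine (Cheap.natCast 1).can.bind fun σ₃ h₃ h1 => ?_
  refine (Cheap.natCast 0).can.bind fun σ₄ h₄ h0 => ?_
  have h24 := le_trans h₃ h₄
  have h14 := le_trans h₂ h24
  have h04 := le_trans h₁ h14
  have hdir : HavePt σ₄ fun I => (1, I.1.mSlope k) :=
    ⟨(h1.mono h₄).congr fun _ _ => by simp, hs₁.mono h14⟩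
  have hpt : HavePt σ₄ fun I => (0, I.1.mIcpt k) :=
    ⟨h0.congr fun _ _ => by simp, hi₂.mono h24⟩
  have hb := hb.mono h04
  refine ((cheap_quadA hb k hdir).can).bind fun σ₅ h₅ hD => ?_
  refine (((cheap_quadB hb k hpt hdir).mono h₅).can).bind fun σ₆ h₆ hE => ?_
  have hD : σ₆.Have fun I => I.1.mD k := hD.mono h₆
  have hE : σ₆.Have fun I => I.1.mE k := hE
  refine (hD.cheap.nonpos).bind fun σ₇ h₇ kD => ?_
  refine (Cheap.nonpos (c := 0) (hE.mono h₇).cheap).bind fun σ₈ h₈ kE => ?_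
  have h68 := le_trans h₇ h₈
  have h48 := le_trans (le_trans h₅ h₆) h68
  have hs := hs₁.mono (le_trans h14 h48)
  have hi := hi₂.mono (le_trans h24 h48)
  have hp := hp.mono (le_trans h04 h48)
  have kD := kD.mono h₈
  have hD := hD.mono h68
  have hE := hE.mono h68
  have hT : Cheap R σ₈ 10 fun I => I.1.mTime k (p I) := by
    rcases kD with kD | kD
    · rcases kE with kE | kE
      · refine ((((Cheap.natCast 0).max ((hp.1.cheap.add (hs.cheap.mul
          (hp.2.cheap.sub hi.cheap))).div ((Cheap.natCast 1).add hs.cheap.sq)))).congr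
          fun I hI => ?_).le (by norm_num)
        rw [mTime, if_neg (not_lt.2 (kD I hI)), if_neg (not_lt.2 (kE I hI))]
        simp
      · refine ((Cheap.natCast 0).congr fun I hI => ?_).le (by norm_num)
        rw [mTime, if_neg (not_lt.2 (kD I hI)), if_pos (not_le.1 (kE I hI))]
        simp
    · refine ((((Cheap.natCast 0).max (hE.cheap.neg.div ((Cheap.natCast 2).mul hD.cheap)))).congr
        fun I hI => ?_).le (by norm_num)
      rw [mTime, if_pos (not_le.1 (kD I hI))]
      simp
  refine hT.can.bind fun σ₉ h₉ hT => ?_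
  refine (((hs.mono h₉).cheap.mul hT.cheap).add (hi.mono h₉).cheap).can.imp fun τ hτ h2 => ?_
  exact ⟨hT.mono hτ, h2⟩

lemma can_ray {p d : Adm n → ℝ × ℝ} {t : Adm n → ℝ} (hp : HavePt σ p) (hd : HavePt σ d)
    (ht : σ.Have t) : Can R σ 4 fun τ => HavePt τ fun I => ray (p I) (d I) (t I) :=
  can_pt (c := 2) (d := 2) (hp.1.cheap.add (ht.cheap.mul hd.1.cheap))
    (hp.2.cheap.add (ht.cheap.mul hd.2.cheap))

/-- The region step through a given cell, or the certainty that there is none. -/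
lemma can_region (hn : 1 ≤ n) (hb : Base σ) {p : Adm n → ℝ × ℝ} (hp : HavePt σ p)
    (hF : σ.Have fun I => I.1.F (p I)) (above : Fin n → Fin 4 → Bool)
    (hg : ∀ I ∈ σ.D, I.1.Good (p I)) (hz : ∀ I ∈ σ.D, ∃ z, I.1.StrictIn above z)
    (hc : ∀ I ∈ σ.D, p I ∈ I.1.Cell above) :
    Can R σ (300 * n) fun τ =>
      (∃ q, HavePt τ q ∧ ∀ I ∈ τ.D, I.1.RegionStep (I.1.Cell above) (p I) (q I)) ∨
        ∀ I ∈ τ.D, ∀ q, ¬ I.1.RegionStep (I.1.Cell above) (p I) q := by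
  by_cases hD : ∃ I, I ∈ σ.D
  swap
  · exact Can.of_empty (not_exists.1 hD)
  obtain ⟨J, hJ⟩ := hD
  -- The forms depend only on the sides and the regime, hence are the same for all inputs at this
  -- node.
  obtain ⟨k, rfl⟩ : ∃ k, k = J.1.kform above := ⟨_, rfl⟩
  set k := J.1.kform above
  have hk : ∀ I ∈ σ.D, I.1.kform above = k := fun I hI => kform_congr (hb.big.iff hI hJ) above
  by_cases ha : ∃ a, k a ≠ 0
  swap
  · refine Can.le (Can.pure (Or.inr fun I hI q h => ha ?_)) (Nat.zero_le _)
    obtain ⟨z, hz⟩ := hz I hI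
    rw [← hk I hI]
    exact ((regionStep_iff hn I.2.1 I.2.2 (hg I hI) hz (hc I hI)).1 h).1
  have ha' : ∀ I ∈ σ.D, ∃ a, I.1.kform above a ≠ 0 := fun I hI => by rw [hk I hI]; exact ha
  refine Can.le (c := (50 * n + 60) + ((27 * n + 16) + (1 + ((n * 4) * 18 + ((n * 4) * 2 +
    (n * 4 + 6)))))) ?_ (by omega)
  refine (can_nearMin hb k hp).bind fun σ₁ h₁ hm => ?_
  refine ((cheap_FG (hb.mono h₁) k hm).can).bind fun σ₂ h₂ hFm => ?_
  refine (Can.compare (hF.mono (le_trans h₁ h₂)) hFm).bind fun σ₃ h₃ hlt => ?_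
  have h13 := le_trans h₂ h₃
  have h03 := le_trans h₁ h13
  rcases hlt with hge | hlt
  · refine Can.le (Can.pure (Or.inr fun I hI q h => ?_)) (Nat.zero_le _)
    have hI' := h03.2 hI
    obtain ⟨z, hz⟩ := hz I hI'
    have := ((regionStep_iff hn I.2.1 I.2.2 (hg I hI') hz (hc I hI')).1 h).2.1
    rw [hk I hI'] at this
    exact absurd (hge I hI) (not_le.2 this)
  -- Slacks at the current point and at the minimizer. The constraint `λ₁ ≥ 0` can be ignored, as
  -- both points are in the half-plane.
  let a : Fin n × Fin 4 → Adm n → ℝ := fun c I => I.1.con above (some c) (p I)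
  let b : Fin n × Fin 4 → Adm n → ℝ := fun c I => I.1.con above (some c) (I.1.nearMin k (p I))
  have hb₃ := hb.mono h03
  have hp₃ := hp.mono h03
  have hm₃ := hm.mono h13
  refine ((Can.forall_fintype (ι := Fin n × Fin 4) (c := 18)
    (Q := fun c τ => (τ.Have (a c)) ∧ (τ.Have (b c)) ∧ (τ.Known fun I => a c I ≤ 0) ∧
      τ.Known fun I => 0 ≤ b c I) (fun c τ τ' hle h => ⟨h.1.mono hle, h.2.1.mono hle,
        h.2.2.1.mono hle, h.2.2.2.mono hle⟩) fun c σ' hle => ?_).le (by simp)).bind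
    fun σ₄ h₄ hab => ?_
  · have hb' := hb₃.mono hle
    have hpa := cheap_con (R := R) hb' above (hp₃.mono hle) c
    have hpb := cheap_con (R := R) hb' above (hm₃.mono hle) c
    refine Can.le (c := 7 + (7 + (2 + 2))) ?_ (by norm_num)
    refine hpa.can.bind fun τ₁ l₁ ha => (hpb.mono l₁).can.bind fun τ₂ l₂ hb => ?_
    refine (Cheap.nonpos (c := 0) (ha.mono l₂).cheap).bind fun τ₃ l₃ k1 => ?_
    refine (Cheap.nonneg (c := 0) (hb.mono l₃).cheap).imp fun τ₄ l₄ k2 => ?_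
    exact ⟨ha.mono (le_trans l₂ (le_trans l₃ l₄)), hb.mono (le_trans l₃ l₄), k1.mono l₄, k2⟩
  have h04 := le_trans h03 h₄
  have h34 := h₄
  have hlt : ∀ I ∈ σ₄.D, I.1.FG (I.1.kform above) (I.1.nearMin (I.1.kform above) (p I)) <
      I.1.F (p I) := fun I hI => by
    rw [hk I (h04.2 hI)]; exact not_le.1 (hlt I (h₄.2 hI))
  have ha0 : ∀ c, ∀ I ∈ σ₄.D, 0 ≤ a c I := fun c I hI => mem_Cell.1 (hc I (h04.2 hI)) (some c)
  by_cases hbad : ∃ c, (∀ I ∈ σ₄.D, a c I ≤ 0) ∧ ∀ I ∈ σ₄.D, ¬ 0 ≤ b c I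
  · obtain ⟨c, hc1, hc2⟩ := hbad
    refine Can.le (Can.pure (Or.inr fun I hI q => ?_)) (Nat.zero_le _)
    have hI' := h04.2 hI
    obtain ⟨z, hz⟩ := hz I hI'
    refine not_regionStep_of_con (i := c.1) (j := c.2) I.2.1 I.2.2 hz (hc I hI') (ha' I hI')
      (hc1 I hI) ?_
    rw [hk I hI']; exact not_le.1 (hc2 I hI)
  have key : ∀ I ∈ σ₄.D, ∀ τ : ℝ, 0 < τ → τ ≤ 1 → (∀ c, 0 ≤ a c I + τ * (b c I - a c I)) →
      (τ = 1 ∨ ∃ c, a c I + τ * (b c I - a c I) = 0 ∧ b c I < 0) →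
      I.1.RegionStep (I.1.Cell above) (p I) (ray (p I) (I.1.nearMin k (p I) - p I) τ) := by
    intro I hI τ h0 h1 hin hex
    have hI' := h04.2 hI
    obtain ⟨z, hz⟩ := hz I hI'
    have := regionStep_of_time hn I.2.1 I.2.2 (hg I hI') hz (hc I hI') (ha' I hI') (hlt I hI)
      h0 h1
    rw [hk I hI'] at this
    refine this (fun i j => hin (i, j)) (hex.imp id ?_)
    rintro ⟨c, hc⟩
    exact ⟨c.1, c.2, hc⟩
  classical
  -- The constraints violated at the minimizer; the step ends there if there are none, and otherwise
  -- at the smallest time `a / (a - b)`.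
  let S : Finset (Fin n × Fin 4) := Finset.univ.filter fun c => ∀ I ∈ σ₄.D, ¬ 0 ≤ b c I
  have hS : ∀ c ∉ S, ∀ I ∈ σ₄.D, 0 ≤ b c I := fun c hcS =>
    (hab c).2.2.2.resolve_right fun h => hcS (Finset.mem_filter.2 ⟨Finset.mem_univ _, h⟩)
  have hS' : ∀ c ∈ S, ∀ I ∈ σ₄.D, b c I < 0 := fun c hcS I hI =>
    not_le.1 ((Finset.mem_filter.1 hcS).2 I hI)
  have haS : ∀ c ∈ S, ∀ I ∈ σ₄.D, 0 < a c I := fun c hcS I hI => by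
    rcases (hab c).2.2.1 with h | h
    · exact absurd ⟨c, h, (Finset.mem_filter.1 hcS).2⟩ hbad
    · exact not_le.1 (h I hI)
  have hScard : S.card ≤ n * 4 := by simpa using Finset.card_le_univ S
  rcases S.eq_empty_or_nonempty with hSe | hSn
  · refine Can.le (Can.pure (Or.inl ⟨fun I => I.1.nearMin k (p I), hm₃.mono h₄, fun I hI => ?_⟩))
      (Nat.zero_le _)
    have := key I hI 1 one_pos le_rfl (fun c => ?_) (Or.inl rfl)
    · rwa [ray_sub_one] at this
    · have := hS c (by simp [hSe]) I hI
      linarith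
  refine ((Can.forall_finset (c := 2) S (Q := fun c τ => τ.Have fun I => a c I / (a c I - b c I))
    (fun c _ => persistent_have _) fun c _ σ' hle => ?_).le
      (Nat.mul_le_mul_right 2 hScard)).bind fun σ₅ h₅ hu => ?_
  · exact ((((hab c).1.mono hle).cheap).div
      ((((hab c).1.mono hle).cheap).sub (((hab c).2.1.mono hle).cheap))).can
  refine ((Can.argmin S hSn hu).le hScard).bind fun σ₆ h₆ hmin => ?_
  obtain ⟨c, hcS, hmin⟩ := hmin
  have h46 := le_trans h₅ h₆
  have hm₆ := hm₃.mono (le_trans h₄ h46)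
  have hp₆ := hp₃.mono (le_trans h₄ h46)
  have hu₆ := (hu c hcS).mono h₆
  refine (can_pt (p := fun I => ray (p I) (I.1.nearMin k (p I) - p I) (a c I / (a c I - b c I)))
    (hp₆.1.cheap.add (hu₆.cheap.mul (hm₆.1.cheap.sub hp₆.1.cheap)))
    (hp₆.2.cheap.add (hu₆.cheap.mul (hm₆.2.cheap.sub hp₆.2.cheap)))).imp fun σ₇ h₇ hq => ?_
  refine Or.inl ⟨_, hq, fun I hI => ?_⟩
  have hI6 := h₇.2 hI
  have hI4 := h46.2 hI6
  have hac := haS c hcS I hI4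
  have hbc := hS' c hcS I hI4
  have hdc : 0 < a c I - b c I := by linarith
  refine key I hI4 _ (div_pos hac hdc) ((div_le_one hdc).2 (by linarith)) (fun c' => ?_)
    (Or.inr ⟨c, ?_, hbc⟩)
  · have hτ0 : 0 < a c I / (a c I - b c I) := div_pos hac hdc
    have hτ1 : a c I / (a c I - b c I) ≤ 1 := (div_le_one hdc).2 (by linarith)
    have ha' := ha0 c' I hI4
    by_cases hc' : c' ∈ S
    · have h1 := hmin c' hc' I hI6
      have hb' := hS' c' hc' I hI4
      have hd' : 0 < a c' I - b c' I := by linarith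
      have h2 := (le_div_iff₀ hd').1 h1
      linarith
    · have hb' := hS c' hc' I hI4
      nlinarith
  · field_simp
    ring

lemma can_sdir (hb : Base σ) (o : Bool) (a : Fin n) :
    Can R σ 5 fun τ => HavePt τ fun I => sdir o (I.1.x a) := by
  have h2 : Cheap R σ 2 fun I => 2 * I.1.x a :=
    ((Cheap.natCast 2).mul (hb.x a).cheap).congr fun I _ => by simp
  cases o
  · refine (can_pt (((Cheap.const (-1)).congr fun I _ => ?_)) (h2.neg.congr fun I _ => ?_)).le
      (by norm_num)
    · simp [sdir]
    · simp [sdir]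
  · refine (can_pt (((Cheap.const 1).congr fun I _ => ?_)) (h2.congr fun I _ => ?_)).le
      (by norm_num)
    · simp [sdir]
    · simp [sdir]

/-- The candidate cells depend on the input only through signs of slacks and the order of the
observations, which are decided comparisons. -/
lemma cand_congr {I J : Newsvendor n} {p q : ℝ × ℝ}
    (h1 : ∀ i j, I.s i p + I.β j ≤ 0 ↔ J.s i q + J.β j ≤ 0)
    (h2 : ∀ i j, 0 ≤ I.s i p + I.β j ↔ 0 ≤ J.s i q + J.β j)
    (hx : ∀ i i', I.x i ≤ I.x i' ↔ J.x i ≤ J.x i') : I.cand p = J.cand q := by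
  funext κ o i j
  have e : I.s i p + I.β j = 0 ↔ J.s i q + J.β j = 0 := by
    rw [le_antisymm_iff, le_antisymm_iff, h1, h2]
  have e' : I.s i p + I.β j < 0 ↔ J.s i q + J.β j < 0 := by
    rw [← not_le, ← not_le, h2]
  have e'' : I.Cut κ i ↔ J.Cut κ i :=
    exists_congr fun a => and_congr Iff.rfl (hx i a)
  rw [Bool.eq_iff_iff, cand_eq_true_iff, cand_eq_true_iff, e, e', e'']

lemma reps_congr {I J : Newsvendor n} {p q : ℝ × ℝ}
    (h1 : ∀ i j, I.s i p + I.β j ≤ 0 ↔ J.s i q + J.β j ≤ 0)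
    (h2 : ∀ i j, 0 ≤ I.s i p + I.β j ↔ 0 ≤ J.s i q + J.β j)
    (hx : ∀ i i', I.x i ≤ I.x i' ↔ J.x i ≤ J.x i') : I.reps p = J.reps q := by
  classical
  have e : ∀ i, I.Thru p i ↔ J.Thru q i := fun i => exists_congr fun j => by
    rw [le_antisymm_iff, le_antisymm_iff, h1, h2]
  have e' : ∀ i i', I.x i' ≠ I.x i ↔ J.x i' ≠ J.x i := fun i i' => by
    rw [ne_eq, ne_eq, le_antisymm_iff, le_antisymm_iff, hx, hx]
  ext i
  simp only [reps, Finset.mem_filter, Finset.mem_univ, true_and, e, e']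

lemma cands_congr {I J : Newsvendor n} {p q : ℝ × ℝ} (h : I.reps p = J.reps q)
    (h0 : p.1 ≤ 0 ↔ q.1 ≤ 0) : I.cands p = J.cands q := by
  classical
  ext c
  simp only [cands, Finset.mem_filter, Finset.mem_univ, true_and, h, ← not_le, h0]

/-- One pass through the loop, or the certainty that the method stops. -/
lemma can_step (hn : 1 ≤ n) (hb : Base σ) {p : Adm n → ℝ × ℝ} (hp : HavePt σ p) {r : ℕ}
    (hg : ∀ I ∈ σ.D, I.1.Good (p I)) (hr : ∀ I ∈ σ.D, (I.1.reps (p I)).card ≤ r) :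
    Can R σ (1000 * n * (r + 1)) fun τ =>
      (∃ q, HavePt τ q ∧ ∀ I ∈ τ.D, ∃ P, I.1.Step P (p I) (q I)) ∨
        ∀ I ∈ τ.D, I.1.Stops (p I) := by
  refine Can.le (c := (36 * n + 16) + ((n * 4) * 9 + (2 + (2 * (r + 1) * (300 * n) +
    (2 * (r + 1) * (38 * n + 40) + 2 * (r + 1)))))) ?_ (by nlinarith [Nat.mul_le_mul_right r hn])
  refine (cheap_F hb hp).can.bind fun σ₁ h₁ hF => ?_
  let a : Fin n × Fin 4 → Adm n → ℝ := fun c I => I.1.s c.1 (p I) + I.1.β c.2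
  have hb₁ := hb.mono h₁
  have hp₁ := hp.mono h₁
  refine ((Can.forall_fintype (ι := Fin n × Fin 4) (c := 9)
    (Q := fun c τ => (τ.Known fun I => a c I ≤ 0) ∧ τ.Known fun I => 0 ≤ a c I)
      (fun c τ τ' hle h => ⟨h.1.mono hle, h.2.mono hle⟩) fun c σ' hle => ?_).le (by simp)).bind
    fun σ₂ h₂ hab => ?_
  · have hb' := hb₁.mono hle
    have ha := (cheap_s (R := R) hb' (hp₁.mono hle) c.1).add (hb'.β c.2).cheap
    refine Can.le (c := (4 + 0 + 1) + (2 + 2)) ?_ (by norm_num)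
    refine ha.can.bind fun τ₁ l₁ ha => ?_
    refine (Cheap.nonpos (c := 0) ha.cheap).bind fun τ₃ l₃ k1 => ?_
    exact (Cheap.nonneg (c := 0) (ha.mono l₃).cheap).imp fun τ₄ l₄ k2 => ⟨k1.mono l₄, k2⟩
  refine (Cheap.nonpos (c := 0) (hp₁.mono h₂).1.cheap).bind fun σ₃ h₃ k0 => ?_
  have h13 := le_trans h₂ h₃
  have h03 := le_trans h₁ h13
  by_cases hD : ∃ I, I ∈ σ₃.D
  swap
  · exact Can.of_empty (not_exists.1 hD)
  -- A representative input; the list of candidate cells and their sides are taken from it and agree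
  -- with those of all other inputs at this node.
  obtain ⟨J, hJ⟩ := hD
  have hb₃ := hb.mono h03
  have hp₃ := hp.mono h03
  have hF₃ := hF.mono h13
  have hg₃ : ∀ I ∈ σ₃.D, I.1.Good (p I) := fun I hI => hg I (h03.2 hI)
  have e1 : ∀ I ∈ σ₃.D, ∀ i j, I.1.s i (p I) + I.1.β j ≤ 0 ↔ J.1.s i (p J) + J.1.β j ≤ 0 :=
    fun I hI i j => ((hab (i, j)).1.mono h₃).iff hI hJ
  have e2 : ∀ I ∈ σ₃.D, ∀ i j, 0 ≤ I.1.s i (p I) + I.1.β j ↔ 0 ≤ J.1.s i (p J) + J.1.β j :=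
    fun I hI i j => ((hab (i, j)).2.mono h₃).iff hI hJ
  have e3 : ∀ I ∈ σ₃.D, ∀ i i', I.1.x i ≤ I.1.x i' ↔ J.1.x i ≤ J.1.x i' :=
    fun I hI i i' => (hb₃.xle i i').iff hI hJ
  have hcand : ∀ I ∈ σ₃.D, I.1.cand (p I) = J.1.cand (p J) := fun I hI =>
    cand_congr (e1 I hI) (e2 I hI) (e3 I hI)
  have hcands : ∀ I ∈ σ₃.D, I.1.cands (p I) = J.1.cands (p J) := fun I hI =>
    cands_congr (reps_congr (e1 I hI) (e2 I hI) (e3 I hI)) (k0.iff hI hJ)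
  set pat := J.1.cand (p J)
  set s := J.1.cands (p J)
  have hcard : s.card ≤ 2 * (r + 1) :=
    (card_cands_le _).trans (by have := hr J (h03.2 hJ); omega)
  refine ((Can.forall_finset (c := 300 * n) s (Q := fun c τ =>
    (∃ q, HavePt τ q ∧ ∀ I ∈ τ.D, I.1.RegionStep (I.1.Cell (pat c.1 c.2)) (p I) (q I)) ∨
        ∀ I ∈ τ.D, ∀ q, ¬ I.1.RegionStep (I.1.Cell (pat c.1 c.2)) (p I) q)
    (fun c _ τ τ' hle h => ?_) fun c hc σ' hle => ?_).le
      (Nat.mul_le_mul_right _ hcard)).bind fun σ₄ h₄ hreg => ?_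
  · rcases h with ⟨q, hq, h⟩ | h
    · exact Or.inl ⟨q, hq.mono hle, fun I hI => h I (hle.2 hI)⟩
    · exact Or.inr fun I hI => h I (hle.2 hI)
  · refine can_region hn (hb₃.mono hle) (hp₃.mono hle) (hF₃.mono hle) _
      (fun I hI => hg₃ I (hle.2 hI)) (fun I hI => ?_) fun I hI => ?_
    · rw [← hcand I (hle.2 hI)]
      refine strictIn_cand (hg₃ I (hle.2 hI)).1 _ (ok_of_mem_cands (I := I.1) ?_).2
      rw [hcands I (hle.2 hI)]; exact hc
    · rw [← hcand I (hle.2 hI)]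
      exact mem_Cell_cand (hg₃ I (hle.2 hI)).1 _ _
  by_cases hex : ∃ c ∈ s, ∃ q, HavePt σ₄ q ∧
      ∀ I ∈ σ₄.D, I.1.RegionStep (I.1.Cell (pat c.1 c.2)) (p I) (q I)
  · obtain ⟨c, -, q, hq, h⟩ := hex
    exact Can.le (Can.pure (Or.inl ⟨q, hq, fun I hI => ⟨_, Or.inl (h I hI)⟩⟩)) (Nat.zero_le _)
  have hno : ∀ I ∈ σ₄.D, ∀ Γ q, ¬ I.1.RegionStep Γ (p I) q := by
    intro I hI Γ q h
    obtain ⟨above, rfl, z, hz⟩ := isRegion_iff.1 h.1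
    obtain ⟨c, hc, rfl⟩ := exists_cand hz h.2.1
    rw [hcands I (h₄.2 hI)] at hc
    rw [hcand I (h₄.2 hI)] at h
    rcases hreg c hc with h' | h'
    · exact hex ⟨c, hc, h'⟩
    · exact h' I hI q h
  let k : Fin n → Bool → Fin n → Fin 3 := fun a o => J.1.kform (pat (some a) o)
  have hk : ∀ I ∈ σ₃.D, ∀ a o, I.1.kform (I.1.cand (p I) (some a) o) = k a o := fun I hI a o => by
    rw [hcand I hI]; exact kform_congr (hb₃.big.iff hI hJ) _
  let B : Fin n → Bool → Adm n → ℝ := fun a o I => I.1.quadB (k a o) (p I) (sdir o (I.1.x a))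
  let q : Fin n → Bool → Adm n → ℝ × ℝ := fun a o I => ray (p I) (sdir o (I.1.x a))
    (-B a o I / (2 * I.1.quadA (k a o) (sdir o (I.1.x a))))
  refine ((Can.forall_finset (c := 38 * n + 40) s (Q := fun c τ => ∀ a, c.1 = some a →
    (τ.Known fun I => 0 ≤ B a c.2 I) ∧ HavePt τ (q a c.2) ∧
      τ.Have fun I => sqDist (p I) (q a c.2 I)) (fun c _ τ τ' hle h a ha => ?_)
      fun c hc σ' hle => ?_).le (Nat.mul_le_mul_right _ hcard)).bind fun σ₅ h₅ hray => ?_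
  · exact ⟨(h a ha).1.mono hle, (h a ha).2.1.mono hle, (h a ha).2.2.mono hle⟩
  · obtain ⟨_ | a, o⟩ := c
    · exact Can.le (Can.pure (by simp)) (Nat.zero_le _)
    have l₀ := le_trans h₄ hle
    have hb' := hb₃.mono l₀
    have hp' := hp₃.mono l₀
    refine Can.le (c := 5 + ((15 * n + 2) + ((23 * n + 15) + (2 + (5 + (4 + 7)))))) ?_ (by omega)
    refine (can_sdir hb' o a).bind fun τ₁ l₁ hd => ?_
    refine (cheap_quadA (hb'.mono l₁) (k a o) hd).can.bind fun τ₂ l₂ hA => ?_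
    have l₀₂ := le_trans l₁ l₂
    refine (cheap_quadB (hb'.mono l₀₂) (k a o) (hp'.mono l₀₂) (hd.mono l₂)).can.bind
      fun τ₃ l₃ hB => ?_
    refine (Cheap.nonneg (c := 0) hB.cheap).bind fun τ₄ l₄ kB => ?_
    have l₂₄ := le_trans l₃ l₄
    have l₀₄ := le_trans l₀₂ l₂₄
    have hτ := (((hB.mono l₄).cheap (R := R)).neg.div ((Cheap.natCast 2).mul
      (hA.mono l₂₄).cheap))
    refine (hτ.can.le (by norm_num : _ ≤ 5)).bind fun τ₅ l₅ ht => ?_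
    have l₀₅ := le_trans l₀₄ l₅
    refine (can_ray (hp'.mono l₀₅) (hd.mono (le_trans l₂ (le_trans l₂₄ l₅))) ht).bind
      fun τ₆ l₆ hq => ?_
    have hq : HavePt τ₆ (q a o) := by simpa [q, B, HavePt] using hq
    have hp₆ := hp'.mono (le_trans l₀₅ l₆)
    refine (((hp₆.1.cheap.sub hq.1.cheap).sq.add (hp₆.2.cheap.sub hq.2.cheap).sq).can).imp
      fun τ₇ l₇ hs => ?_
    intro a' ha'
    obtain rfl : a = a' := by simpa using ha'
    exact ⟨kB.mono (le_trans l₅ (le_trans l₆ l₇)), hq.mono l₇, hs⟩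
  classical
  -- The rays with negative initial slope, which are exactly those carrying a critical point.
  let S : Finset (Option (Fin n) × Bool) := s.filter fun c =>
    ∃ a, c.1 = some a ∧ ∀ I ∈ σ₅.D, ¬ 0 ≤ B a c.2 I
  have h35 := le_trans h₄ h₅
  have hcrit : ∀ I ∈ σ₅.D, ∀ e q', I.1.RayCritical e (p I) q' →
      ∃ c ∈ S, ∃ a, c.1 = some a ∧ q' = q a c.2 I := by
    intro I hI e q' h
    have hI3 := h35.2 hI
    obtain ⟨a, o, hmem, hneg, hq'⟩ := h.exists_sdir I.2.1 I.2.2 (hg₃ I hI3)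
    rw [hcands I hI3] at hmem
    rw [hk I hI3] at hneg hq'
    refine ⟨(some a, o), Finset.mem_filter.2 ⟨hmem, a, rfl, ?_⟩, a, rfl, hq'⟩
    exact (hray _ hmem a rfl).1.resolve_left fun h => absurd (h I hI) (not_le.2 hneg)
  rcases S.eq_empty_or_nonempty with hSe | hSn
  · refine Can.le (Can.pure (Or.inr fun I hI => ⟨hno I (h₅.2 hI), fun e q' h => ?_⟩))
      (Nat.zero_le _)
    obtain ⟨c, hc, -⟩ := hcrit I hI e q' h
    simp [hSe] at hc
  let u : Option (Fin n) × Bool → Adm n → ℝ := fun c I =>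
    c.1.elim 0 fun a => sqDist (p I) (q a c.2 I)
  refine ((Can.argmin S hSn (u := u) fun c hc => ?_).le
    ((Finset.card_filter_le _ _).trans hcard)).imp fun σ₆ h₆ hmin => ?_
  · obtain ⟨hcs, a, hca, -⟩ := Finset.mem_filter.1 hc
    have := (hray c hcs a hca).2.2
    simpa only [u, hca, Option.elim] using this
  obtain ⟨c, hcS, hmin⟩ := hmin
  obtain ⟨hcs, a, hca, hneg⟩ := Finset.mem_filter.1 hcS
  refine Or.inl ⟨q a c.2, (hray c hcs a hca).2.1.mono h₆, fun I hI => ?_⟩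
  have hI5 := h₆.2 hI
  have hI3 := h35.2 hI5
  have hmem : (some a, c.2) ∈ I.1.cands (p I) := by
    rw [hcands I hI3, ← hca]; exact hcs
  have hok := ok_of_mem_cands hmem
  have hneg := not_le.1 (hneg I hI5)
  obtain ⟨e, he⟩ := rayCritical_sdir I.2.1 I.2.2 (hg₃ I hI3) (thru_of_mem_reps (hok.1 a rfl)) hok.2
    (by rw [hk I hI3]; exact hneg)
  rw [hk I hI3] at he
  refine ⟨e, Or.inr ⟨hno I (h₅.2 hI5), he, fun e' q' h' => ?_⟩⟩
  obtain ⟨c', hc', a', hca', rfl⟩ := hcrit I hI5 e' q' h'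
  have := hmin c' hc' I hI
  simpa only [u, hca, hca', Option.elim] using this

end Newsvendor

/-! ### Prefix sums and merging -/

/-- The sum of the first `r` terms. -/
def prefixSum {n : ℕ} (u : Fin n → ℝ) (r : ℕ) : ℝ := ∑ l, if l.val < r then u l else 0

lemma prefixSum_zero {n : ℕ} (u : Fin n → ℝ) : prefixSum u 0 = 0 := by simp [prefixSum]

lemma prefixSum_succ {n : ℕ} (u : Fin n → ℝ) {r : ℕ} (hr : r < n) :
    prefixSum u (r + 1) = prefixSum u r + u ⟨r, hr⟩ := by
  have : u ⟨r, hr⟩ = ∑ l, if l = ⟨r, hr⟩ then u l else 0 := by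
    rw [Finset.sum_ite_eq' Finset.univ]; simp
  rw [prefixSum, prefixSum, this, ← Finset.sum_add_distrib]
  refine Finset.sum_congr rfl fun l _ => ?_
  rcases lt_trichotomy l.val r with h | h | h
  · rw [if_pos (by omega), if_pos h, if_neg (fun e => by rw [e] at h; exact lt_irrefl _ h), add_zero]
  · obtain rfl : l = ⟨r, hr⟩ := Fin.ext h
    simp
  · rw [if_neg (by omega), if_neg (by omega),
      if_neg (fun e => by rw [e] at h; exact lt_irrefl _ h), add_zero]

lemma sum_three_pieces {n : ℕ} (A B C : Fin n → ℝ) {a b : ℕ} (hab : a ≤ b) :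
    ∑ l : Fin n, (if l.val < a then A l else if l.val < b then B l else C l) =
      prefixSum A a + (prefixSum B b - prefixSum B a) + (prefixSum C n - prefixSum C b) := by
  simp only [prefixSum, ← Finset.sum_sub_distrib, ← Finset.sum_add_distrib]
  refine Finset.sum_congr rfl fun l _ => ?_
  have := l.2
  by_cases h1 : l.val < a
  · have h2 : l.val < b := by omega
    simp [h1, h2]
  · by_cases h2 : l.val < b <;> simp [h1, h2]

/-- A sum of squares of shifted terms in terms of power sums. -/
lemma prefixSum_quadratic {n : ℕ} (y : Fin n → ℝ) (a g d h : ℝ) (r : ℕ) :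
    prefixSum (fun l => (a * y l + g) ^ 2 / d + h) r =
      (a ^ 2 * prefixSum (fun l => y l ^ 2) r + 2 * a * g * prefixSum y r +
        g ^ 2 * prefixSum (fun _ : Fin n => 1) r) / d + h * prefixSum (fun _ : Fin n => 1) r := by
  simp only [prefixSum, Finset.mul_sum, ← Finset.sum_add_distrib, Finset.sum_div]
  refine Finset.sum_congr rfl fun l _ => ?_
  split_ifs <;> ring

lemma prefixSum_const {n : ℕ} (h : ℝ) (r : ℕ) :
    prefixSum (fun _ : Fin n => h) r = h * prefixSum (fun _ : Fin n => 1) r := by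
  simp only [prefixSum, Finset.mul_sum]
  refine Finset.sum_congr rfl fun l _ => ?_
  split_ifs <;> ring

namespace Ctx

variable {Ω : Type} {R : Ω → List ℝ → Prop} {σ : Ctx Ω}

lemma can_prefixSum {n c : ℕ} {u : Fin n → Ω → ℝ} (hu : ∀ l, Cheap R σ c (u l)) :
    Can R σ (n * (c + 1) + 1) fun τ => ∀ r ≤ n, τ.Have fun ω => prefixSum (fun l => u l ω) r := by
  have : ∀ m ≤ n, Can R σ (m * (c + 1) + 1) fun τ =>
      ∀ r ≤ m, τ.Have fun ω => prefixSum (fun l => u l ω) r := by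
    intro m
    induction m with
    | zero =>
      intro _
      refine ((Cheap.natCast 0).can.le (by omega)).imp fun τ _ h r hr => ?_
      obtain rfl : r = 0 := by omega
      exact h.congr fun ω _ => by rw [prefixSum_zero]; simp
    | succ m ih =>
      intro hm
      refine ((ih (by omega)).bind (d := c + 1) fun σ₁ h₁ hs => ?_).le
        (by rw [Nat.succ_mul]; omega)
      refine (((hs m le_rfl).cheap.add ((hu ⟨m, hm⟩).mono h₁)).can.le (by omega)).imp
        fun τ hτ h r hr => ?_
      rcases Nat.lt_or_ge m r with h' | h'
      · obtain rfl : r = m + 1 := by omega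
        exact h.congr fun ω _ => (prefixSum_succ _ _).symm
      · exact (hs r h').mono hτ
  exact this n le_rfl

/-- Merging two sorted sequences gives the ranks of the terms of one in the other. -/
lemma can_ranks {n m : ℕ} {y : Fin n → Ω → ℝ} {t : Fin m → Ω → ℝ} (hy : ∀ l, σ.Have (y l))
    (ht : ∀ i, σ.Have (t i)) (hy' : ∀ ω ∈ σ.D, Monotone fun l => y l ω)
    (ht' : ∀ ω ∈ σ.D, Monotone fun i => t i ω) :
    Can R σ (n + m) fun τ => ∃ r : Fin m → ℕ, ∀ i, r i ≤ n ∧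
      ∀ ω ∈ τ.D, ∀ l, y l ω ≤ t i ω ↔ l.val < r i := by
  -- Induction on the number of moves left in the merge. Invariant: the first `r` terms of `y` are
  -- at most every `t i'` with `i' ≥ i`.
  have : ∀ N (σ' : Ctx Ω), σ ≤ σ' → ∀ i r, i ≤ m → r ≤ n → (m - i) + (n - r) ≤ N →
      (∀ l : Fin n, l.val < r → ∀ i' : Fin m, i ≤ i'.val → ∀ ω ∈ σ'.D, y l ω ≤ t i' ω) →
      Can R σ' N fun τ => ∃ r : Fin m → ℕ, ∀ i' : Fin m, i ≤ i'.val → r i' ≤ n ∧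
        ∀ ω ∈ τ.D, ∀ l, y l ω ≤ t i' ω ↔ l.val < r i' := by
    intro N
    induction N with
    | zero =>
      intro σ' _ i r hi hr hN _
      exact Can.pure ⟨fun _ => 0, fun i' hi' => absurd i'.2 (by omega)⟩
    | succ N ih =>
      intro σ' hle i r hi hr hN hinv
      rcases Nat.eq_or_lt_of_le hi with rfl | him
      · exact Can.le (Can.pure ⟨fun _ => 0, fun i' hi' => absurd i'.2 (by omega)⟩) (Nat.zero_le _)
      have next : ∀ σ'', σ' ≤ σ'' → (∀ ω ∈ σ''.D, ∀ l : Fin n,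
          y l ω ≤ t ⟨i, him⟩ ω ↔ l.val < r) →
          Can R σ'' N fun τ => ∃ r : Fin m → ℕ, ∀ i' : Fin m, i ≤ i'.val → r i' ≤ n ∧
            ∀ ω ∈ τ.D, ∀ l, y l ω ≤ t i' ω ↔ l.val < r i' := by
        intro σ'' h'' hrank
        refine (ih σ'' (le_trans hle h'') (i + 1) r him hr (by omega)
          fun l hl i' hi' ω hω => hinv l hl i' (by omega) ω (h''.2 hω)).imp fun τ hτ h => ?_
        obtain ⟨ρ, hρ⟩ := h
        refine ⟨Function.update ρ ⟨i, him⟩ r, fun i' hi' => ?_⟩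
        by_cases e : i' = ⟨i, him⟩
        · subst e
          rw [Function.update_self]
          exact ⟨hr, fun ω hω => hrank ω (hτ.2 hω)⟩
        · rw [Function.update_of_ne e]
          refine hρ i' ?_
          have : i'.val ≠ i := fun h => e (Fin.ext h)
          omega
      rcases Nat.eq_or_lt_of_le hr with rfl | hrn
      · exact (next σ' (le_refl σ') fun ω hω l =>
          iff_of_true (hinv l l.2 ⟨i, him⟩ (_root_.le_refl _) ω hω) l.2).le (by omega)
      rw [Nat.add_comm N 1]
      refine (Can.compare ((hy ⟨r, hrn⟩).mono hle) ((ht ⟨i, him⟩).mono hle)).bind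
        fun σ'' h'' hk => ?_
      have hD := le_trans hle h''
      rcases hk with hk | hk
      · refine ih σ'' hD i (r + 1) hi hrn (by omega) fun l hl i' hi' ω hω => ?_
        have h1 : y l ω ≤ y ⟨r, hrn⟩ ω := hy' ω (hD.2 hω) (Fin.le_def.2 (by simp; omega))
        have h2 : t ⟨i, him⟩ ω ≤ t i' ω := ht' ω (hD.2 hω) (Fin.le_def.2 hi')
        exact h1.trans ((hk ω hω).trans h2)
      · refine next σ'' h'' fun ω hω l => ⟨fun h => ?_, fun h =>
          hinv l h ⟨i, him⟩ (_root_.le_refl _) ω (h''.2 hω)⟩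
        by_contra hlr
        have h1 : y ⟨r, hrn⟩ ω ≤ y l ω := hy' ω (hD.2 hω) (Fin.le_def.2 (by simp; omega))
        exact hk ω hω (h1.trans h)
  refine (this (n + m) σ (le_refl σ) 0 0 (Nat.zero_le _) (Nat.zero_le _) (by omega)
    fun l hl => absurd hl (by omega)).imp fun τ _ h => ?_
  obtain ⟨r, hr⟩ := h
  exact ⟨r, fun i => hr i (Nat.zero_le _)⟩

/-- Merging with a sequence that is sorted in either direction. -/
lemma can_ranks_of_antitone {n m : ℕ} {y : Fin n → Ω → ℝ} {t : Fin m → Ω → ℝ}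
    (hy : ∀ l, σ.Have (y l)) (ht : ∀ i, σ.Have (t i)) (hy' : ∀ ω ∈ σ.D, Monotone fun l => y l ω)
    (ht' : ∀ ω ∈ σ.D, Antitone fun i => t i ω) :
    Can R σ (n + m) fun τ => ∃ r : Fin m → ℕ, ∀ i, r i ≤ n ∧
      ∀ ω ∈ τ.D, ∀ l, y l ω ≤ t i ω ↔ l.val < r i := by
  refine (can_ranks (t := fun i => t i.rev) hy (fun i => ht _) hy'
    fun ω hω i i' h => ht' ω hω (Fin.rev_le_rev.2 h)).imp fun τ _ h => ?_
  obtain ⟨r, hr⟩ := h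
  exact ⟨fun i => r i.rev, fun i => by simpa using hr i.rev⟩

end Ctx

namespace Newsvendor

open Ctx

variable {n : ℕ} {I : Newsvendor n} {R : Adm n → List ℝ → Prop} {σ : Ctx (Adm n)}

/-! ### The initial search point -/

variable (I) in
/-- The common point of the lines with indices `(i, j)` and `(i', j')`. -/
noncomputable def cross (i : Fin n) (j : Fin 4) (i' : Fin n) (j' : Fin 4) : ℝ × ℝ :=
  ((I.β j' - I.β j) / (2 * (I.x i - I.x i')),
    2 * ((I.β j' - I.β j) / (2 * (I.x i - I.x i'))) * I.x i + I.β j)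

lemma isVertex_cross {i i' : Fin n} {j j' : Fin 4} (hβ : I.β j < I.β j') (hx : I.x i' < I.x i) :
    I.IsVertex (I.cross i j i' j') := by
  have h1 : 0 < I.x i - I.x i' := sub_pos.2 hx
  have h2 : 0 < I.β j' - I.β j := sub_pos.2 hβ
  refine isVertex_iff.2 ⟨by simp only [cross]; positivity, i, j, by simp [s, cross],
    Or.inr ⟨i', j', ?_, hx.ne⟩⟩
  simp only [s, cross]
  field_simp
  ring

/-- Off the axis `2 λ₁ (x_i - x_i') = β_j' - β_j` with `λ₁ > 0`, so the lines can be ordered to make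
both differences positive. These are the conditions tested in the search for the start. -/
lemma IsVertex.eq_axis_or_cross {v : ℝ × ℝ} (hv : I.IsVertex v) :
    (∃ j, v = (0, I.β j)) ∨ ∃ i j i' j', I.β j < I.β j' ∧ I.x i' < I.x i ∧
      v = I.cross i j i' j' := by
  have key : ∀ i j i' j', 0 < v.1 → I.s i v + I.β j = 0 → I.s i' v + I.β j' = 0 →
      I.x i' < I.x i → ∃ i j i' j', I.β j < I.β j' ∧ I.x i' < I.x i ∧ v = I.cross i j i' j' := by
    intro i j i' j' h0 h h' hx
    simp only [s] at h h'
    have hx' := sub_pos.2 hx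
    have h1 : v.1 = (I.β j' - I.β j) / (2 * (I.x i - I.x i')) := by
      field_simp; linarith
    refine ⟨i, j, i', j', by nlinarith, hx, Prod.ext h1 ?_⟩
    rw [cross, ← h1]
    linarith
  obtain ⟨h0, i, j, h, h0' | ⟨i', j', h', hx⟩⟩ := isVertex_iff.1 hv
  · refine Or.inl ⟨j, Prod.ext h0' ?_⟩
    simp only [s, h0'] at h
    simp only
    linarith
  · rcases h0.eq_or_lt with h0' | h0'
    · refine Or.inl ⟨j, Prod.ext h0'.symm ?_⟩
      simp only [s, ← h0'] at h
      simp only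
      linarith
    · rcases lt_or_gt_of_ne hx with hx | hx
      · exact Or.inr (key i j i' j' h0' h h' hx)
      · exact Or.inr (key i' j' i j h0' h' h hx)

/-- The side of a line on which a crossing point lies, as a comparison of observations. -/
lemma s_cross_le_iff {i i' l : Fin n} {j j' k : Fin 4} (hβ : I.β j < I.β j')
    (hx : I.x i' < I.x i) : I.s l (I.cross i j i' j') + I.β k ≤ 0 ↔
      I.x l ≤ I.x i + (I.β k - I.β j) / (I.β j' - I.β j) * (I.x i' - I.x i) := by
  have h1 : 0 < I.x i - I.x i' := sub_pos.2 hx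
  have h2 : 0 < I.β j' - I.β j := sub_pos.2 hβ
  have e : I.s l (I.cross i j i' j') + I.β k = (I.β j' - I.β j) / (I.x i - I.x i') *
      (I.x l - (I.x i + (I.β k - I.β j) / (I.β j' - I.β j) * (I.x i' - I.x i))) := by
    simp only [s, cross]
    field_simp
    ring
  have hpos : 0 < (I.β j' - I.β j) / (I.x i - I.x i') := by positivity
  rw [e, ← sub_nonpos (a := I.x l)]
  exact ⟨fun h => by_contra fun h' => absurd h (not_le.2 (mul_pos hpos (not_le.1 h'))),
    fun h => mul_nonpos_of_nonneg_of_nonpos hpos.le h⟩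

open Classical in
/-- The index of the intercept above which the last functional form holds. -/
noncomputable def theta' (I : Newsvendor n) : Fin 4 := if I.Big then 2 else 3

open Classical in
lemma phi_eq_ite (hI : I.Admissible) (t : ℝ) :
    I.phi t = if t + I.β I.theta ≤ 0 then I.c₂ * I.Q
      else if t + I.β I.theta' ≤ 0 then (t - I.c₂) ^ 2 / (4 * I.ξ) + I.c₂ * I.Q
      else (t + I.c₁) ^ 2 / (4 * I.ξ) + -(I.c₁ * I.Q) := by
  split_ifs with h1 h2
  · exact phi_of_theta_le hI h1
  · by_cases hb : I.Big
    · rw [theta, if_pos hb] at h1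
      rw [theta', if_pos hb] at h2
      exact phi_of_big_mid hI (not_le.1 h1).le h2
    · rw [theta, if_neg hb] at h1
      rw [theta', if_neg hb] at h2
      exact absurd h2 h1
  · by_cases hb : I.Big
    · rw [theta, if_pos hb] at h1
      rw [theta', if_pos hb] at h2
      exact phi_of_big_ge hI (not_le.1 h1).le (not_le.1 h2).le
    · rw [theta, if_neg hb] at h1
      exact phi_of_not_big_ge hI hb (not_le.1 h1).le

variable (I) in
/-- The objective in terms of power sums `S₀, S₁, S₂` of the sorted observations and the ranks
`a ≤ b` at which the functional form changes. -/
noncomputable def rankValue (S₀ S₁ S₂ : ℕ → ℝ) (a b : ℕ) (v : ℝ × ℝ) : ℝ :=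
  let piece (g h : ℝ) (r : ℕ) : ℝ := ((2 * v.1) ^ 2 * S₂ r + 2 * (2 * v.1) * g * S₁ r +
    g ^ 2 * S₀ r) / (4 * I.ξ) + h * S₀ r
  I.lin v + I.w * (I.c₂ * I.Q * S₀ a +
    (piece (-v.2 - I.c₂) (I.c₂ * I.Q) b - piece (-v.2 - I.c₂) (I.c₂ * I.Q) a) +
    (piece (-v.2 + I.c₁) (-(I.c₁ * I.Q)) n - piece (-v.2 + I.c₁) (-(I.c₁ * I.Q)) b))

/-- At the given point the forms occupy consecutive blocks of the sorted observations. The constant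
form has priority in `phi_eq_ite`, hence the second block ends at `max a b`, and no comparison of
`a` and `b` has to be proved. -/
lemma F_eq_rankValue (hI : I.Admissible) (π : Equiv.Perm (Fin n)) {v : ℝ × ℝ} {a b : ℕ}
    (ha : ∀ l : Fin n, I.s (π l) v + I.β I.theta ≤ 0 ↔ l.val < a)
    (hb : ∀ l : Fin n, I.s (π l) v + I.β I.theta' ≤ 0 ↔ l.val < b) :
    I.F v = I.rankValue (prefixSum fun _ : Fin n => 1) (prefixSum fun l => I.x (π l))
      (prefixSum fun l => I.x (π l) ^ 2) a (max a b) v := by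
  have h1 : ∑ i, I.phi (I.s i v) = ∑ l : Fin n, (if l.val < a then I.c₂ * I.Q
      else if l.val < max a b then (2 * v.1 * I.x (π l) + (-v.2 - I.c₂)) ^ 2 / (4 * I.ξ) +
        I.c₂ * I.Q
      else (2 * v.1 * I.x (π l) + (-v.2 + I.c₁)) ^ 2 / (4 * I.ξ) + -(I.c₁ * I.Q)) := by
    rw [← Equiv.sum_comp π]
    refine Finset.sum_congr rfl fun l _ => ?_
    rw [phi_eq_ite hI]
    simp only [ha, hb]
    by_cases h1 : l.val < a
    · simp only [h1, if_true]
    · have : l.val < max a b ↔ l.val < b := by rw [lt_max_iff]; tauto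
      simp only [h1, if_false, this, s]
      have e1 : 2 * v.1 * I.x (π l) - v.2 - I.c₂ = 2 * v.1 * I.x (π l) + (-v.2 - I.c₂) := by ring
      have e2 : 2 * v.1 * I.x (π l) - v.2 + I.c₁ = 2 * v.1 * I.x (π l) + (-v.2 + I.c₁) := by ring
      rw [e1, e2]
  rw [F_eq hI, h1, sum_three_pieces _ _ _ (le_max_left a b)]
  simp only [prefixSum_quadratic, prefixSum_const (I.c₂ * I.Q), rankValue]

lemma cheap_rankValue (hb : Base σ) {S₀ S₁ S₂ : ℕ → Adm n → ℝ}
    (h₀ : ∀ r ≤ n, σ.Have (S₀ r)) (h₁ : ∀ r ≤ n, σ.Have (S₁ r)) (h₂ : ∀ r ≤ n, σ.Have (S₂ r))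
    {a b : ℕ} (ha : a ≤ n) (hbn : b ≤ n) {v : Adm n → ℝ × ℝ} (hv : HavePt σ v) :
    Cheap R σ 200 fun I => I.1.rankValue (fun r => S₀ r I) (fun r => S₁ r I) (fun r => S₂ r I)
      a b (v I) := by
  have piece : ∀ {g h : Adm n → ℝ}, Cheap R σ 4 g → Cheap R σ 3 h → ∀ r ≤ n, Cheap R σ 40 fun I =>
      ((2 * (v I).1) ^ 2 * S₂ r I + 2 * (2 * (v I).1) * g I * S₁ r I + g I ^ 2 * S₀ r I) /
        (4 * I.1.ξ) + h I * S₀ r I := by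
    intro g h hg hh r hr
    have h2v : Cheap R σ 2 fun I => 2 * (v I).1 :=
      ((Cheap.natCast 2).mul hv.1.cheap).congr fun I _ => by simp
    have := ((((h2v.sq.mul (h₂ r hr).cheap).add ((((Cheap.natCast 2).mul h2v).mul hg).mul
      (h₁ r hr).cheap)).add (hg.sq.mul (h₀ r hr).cheap)).div
      ((Cheap.natCast 4).mul hb.ξ.cheap)).add (hh.mul (h₀ r hr).cheap)
    exact (this.congr fun I _ => by simp).le (by norm_num)
  have hg1 : Cheap R σ 4 fun I => -(v I).2 - I.1.c₂ :=
    (hv.2.cheap.neg.sub hb.c₂.cheap).le (by norm_num)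
  have hg2 : Cheap R σ 4 fun I => -(v I).2 + I.1.c₁ :=
    (hv.2.cheap.neg.add hb.c₁.cheap).le (by norm_num)
  have hh1 : Cheap R σ 3 fun I => I.1.c₂ * I.1.Q := (hb.c₂.cheap.mul hb.Q.cheap).le (by norm_num)
  have hh2 : Cheap R σ 3 fun I => -(I.1.c₁ * I.1.Q) :=
    (hb.c₁.cheap.mul hb.Q.cheap).neg.le (by norm_num)
  have := (cheap_lin hb hv).add (hb.w.cheap.mul (((hh1.mul (h₀ a ha).cheap).add
    ((piece hg1 hh1 b hbn).sub (piece hg1 hh1 a ha))).add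
    ((piece hg2 hh2 n le_rfl).sub (piece hg2 hh2 b hbn))))
  exact (this.congr fun I _ => rfl).le (by norm_num)

/-- Ranks of the crossing points of a line with respect to the lines of one intercept. -/
lemma can_crossRanks (hb : Base σ) {π : Equiv.Perm (Fin n)}
    (hπ : ∀ I ∈ σ.D, Monotone fun l => I.1.x (π l)) (i : Fin n) {j j' : Fin 4} (k : Fin 4)
    (hβ : ∀ I ∈ σ.D, I.1.β j < I.1.β j') :
    Can R σ (8 * n) fun τ => ∃ r : Fin n → ℕ, ∀ i', r i' ≤ n ∧ ∀ I ∈ τ.D, ∀ l : Fin n,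
      I.1.x (π l) ≤ I.1.x i + (I.1.β k - I.1.β j) / (I.1.β j' - I.1.β j) *
        (I.1.x (π i') - I.1.x i) ↔ l.val < r i' := by
  refine Can.le (c := n * 6 + (n + n)) ?_ (by omega)
  refine ((Can.forall_fintype (c := 6) (Q := fun (i' : Fin n) τ => τ.Have fun I =>
    I.1.x i + (I.1.β k - I.1.β j) / (I.1.β j' - I.1.β j) * (I.1.x (π i') - I.1.x i))
    (fun i' => persistent_have _) fun i' σ' hle => ?_).le (by simp)).bind fun σ₁ h₁ ht => ?_
  · have hb' := hb.mono hle
    exact ((hb'.x i).cheap.add ((((hb'.β k).cheap.sub (hb'.β j).cheap).div ((hb'.β j').cheap.sub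
      (hb'.β j).cheap)).mul ((hb'.x (π i')).cheap.sub (hb'.x i).cheap))).can
  have hy : ∀ l, σ₁.Have fun I => I.1.x (π l) := fun l => (hb.mono h₁).x (π l)
  have hπ₁ : ∀ I ∈ σ₁.D, Monotone fun l => I.1.x (π l) := fun I hI => hπ I (h₁.2 hI)
  -- The thresholds are affine in `x (π i')`, so they are monotone or antitone in `i'` according to
  -- the sign of `β_k - β_j`.
  rcases (hb.mono h₁).βle j k with hk | hk
  · refine can_ranks hy ht hπ₁ fun I hI i₁ i₂ h => ?_
    have h1 := sub_nonneg.2 (hk I hI)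
    have h2 := sub_pos.2 (hβ I (h₁.2 hI))
    have h3 := hπ₁ I hI h
    have h4 : 0 ≤ (I.1.β k - I.1.β j) / (I.1.β j' - I.1.β j) := by positivity
    simp only at h3 ⊢
    nlinarith
  · refine can_ranks_of_antitone hy ht hπ₁ fun I hI i₁ i₂ h => ?_
    have h1 := sub_neg.2 (not_le.1 (hk I hI))
    have h2 := sub_pos.2 (hβ I (h₁.2 hI))
    have h3 := hπ₁ I hI h
    have h4 : (I.1.β k - I.1.β j) / (I.1.β j' - I.1.β j) ≤ 0 :=
      div_nonpos_of_nonpos_of_nonneg h1.le h2.le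
    simp only at h3 ⊢
    nlinarith

lemma theta_congr {I J : Newsvendor n} (h : I.Big ↔ J.Big) :
    I.theta = J.theta ∧ I.theta' = J.theta' := by
  by_cases hJ : J.Big
  · simp only [theta, theta', if_pos hJ, if_pos (h.2 hJ), and_self]
  · simp only [theta, theta', if_neg hJ, if_neg fun hI => hJ (h.1 hI), and_self]

/-- The values at all crossing points are found in constant time each. -/
lemma can_start (hn : 1 ≤ n) (hb : Base σ) : Can R σ (5000 * n ^ 2) fun τ =>
    ∃ p, HavePt τ p ∧ ∀ I ∈ τ.D, I.1.IsStart (p I) := by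
  classical
  by_cases hD : ∃ I, I ∈ σ.D
  swap
  · exact Can.of_empty (not_exists.1 hD)
  obtain ⟨J, hJ⟩ := hD
  let π : Equiv.Perm (Fin n) := Tuple.sort J.1.x
  have hπ : ∀ I ∈ σ.D, Monotone fun l => I.1.x (π l) := fun I hI l l' h =>
    ((hb.xle (π l) (π l')).iff hI hJ).2 (Tuple.monotone_sort J.1.x h)
  have hβ : ∀ I ∈ σ.D, ∀ j j', I.1.β j < I.1.β j' ↔ J.1.β j < J.1.β j' := fun I hI j j' => by
    rw [← not_le, ← not_le, (hb.βle j' j).iff hI hJ]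
  have hx : ∀ I ∈ σ.D, ∀ i i', I.1.x i < I.1.x i' ↔ J.1.x i < J.1.x i' := fun I hI i i' => by
    rw [← not_le, ← not_le, (hb.xle i' i).iff hI hJ]
  have hθ : ∀ I ∈ σ.D, I.1.theta = J.1.theta ∧ I.1.theta' = J.1.theta' := fun I hI =>
    theta_congr (hb.big.iff hI hJ)
  refine Can.le (c := (n * (1 + 1) + 1) + ((n * (0 + 1) + 1) + ((n * (1 + 1) + 1) +
    (n * 64 * (8 * n) + ((n * 4 * (n * 4)) * 210 + (4 * (36 * n + 17) +
      (n * 4 * (n * 4) + 4))))))) ?_ (by nlinarith)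
  refine (can_prefixSum (u := fun (_ : Fin n) _ => 1) fun l =>
    (Cheap.natCast 1).congr fun I _ => by simp).bind fun σ₁ h₁ hS₀ => ?_
  refine (can_prefixSum (u := fun l I => I.1.x (π l)) fun l =>
    ((hb.mono h₁).x (π l)).cheap).bind fun σ₂ h₂ hS₁ => ?_
  have h02 := le_trans h₁ h₂
  refine (can_prefixSum (u := fun l I => I.1.x (π l) ^ 2) fun l =>
    ((hb.mono h02).x (π l)).cheap.sq).bind fun σ₃ h₃ hS₂ => ?_
  have h13 := le_trans h₂ h₃
  have h03 := le_trans h₁ h13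
  -- For each line `(i, j)`, each second intercept `j'` and each threshold intercept `k`, one linear
  -- merge yields the ranks for all `n` crossing points: `64 n` merges in total.
  refine ((Can.forall_fintype (ι := Fin n × Fin 4 × Fin 4 × Fin 4) (c := 8 * n)
    (Q := fun c τ => J.1.β c.2.1 < J.1.β c.2.2.1 → ∃ r : Fin n → ℕ, ∀ i', r i' ≤ n ∧ ∀ I ∈ τ.D,
      ∀ l : Fin n, I.1.x (π l) ≤ I.1.x c.1 + (I.1.β c.2.2.2 - I.1.β c.2.1) /
        (I.1.β c.2.2.1 - I.1.β c.2.1) * (I.1.x (π i') - I.1.x c.1) ↔ l.val < r i')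
    (fun c τ τ' hle h hβ => ?_) fun c σ' hle => ?_).le (by simp)).bind fun σ₄ h₄ hrank => ?_
  · obtain ⟨r, hr⟩ := h hβ
    exact ⟨r, fun i' => ⟨(hr i').1, fun I hI => (hr i').2 I (hle.2 hI)⟩⟩
  · by_cases h : J.1.β c.2.1 < J.1.β c.2.2.1
    · have h0' := le_trans h03 hle
      exact (can_crossRanks (hb.mono h0') (fun I hI => hπ I (h0'.2 hI)) c.1 c.2.2.2
        fun I hI => (hβ I (h0'.2 hI) _ _).2 h).imp fun τ _ hr _ => hr
    · exact Can.le (Can.pure fun h' => absurd h' h) (Nat.zero_le _)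
  have h04 := le_trans h03 h₄
  let V : Fin n × Fin 4 × Fin n × Fin 4 → Adm n → ℝ × ℝ := fun c I =>
    I.1.cross c.1 c.2.1 (π c.2.2.1) c.2.2.2
  let S : Finset (Fin n × Fin 4 × Fin n × Fin 4) := Finset.univ.filter fun c =>
    J.1.β c.2.1 < J.1.β c.2.2.2 ∧ J.1.x (π c.2.2.1) < J.1.x c.1
  have hScard : S.card ≤ n * 4 * (n * 4) :=
    (Finset.card_le_univ S).trans (by simp; nlinarith)
  refine ((Can.forall_finset (c := 210) S (Q := fun c τ => HavePt τ (V c) ∧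
    τ.Have fun I => I.1.F (V c I)) (fun c _ τ τ' hle h => ⟨h.1.mono hle, h.2.mono hle⟩)
    fun c hc σ' hle => ?_).le (Nat.mul_le_mul_right _ hScard)).bind fun σ₅ h₅ hV => ?_
  · obtain ⟨i, j, i', j'⟩ := c
    obtain ⟨-, hjj, hii⟩ := Finset.mem_filter.1 hc
    have h0' := le_trans h04 hle
    have h3' := le_trans h₄ hle
    have hb' := hb.mono h0'
    have hT : Cheap R σ' 5 fun I => (V (i, j, i', j') I).1 :=
      (((hb'.β j').cheap.sub (hb'.β j).cheap).div ((Cheap.natCast 2).mul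
        ((hb'.x i).cheap.sub (hb'.x (π i')).cheap))).congr (fun I _ => by simp [V, cross]) |>.le
        (by norm_num)
    obtain ⟨r₁, hr₁⟩ := hrank (i, j, j', J.1.theta) hjj
    obtain ⟨r₂, hr₂⟩ := hrank (i, j, j', J.1.theta') hjj
    refine Can.le (c := 5 + (4 + 200)) ?_ (by norm_num)
    refine hT.can.bind fun τ₁ l₁ hT => ?_
    have hb₁ := hb'.mono l₁
    have hY : Cheap R τ₁ 4 fun I => (V (i, j, i', j') I).2 :=
      ((((Cheap.natCast 2).mul hT.cheap).mul (hb₁.x i).cheap).add (hb₁.β j).cheap).congr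
        fun I _ => by simp [V, cross]
    refine hY.can.bind fun τ₂ l₂ hY => ?_
    have hv : HavePt τ₂ (V (i, j, i', j')) := ⟨hT.mono l₂, hY⟩
    have l₀₂ := le_trans l₁ l₂
    have h32 := le_trans h3' l₀₂
    have h42 := le_trans hle l₀₂
    refine (cheap_rankValue (hb₁.mono l₂)
      (fun r hr => (hS₀ r hr).mono (le_trans h13 h32))
      (fun r hr => (hS₁ r hr).mono (le_trans h₃ h32))
      (fun r hr => (hS₂ r hr).mono h32) (hr₁ i').1 (max_le (hr₁ i').1 (hr₂ i').1) hv).can.imp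
      fun τ₃ l₃ hval => ?_
    refine ⟨hv.mono l₃, hval.congr fun I hI => ?_⟩
    have hI4 := h42.2 (l₃.2 hI)
    have hI0 := h04.2 hI4
    have e1 := (hβ I hI0 j j').2 hjj
    have e2 := (hx I hI0 (π i') i).2 hii
    refine (F_eq_rankValue I.2.1 π (fun l => ?_) fun l => ?_).symm
    · rw [(hθ I hI0).1]
      exact (s_cross_le_iff e1 e2).trans ((hr₁ i').2 I hI4 l)
    · rw [(hθ I hI0).2]
      exact (s_cross_le_iff e1 e2).trans ((hr₂ i').2 I hI4 l)
  refine ((Can.forall_fintype (ι := Fin 4) (c := 36 * n + 17) (Q := fun j τ =>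
    HavePt τ (fun I => (0, I.1.β j)) ∧ τ.Have fun I => I.1.F (0, I.1.β j))
    (fun j τ τ' hle h => ⟨h.1.mono hle, h.2.mono hle⟩) fun j σ' hle => ?_).le (by simp)).bind
    fun σ₆ h₆ hA => ?_
  · have hb' := hb.mono (le_trans h04 (le_trans h₅ hle))
    refine Can.le (c := 1 + (36 * n + 16)) ?_ (by omega)
    refine (Cheap.natCast 0).can.bind fun τ₁ l₁ h0 => ?_
    have hv : HavePt τ₁ fun I => (0, I.1.β j) :=
      ⟨h0.congr fun _ _ => by simp, (hb'.β j).mono l₁⟩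
    exact (cheap_F (hb'.mono l₁) hv).can.imp fun τ₂ l₂ hF => ⟨hv.mono l₂, hF⟩
  let pt : (Fin n × Fin 4 × Fin n × Fin 4) ⊕ Fin 4 → Adm n → ℝ × ℝ :=
    Sum.elim V fun j I => (0, I.1.β j)
  let T : Finset ((Fin n × Fin 4 × Fin n × Fin 4) ⊕ Fin 4) := S.disjSum Finset.univ
  have hT : ∀ c ∈ T, HavePt σ₆ (pt c) ∧ σ₆.Have fun I => I.1.F (pt c I) := by
    rintro (c | j) hc
    · have := hV c (by simpa [T] using hc)
      exact ⟨this.1.mono h₆, this.2.mono h₆⟩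
    · exact hA j
  have hTcard : T.card ≤ n * 4 * (n * 4) + 4 := by
    rw [Finset.card_disjSum]; simpa using hScard
  refine ((Can.argmin T ⟨Sum.inr 0, by simp [T]⟩ fun c hc => (hT c hc).2).le hTcard).imp
    fun τ hτ hmin => ?_
  obtain ⟨c, hc, hmin⟩ := hmin
  refine ⟨pt c, (hT c hc).1.mono hτ, fun I hI => ?_⟩
  have hI0 : I ∈ σ.D := h04.2 (h₅.2 (h₆.2 (hτ.2 hI)))
  refine ⟨?_, fun v hv => ?_⟩
  · rcases c with c | j
    · have := (Finset.mem_filter.1 (by simpa [T] using hc : c ∈ S)).2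
      exact isVertex_cross ((hβ I hI0 _ _).2 this.1) ((hx I hI0 _ _).2 this.2)
    · exact isVertex_axis hn j
  · rcases hv.eq_axis_or_cross with ⟨j, rfl⟩ | ⟨i, j, i', j', h1, h2, rfl⟩
    · exact hmin (Sum.inr j) (by simp [T]) I hI
    · have := hmin (Sum.inl (i, j, π.symm i', j')) (by
        simp only [T, Finset.inl_mem_disjSum, S, Finset.mem_filter, Finset.mem_univ, true_and,
          Equiv.apply_symm_apply]
        exact ⟨(hβ I hI0 _ _).1 h1, (hx I hI0 _ _).1 h2⟩) I hI
      simpa only [pt, Sum.elim_inl, V, Equiv.apply_symm_apply] using this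

end Newsvendor

namespace Newsvendor

open Ctx

variable {n : ℕ}

/-! ### The complete run -/

/-- The output lists the search points of a complete run and the optimal value. -/
def IsOutput (I : Adm n) (l : List ℝ) : Prop :=
  ∃ (K : ℕ) (p : ℕ → ℝ × ℝ) (P : ℕ → Set (ℝ × ℝ)), I.1.IsRun K p P ∧ I.1.Stops (p K) ∧
    l = trace K p ++ [I.1.f]

/-- The points `p 0, …, p K` have been computed and form a run. -/
structure Reached (σ : Ctx (Adm n)) (K : ℕ) (p : ℕ → Adm n → ℝ × ℝ) : Prop where
  base : Base σ
  pt : ∀ k ≤ K, HavePt σ (p k)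
  run : ∀ I ∈ σ.D, ∃ P, I.1.IsRun K (fun k => p k I) P

variable {σ : Ctx (Adm n)} {K : ℕ} {p : ℕ → Adm n → ℝ × ℝ}

lemma IsRun.snoc {I : Newsvendor n} {p : ℕ → ℝ × ℝ} {P : ℕ → Set (ℝ × ℝ)} (h : I.IsRun K p P)
    {X : Set (ℝ × ℝ)} {q : ℝ × ℝ} (hs : I.Step X (p K) q) :
    I.IsRun (K + 1) (fun k => if k ≤ K then p k else q) fun k => if k < K then P k else X := by
  refine ⟨by simpa using h.1, fun k hk => ?_⟩
  rcases Nat.lt_or_ge k K with h' | h'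
  · simp only [if_pos h', if_pos h'.le, if_pos (show k + 1 ≤ K from h')]
    exact h.2 k h'
  · obtain rfl : k = K := by omega
    simpa using hs

lemma Reached.good (h : Reached σ K p) : ∀ I ∈ σ.D, I.1.Good (p K I) := fun I hI => by
  obtain ⟨P, hP⟩ := h.run I hI
  exact hP.good I.2.1 (k := K) le_rfl

lemma Reached.finish (hn : 1 ≤ n) (h : Reached σ K p) (hs : ∀ I ∈ σ.D, I.1.Stops (p K I)) :
    Comp IsOutput σ (2 * (K + 1) + 1 + (36 * n + 16)) := by
  refine (cheap_F h.base (h.pt K le_rfl)).can.finish fun τ hle hF => ?_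
  refine .out (((List.range (K + 1)).flatMap fun k =>
    [fun I => (p k I).1, fun I => (p k I).2]) ++ [fun I => I.1.F (p K I)]) (fun u hu => ?_)
    (fun I hI => ?_) ?_
  · simp only [List.mem_append, List.mem_flatMap, List.mem_range, List.mem_cons,
      List.not_mem_nil, or_false] at hu
    rcases hu with ⟨k, hk, rfl | rfl⟩ | rfl
    · exact ((h.pt k (by omega)).mono hle).1
    · exact ((h.pt k (by omega)).mono hle).2
    · exact hF
  · have hI' := hle.2 hI
    obtain ⟨P, hP⟩ := h.run I hI'
    refine ⟨K, fun k => p k I, P, hP, hs I hI', ?_⟩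
    rw [← F_eq_f_of_stops hn I.2.1 I.2.2 (h.good I hI') (hs I hI'), trace, List.map_append,
      List.map_flatMap]
    rfl
  · simp [List.length_flatMap]
    omega

lemma Reached.advance (hn : 1 ≤ n) (h : Reached σ K p) {r b : ℕ}
    (hr : ∀ I ∈ σ.D, (I.1.reps (p K I)).card ≤ r) (hb : 2 * (K + 1) + 1 + (36 * n + 16) ≤ b)
    (hnext : ∀ (σ' : Ctx (Adm n)) p', Reached σ' (K + 1) p' → Comp IsOutput σ' b) :
    Comp IsOutput σ (b + 1000 * n * (r + 1)) := by
  refine (can_step hn h.base (h.pt K le_rfl) h.good hr).finish fun τ hle hτ => ?_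
  rcases hτ with ⟨q, hq, hs⟩ | hs
  · refine hnext τ (fun k => if k ≤ K then p k else q) ⟨h.base.mono hle, fun k hk => ?_,
      fun I hI => ?_⟩
    · by_cases hkK : k ≤ K
      · simpa only [if_pos hkK] using (h.pt k hkK).mono hle
      · simpa only [if_neg hkK] using hq
    · obtain ⟨P, hP⟩ := h.run I (hle.2 hI)
      obtain ⟨X, hX⟩ := hs I hI
      have e : (fun k => (if k ≤ K then p k else q) I) = fun k => if k ≤ K then p k I else q I := by
        funext k; split_ifs <;> rfl
      exact ⟨_, e ▸ hP.snoc hX⟩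
  · have h' : Reached τ K p := ⟨h.base.mono hle, fun k hk => (h.pt k hk).mono hle,
      fun I hI => h.run I (hle.2 hI)⟩
    exact (h'.finish hn hs).mono hb

lemma Reached.comp (hn : 1 ≤ n) (m : ℕ) : ∀ {σ : Ctx (Adm n)} {K : ℕ} {p : ℕ → Adm n → ℝ × ℝ},
    Reached σ K p → 1 ≤ K → K + m = 16 * n + 2 → Comp IsOutput σ (100 * n + m * (2000 * n)) := by
  induction m with
  | zero =>
    intro σ K p h _ hKm
    -- No input leads here: a run has at most `16 n + 1` passes.
    refine .out [] (by simp) (fun I hI => ?_) (Nat.zero_le _)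
    obtain ⟨P, hP⟩ := h.run I hI
    have := hP.length_le hn I.2.1 I.2.2
    omega
  | succ m ih =>
    intro σ K p h hK hKm
    -- After the first pass the search point is no vertex, so the lines through it have at most one
    -- slope.
    refine (h.advance (r := 1) (b := 100 * n + m * (2000 * n)) hn (fun I hI => ?_) ?_
      fun σ' p' h' => ih h' (by omega) (by omega)).mono ?_
    · obtain ⟨P, hP⟩ := h.run I hI
      exact card_reps_le_one (hP.nonneg (k := K) le_rfl) (hP.not_isVertex I.2.1 (k := K) hK le_rfl)
    · have : 0 ≤ m * (2000 * n) := Nat.zero_le _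
      omega
    · have : (m + 1) * (2000 * n) = m * (2000 * n) + 2000 * n := by ring
      omega

lemma comp_inputCtx (hn : 1 ≤ n) : Comp IsOutput (inputCtx n) (50000 * n ^ 2) := by
  have hb := (can_base (R := IsOutput) hn).finish (d := 100 * n + (16 * n + 1) * (2000 * n) +
    1000 * n * (n + 1) + 5000 * n ^ 2) fun σ _ hb => (can_start hn hb).finish fun τ hle hτ => ?_
  · exact hb.mono (by nlinarith)
  obtain ⟨p, hp, hs⟩ := hτ
  have h0 : Reached τ 0 fun _ => p := ⟨hb.mono hle, fun _ _ => hp, fun I hI =>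
    ⟨fun _ => ∅, hs I hI, fun k hk => absurd hk (Nat.not_lt_zero k)⟩⟩
  -- At the start up to `n` slopes may meet, so this one pass may cost `O(n²)`.
  refine h0.advance hn (fun I _ => card_reps_le _) ?_ fun σ' p' h' =>
    h'.comp hn (16 * n + 1) le_rfl (by omega)
  have : 0 ≤ (16 * n + 1) * (2000 * n) := Nat.zero_le _
  omega

/-- The computation tree of the method. -/
theorem exists_compTree (hn : 1 ≤ n) : ∃ T : CompTree, ∀ I : Newsvendor n, I.Admissible →
    BddBelow (I.F '' halfPlane) → T.cost I.input ≤ 50000 * n ^ 2 ∧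
      ∃ (K : ℕ) (p : ℕ → ℝ × ℝ) (P : ℕ → Set (ℝ × ℝ)), I.IsRun K p P ∧ I.Stops (p K) ∧
        T.result I.input = trace K p ++ [I.f] := by
  obtain ⟨T, hT⟩ := (comp_inputCtx hn).exists_tree
    (List.ofFn (fun i (I : Adm n) => I.1.x i) ++ [fun I => I.1.c₁, fun I => I.1.c₂, fun I => I.1.w,
      fun I => I.1.ξ, fun I => I.1.Q, fun I => I.1.δ, fun I => I.1.μ, fun I => I.1.σ]) (by
      rintro a (⟨i, rfl⟩ | ha)
      · exact List.mem_append_left _ (List.mem_ofFn.2 ⟨i, rfl⟩)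
      · exact List.mem_append_right _ (by simpa using ha))
  refine ⟨T, fun I hI hB => ?_⟩
  have := hT ⟨I, hI, hB⟩ (Set.mem_univ _)
  simp only [List.map_append, List.map_ofFn, List.map_cons, List.map_nil] at this
  exact this

end Newsvendor

/-! ### The theorem, with one constant for all bounds -/

theorem mainTheorem2 :
    ∃ C : ℕ, ∀ n : ℕ, 1 ≤ n →
      -- the method itself, with any resolution of ties
      (∀ I : Newsvendor n, I.Admissible → BddBelow (I.F '' Newsvendor.halfPlane) →
        -- the minimum exists, so `f` is a minimum
        IsLeast (I.F '' Newsvendor.halfPlane) I.f ∧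
        -- the arrangement has `O(n²)` regions and segments
        (I.regions.Finite ∧ I.regions.ncard ≤ C * n ^ 2) ∧
        (I.segments.Finite ∧ I.segments.ncard ≤ C * n ^ 2) ∧
        (I.vertices.Finite ∧ I.vertices.ncard ≤ C * n ^ 2) ∧
        -- the method can be started
        (∃ p, I.IsStart p) ∧
        ∀ (K : ℕ) (p : ℕ → ℝ × ℝ) (P : ℕ → Set (ℝ × ℝ)), I.IsRun K p P →
          -- no region or segment is traversed twice
          Set.InjOn P (Set.Iio K) ∧
          -- `O(n²)` passes through the loop and `O(n²)` searches
          K ≤ C * n ^ 2 ∧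
          I.searchCount K p ≤ C * n ^ 2 ∧
          -- the method stops, with the value `f`, or can go on
          (I.Stops (p K) → I.F (p K) = I.f) ∧
          (¬ I.Stops (p K) → ∃ R q, I.Step R (p K) q)) ∧
      -- the method can be carried out with `O(n²)` operations on real numbers
      ∃ T : CompTree,
        ∀ I : Newsvendor n, I.Admissible → BddBelow (I.F '' Newsvendor.halfPlane) →
          T.cost I.input ≤ C * n ^ 2 ∧
          ∃ (K : ℕ) (p : ℕ → ℝ × ℝ) (P : ℕ → Set (ℝ × ℝ)),
            I.IsRun K p P ∧ I.Stops (p K) ∧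
            T.result I.input = Newsvendor.trace K p ++ [I.f] := by
  refine ⟨50000, fun n hn => ⟨fun I hI hB => ⟨Newsvendor.isLeast_f hn hI hB, ?_, ?_, ?_,
    Newsvendor.exists_isStart hn, fun K p P h => ⟨h.injOn hI hB, ?_, ?_,
      fun hs => Newsvendor.F_eq_f_of_stops hn hI hB (h.good hI le_rfl) hs,
      fun hs => Newsvendor.exists_step_of_not_stops hI hB (h.good hI le_rfl) hs⟩⟩,
    Newsvendor.exists_compTree hn⟩⟩
  · exact ⟨(Newsvendor.regions_bound I hn).1, (Newsvendor.regions_bound I hn).2.trans (by omega)⟩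
  · exact ⟨(Newsvendor.segments_bound I hn).1, (Newsvendor.segments_bound I hn).2.trans (by omega)⟩
  · exact ⟨(Newsvendor.vertices_bound I hn).1, (Newsvendor.vertices_bound I hn).2.trans (by omega)⟩
  · have := h.length_le hn hI hB
    nlinarith
  · exact (h.searchCount_le hn hI hB).trans (by omega)
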